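/- Let $\mathbb K$ be a field of characteristic $0$ and let $(V,F)$ be a DG-pair over $\mathbb K$: $V=\bigoplus_{i\in\mathbb Z}V^i$ is a graded vector space with a differential $d$ of degree $+1$ and $F\subseteq V$ is a graded subspace with $d(F)\subseteq F$. **Notation.** $\overline{x}$ is the degree of a homogeneous element $x$. Let $\operatorname{End}^*(V)=\bigoplus_n\operatorname{Hom}^n(V,V)$ with differential $f\mapsto df-(-1)^{\overline f}fd$, $\operatorname{End}^*(V;F)=\{f\mid f(F)\subseteq F\}$, $\operatorname{Aff}(V)=\operatorname{End}^*(V)\oplus V$ with the associative product $(f,v)(g,u)=(fg,f(u))$, and $\operatorname{Aff}(V;F)=\operatorname{End}^*(V;F)\oplus F$. For a DG associative (or Lie) algebra $A$, $A[s,ds]=A\otimes\mathbb K[s,ds]$ with coefficients written on the left, so that $(a\,p)(b\,q)=(-1)^{\overline p\,\overline b}(ab)(pq)$, and $A[s,t,ds,dt]=A[s,ds][t,dt]$. The DG associative algebra $$TW^{[2]}\Big(\frac{\operatorname{End}^*(V)}{\operatorname{End}^*(V;F)},\frac VF\Big)\subseteq \operatorname{Aff}(V)[s,t,ds,dt]$$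 consists of the pairs $\omega=(a(s,t),m(s,t))$ with $a(0,t)=a(s,0)=0$, $m(0,t)=m(s,0)=m(s,1)=0$, $a(1,t)\in\operatorname{End}^*(V;F)[t,dt]$ and $m(1,t)\in F[t,dt]$. The Jacobian square of $(V,F)$ is the commutative square of DG-Lie algebras (with graded commutators as brackets) with corners $L_{00}=\operatorname{End}^*(V;F)$, $L_{01}=\operatorname{End}^*(V)$, $L_{10}=\operatorname{Aff}(V;F)$, $L_{11}=\operatorname{Aff}(V)$, whose maps $L_{00}\to L_{01}$ and $L_{10}\to L_{11}$ are the inclusions and whose maps $L_{00}\to L_{10}$ and $L_{01}\to L_{11}$ are $f\mapsto(f,0)$. Its Thom-Whitney double fibre is the DG-Lie algebra of the quadruples $(\omega_{00},\omega_{01},\omega_{10},\omega_{11})\in L_{00}\times L_{01}[t,dt]\times L_{10}[t,dt]\times L_{11}[s,t,ds,dt]$ such that $\omega_{01}$, $\omega_{10}$ vanish at $0$ and are equal at $1$ to the image of $\omega_{00}$, $\omega_{11}$ vanishes at $s=0$ and at $t=0$, $\omega_{11}|_{s=1}$ is the image of $\omega_{10}$, and $\omega_{11}|_{t=1}$ is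 the image of $\omega_{01}$ (where the variable of $\omega_{01}$ is called $s$). The complex $V[n]$ has $V[n]^i=V^{n+i}$ and differential $(-1)^nd$; $\frac VF[-2]$ carries the trivial product (and bracket). An $A_\infty$-morphism $A\to B$ of DG associative algebras is a morphism of DG coalgebras $\overline T(A[1])\to\overline T(B[1])$ between the bar constructions, where the codifferential of $\overline T(A[1])$ has components $q_1=-d$ and $q_2(a,b)=(-1)^{\overline a}ab$, with $\overline a$ the degree in $A$; it is given by its components $A[1]^{\otimes n}\to B[1]$, of degree $0$, $n\geq1$. An $L_\infty$-morphism of DG-Lie algebras is defined in the same way through $\overline S(A[1])$ and $q_2(a,b)=(-1)^{\overline a}[a,b]$. Both are quasi-isomorphisms if their linear components are. **Theorem.** For $n\ge 0$ let $$\textstyle\int_\infty\colon \big(\operatorname{Aff}(V)[s,t,ds,dt]\big)^{\otimes n+1}\to \frac VF$$ be the linear map which on $(\operatorname{End}^*(V)[s,ds,t]dt)^{\otimes n}\otimes V[s,ds,t]dt$ is $$a_1p_1(s,t)dt\otimes\cdots\otimes a_np_n(s,t)dt\otimes v\,p_{n+1}(s,t)dt\ \mapsto\ \pm\, a_1a_2\cdots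 a_nv\int_{0\le s\le1}\int_{0\le t_1\le\cdots\le t_{n+1}\le1}p_1(s,t_1)\cdots p_{n+1}(s,t_{n+1})\,dt_1\cdots dt_{n+1}\pmod F,$$ for $a_i\in\operatorname{End}^*(V)$ and $v\in V$ homogeneous and $p_i\in\mathbb K[s,ds,t]$ homogeneous, where $\pm=(-1)^{\sum_{i<l\le n+1}\overline{p_i}\,\overline{a_l}}$ with $\overline{a_{n+1}}:=\overline v$, and which is $0$ on the other direct summands (those where some factor has no $dt$, or where one of the first $n$ factors lies in $V[s,t,ds,dt]$, or the last one in $\operatorname{End}^*(V)[s,t,ds,dt]$). Explicitly, for $p_i=s^{j_i}(ds)^{b_i}t^{k_i}$ with $b_i\in\{0,1\}$, the scalar factor is $\frac{1}{1+\sum_ij_i}\prod_{l=1}^{n+1}\frac1{l+k_1+\cdots+k_l}$ if exactly one $b_i$ equals $1$, and $0$ otherwise. Then: 1. The restrictions of the maps $\int_\infty$, $n\ge0$, are the components of an $A_\infty$ quasi-isomorphism $$TW^{[2]}\Big(\frac{\operatorname{End}^*(V)}{\operatorname{End}^*(V;F)},\frac VF\Big)\longrightarrow\frac VF[-2].$$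 2. The map $(\omega_{00},\omega_{01},\omega_{10},\omega_{11})\mapsto\omega_{11}$ is an isomorphism of DG-Lie algebras from the Thom-Whitney double fibre of the Jacobian square of $(V,F)$ to $TW^{[2]}\big(\operatorname{End}^*(V)/\operatorname{End}^*(V;F),V/F\big)$ with the graded commutator as bracket. Under this identification the symmetrized maps $$x_1\odot\cdots\odot x_n\mapsto\sum_{\sigma\in\Sigma_n}\epsilon(\sigma)\textstyle\int_\infty x_{\sigma(1)}\otimes\cdots\otimes x_{\sigma(n)},$$ where $\epsilon(\sigma)$ is the Koszul sign with respect to the degrees shifted by $1$, are the components of an $L_\infty$ quasi-isomorphism from the Thom-Whitney double fibre of the Jacobian square to $\frac VF[-2]$. -/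

import Mathlib

open scoped TensorProduct Polynomial

/-! ### Differential graded vector spaces -/

/-- A structure of differential graded vector space on `V`: a decomposition `V = ⨁ i, gr i`
indexed by `ℤ`, and a differential of degree `+1`. -/
structure DGSpace (K V : Type*) [Field K] [AddCommGroup V] [Module K V] where
  gr : ℤ → Submodule K V
  isInternal : DirectSum.IsInternal gr
  d : V →ₗ[K] V
  d_mem : ∀ {i : ℤ} {v : V}, v ∈ gr i → d v ∈ gr (i + 1)
  d_d : ∀ v : V, d (d v) = 0

/-- Linear maps commute with signs. -/
theorem map_sign {K V W : Type*} [Field K] [AddCommGroup V] [Module K V] [AddCommGroup W]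
    [Module K W] (f : V →ₗ[K] W) (u : ℤˣ) (v : V) : f (u • v) = u • f v := by
  rw [Units.smul_def, map_zsmul, Units.smul_def]

namespace DGSpace

section basic

variable {K V W : Type*} [Field K] [AddCommGroup V] [Module K V] [AddCommGroup W] [Module K W]

/-- The linear map on `V = ⨁ i, gr i` which is `φ i` on `gr i`. -/
noncomputable def lift (D : DGSpace K V) (φ : ∀ i, D.gr i →ₗ[K] W) : V →ₗ[K] W :=
  DirectSum.toModule K ℤ W φ ∘ₗ
    (LinearEquiv.ofBijective (DirectSum.coeLinearMap D.gr) D.isInternal).symm.toLinearMap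

theorem lift_of_mem (D : DGSpace K V) (φ : ∀ i, D.gr i →ₗ[K] W) {i : ℤ} {v : V}
    (hv : v ∈ D.gr i) : D.lift φ v = φ i ⟨v, hv⟩ := by
  have h : (LinearEquiv.ofBijective (DirectSum.coeLinearMap D.gr) D.isInternal).symm v
      = DirectSum.lof K ℤ (fun i => D.gr i) i ⟨v, hv⟩ := by
    rw [LinearEquiv.symm_apply_eq]
    exact (DirectSum.coeLinearMap_lof D.gr i ⟨v, hv⟩).symm
  simp [lift, h]

theorem iSup_gr (D : DGSpace K V) : ⨆ i, D.gr i = ⊤ :=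
  D.isInternal.submodule_iSup_eq_top

theorem induct (D : DGSpace K V) {P : V → Prop} (v : V) (hom : ∀ i, ∀ v ∈ D.gr i, P v)
    (zero : P 0) (add : ∀ v w, P v → P w → P (v + w)) : P v := by
  have hv : v ∈ ⨆ i, D.gr i := by rw [D.iSup_gr]; trivial
  exact Submodule.iSup_induction D.gr (motive := P) hv hom zero add

/-- The projection onto the homogeneous component of degree `i`. -/
noncomputable def proj (D : DGSpace K V) (i : ℤ) : V →ₗ[K] V :=
  D.lift fun j => if j = i then (D.gr j).subtype else 0

/-- The involution `v ↦ (-1)^{deg v} v`. -/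
noncomputable def sgn (D : DGSpace K V) : V →ₗ[K] V :=
  D.lift fun j => j.negOnePow • (D.gr j).subtype

/-- The linear map `v ↦ (-1)^{i · deg v} v`. -/
noncomputable def twist (D : DGSpace K V) (i : ℤ) : V →ₗ[K] V :=
  D.lift fun j => (i * j).negOnePow • (D.gr j).subtype

theorem proj_self (D : DGSpace K V) {i : ℤ} {v : V} (hv : v ∈ D.gr i) : D.proj i v = v := by
  simp [proj, D.lift_of_mem _ hv]

theorem proj_of_ne (D : DGSpace K V) {i j : ℤ} {v : V} (hv : v ∈ D.gr j) (h : j ≠ i) :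
    D.proj i v = 0 := by
  simp [proj, D.lift_of_mem _ hv, h]

theorem sgn_of_mem (D : DGSpace K V) {i : ℤ} {v : V} (hv : v ∈ D.gr i) :
    D.sgn v = i.negOnePow • v := by
  simp [sgn, D.lift_of_mem _ hv]

theorem twist_of_mem (D : DGSpace K V) (i : ℤ) {j : ℤ} {v : V} (hv : v ∈ D.gr j) :
    D.twist i v = (i * j).negOnePow • v := by
  simp [twist, D.lift_of_mem _ hv]

theorem proj_mem (D : DGSpace K V) (i : ℤ) (v : V) : D.proj i v ∈ D.gr i := by
  refine D.induct (P := fun v => D.proj i v ∈ D.gr i) v ?_ (by simp) ?_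
  · intro j v hv
    by_cases h : j = i
    · subst h; rwa [D.proj_self hv]
    · rw [D.proj_of_ne hv h]; exact zero_mem _
  · intro v w hv hw
    rw [map_add]; exact add_mem hv hw

theorem sgn_d (D : DGSpace K V) (v : V) : D.sgn (D.d v) = - D.d (D.sgn v) := by
  refine D.induct (P := fun v => D.sgn (D.d v) = - D.d (D.sgn v)) v ?_ (by simp) ?_
  · intro i v hv
    rw [D.sgn_of_mem hv, D.sgn_of_mem (D.d_mem hv), Int.negOnePow_succ]
    simp [Units.smul_def]
  · intro v w hv hw
    simp only [map_add, hv, hw]; abel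

theorem sgn_sgn (D : DGSpace K V) (v : V) : D.sgn (D.sgn v) = v := by
  refine D.induct (P := fun v => D.sgn (D.sgn v) = v) v ?_ (by simp) ?_
  · intro i v hv
    rw [D.sgn_of_mem hv, Units.smul_def, map_zsmul, D.sgn_of_mem hv, ← Units.smul_def, smul_smul]
    simp
  · intro v w hv hw
    simp only [map_add, hv, hw]

theorem exists_sum_proj (D : DGSpace K V) (v : V) :
    ∃ s : Finset ℤ, ∀ t : Finset ℤ, s ⊆ t → v = ∑ i ∈ t, D.proj i v := by
  classical
  refine D.induct (P := fun v => ∃ s : Finset ℤ, ∀ t : Finset ℤ, s ⊆ t →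
    v = ∑ i ∈ t, D.proj i v) v ?_ ⟨∅, by simp⟩ ?_
  · intro i v hv
    refine ⟨{i}, fun t ht => ?_⟩
    rw [Finset.sum_eq_single_of_mem i (ht (Finset.mem_singleton_self i))
      (fun j _ hj => D.proj_of_ne hv hj.symm), D.proj_self hv]
  · rintro v w ⟨s, hs⟩ ⟨t, ht⟩
    refine ⟨s ∪ t, fun u hu => ?_⟩
    simp only [map_add, Finset.sum_add_distrib]
    rw [← hs u (Finset.union_subset_left hu), ← ht u (Finset.union_subset_right hu)]

theorem mem_of_proj_mem (D : DGSpace K V) (S : Submodule K V) (v : V)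
    (h : ∀ i, D.proj i v ∈ S) : v ∈ ⨆ i, S ⊓ D.gr i := by
  obtain ⟨s, hs⟩ := D.exists_sum_proj v
  rw [hs s subset_rfl]
  exact sum_mem fun i _ => Submodule.mem_iSup_of_mem i ⟨h i, D.proj_mem i v⟩

/-- A criterion for a family of subspaces to be a grading, in terms of projections. -/
theorem isInternal_of_proj {gr : ℤ → Submodule K V} (π : ℤ → V →ₗ[K] V)
    (h1 : ∀ i, ∀ v ∈ gr i, π i v = v) (h2 : ∀ i j, ∀ v ∈ gr j, j ≠ i → π i v = 0)
    (h3 : ∀ v, v ∈ ⨆ i, gr i) : DirectSum.IsInternal gr := by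
  refine DirectSum.isInternal_submodule_of_iSupIndep_of_iSup_eq_top ?_ (eq_top_iff.2 fun v _ => h3 v)
  intro i
  rw [Submodule.disjoint_def]
  intro v hv hv'
  have : (⨆ j, ⨆ (_ : j ≠ i), gr j) ≤ LinearMap.ker (π i) :=
    iSup₂_le fun j hj v hv => h2 i j v hv hj
  rw [← h1 i v hv]
  exact this hv'

end basic
end DGSpace

/-! ### Morphisms, cohomology, subspaces, quotients, shifts, products -/

namespace DGSpace

section constructions

variable {K V W : Type*} [Field K] [AddCommGroup V] [Module K V] [AddCommGroup W] [Module K W]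

/-- `φ` is a morphism of DG vector spaces. -/
structure IsHom (D : DGSpace K V) (E : DGSpace K W) (φ : V →ₗ[K] W) : Prop where
  map_mem : ∀ {i : ℤ} {v : V}, v ∈ D.gr i → φ v ∈ E.gr i
  map_d : ∀ v : V, φ (D.d v) = E.d (φ v)

theorem IsHom.map_proj {D : DGSpace K V} {E : DGSpace K W} {φ : V →ₗ[K] W} (h : D.IsHom E φ)
    (i : ℤ) (v : V) : φ (D.proj i v) = E.proj i (φ v) := by
  refine D.induct (P := fun v => φ (D.proj i v) = E.proj i (φ v)) v ?_ (by simp) ?_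
  · intro j v hv
    by_cases hj : j = i
    · subst hj; rw [D.proj_self hv, E.proj_self (h.map_mem hv)]
    · rw [D.proj_of_ne hv hj, E.proj_of_ne (h.map_mem hv) hj, map_zero]
  · intro v w hv hw
    simp only [map_add, hv, hw]

theorem IsHom.map_sgn {D : DGSpace K V} {E : DGSpace K W} {φ : V →ₗ[K] W} (h : D.IsHom E φ)
    (v : V) : φ (D.sgn v) = E.sgn (φ v) := by
  refine D.induct (P := fun v => φ (D.sgn v) = E.sgn (φ v)) v ?_ (by simp) ?_
  · intro j v hv
    rw [D.sgn_of_mem hv, E.sgn_of_mem (h.map_mem hv), Units.smul_def, map_zsmul, Units.smul_def]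
  · intro v w hv hw
    simp only [map_add, hv, hw]

/-- The cocycles of degree `i`. -/
def cocycles (D : DGSpace K V) (i : ℤ) : Submodule K V := D.gr i ⊓ LinearMap.ker D.d

/-- The coboundaries of degree `i`. -/
def coboundaries (D : DGSpace K V) (i : ℤ) : Submodule K V := (D.gr (i - 1)).map D.d

/-- The cohomology in degree `i`. -/
abbrev H (D : DGSpace K V) (i : ℤ) : Type _ :=
  D.cocycles i ⧸ (D.coboundaries i).submoduleOf (D.cocycles i)

/-- The map induced in cohomology by a morphism. -/
def IsHom.mapH {D : DGSpace K V} {E : DGSpace K W} {φ : V →ₗ[K] W} (h : D.IsHom E φ) (i : ℤ) :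
    D.H i →ₗ[K] E.H i :=
  Submodule.mapQ _ _
    (φ.restrict (p := D.cocycles i) (q := E.cocycles i) fun v hv =>
      ⟨h.map_mem hv.1, by
        change E.d (φ v) = 0
        rw [← h.map_d, LinearMap.mem_ker.1 hv.2, map_zero]⟩)
    (by
      rintro ⟨v, hv⟩ hv'
      obtain ⟨w, hw, hwv⟩ := hv'
      exact ⟨φ w, h.map_mem hw, by rw [← h.map_d, hwv]; rfl⟩)

/-- `φ` is a quasi-isomorphism: a morphism of DG vector spaces which is bijective in cohomology. -/
def IsQuasiIso (D : DGSpace K V) (E : DGSpace K W) (φ : V →ₗ[K] W) : Prop :=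
  ∃ h : D.IsHom E φ, ∀ i : ℤ, Function.Bijective (h.mapH i)

/-- `S` is a DG subspace: a graded subspace (it contains the homogeneous components of its
elements) which is stable under the differential. -/
structure IsSubspace (D : DGSpace K V) (S : Submodule K V) : Prop where
  proj_mem : ∀ (i : ℤ) {v : V}, v ∈ S → D.proj i v ∈ S
  d_mem : ∀ {v : V}, v ∈ S → D.d v ∈ S

/-- A DG subspace, as a DG vector space. -/
def restrict (D : DGSpace K V) (S : Submodule K V) (h : D.IsSubspace S) : DGSpace K S where
  gr i := (D.gr i).comap S.subtype
  isInternal := by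
    refine isInternal_of_proj (fun i => (D.proj i).restrict fun v hv => h.proj_mem i hv) ?_ ?_ ?_
    · intro i v hv
      exact Subtype.ext (D.proj_self hv)
    · intro i j v hv hj
      exact Subtype.ext (D.proj_of_ne hv hj)
    · intro v
      obtain ⟨s, hs⟩ := D.exists_sum_proj v
      have : v = ∑ i ∈ s, (⟨D.proj i v, h.proj_mem i v.2⟩ : S) := by
        apply Subtype.ext
        rw [AddSubmonoidClass.coe_finsetSum]
        exact hs s subset_rfl
      rw [this]
      exact sum_mem fun i _ => Submodule.mem_iSup_of_mem i (D.proj_mem i v)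
  d := D.d.restrict fun v hv => h.d_mem hv
  d_mem hv := D.d_mem hv
  d_d v := Subtype.ext (D.d_d v)

/-- The quotient of a DG vector space by a DG subspace. -/
def quotient (D : DGSpace K V) (S : Submodule K V) (h : D.IsSubspace S) : DGSpace K (V ⧸ S) where
  gr i := (D.gr i).map S.mkQ
  isInternal := by
    refine isInternal_of_proj (fun i => S.mapQ S (D.proj i) fun v hv => h.proj_mem i hv) ?_ ?_ ?_
    · rintro i _ ⟨v, hv, rfl⟩
      simp [D.proj_self hv]
    · rintro i j _ ⟨v, hv, rfl⟩ hj
      simp [D.proj_of_ne hv hj]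
    · intro v
      rw [← Submodule.map_iSup, D.iSup_gr, Submodule.map_top, Submodule.range_mkQ]
      trivial
  d := S.mapQ S D.d fun v hv => h.d_mem hv
  d_mem := by
    rintro i _ ⟨v, hv, rfl⟩
    exact ⟨D.d v, D.d_mem hv, by simp⟩
  d_d v := by
    obtain ⟨v, rfl⟩ := S.mkQ_surjective v
    simp [D.d_d]

/-- The shifted DG vector space `V[n]`, with `V[n]^i = V^{n+i}` and differential `(-1)^n d`. -/
def shift (D : DGSpace K V) (n : ℤ) : DGSpace K V where
  gr i := D.gr (n + i)
  isInternal := by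
    refine isInternal_of_proj (fun i => D.proj (n + i)) (fun i v hv => D.proj_self hv)
      (fun i j v hv hj => D.proj_of_ne hv (by omega)) ?_
    intro v
    have h : v ∈ ⨆ i, D.gr i := by rw [D.iSup_gr]; trivial
    rwa [← (Equiv.addLeft n).iSup_comp] at h
  d := n.negOnePow • D.d
  d_mem hv := by
    rw [LinearMap.smul_apply, Units.smul_def, ← add_assoc]
    exact zsmul_mem (D.d_mem hv) _
  d_d v := by simp only [LinearMap.smul_apply, map_sign, D.d_d, smul_zero]

/-- The product of two DG vector spaces. -/
def prod (D : DGSpace K V) (E : DGSpace K W) : DGSpace K (V × W) where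
  gr i := (D.gr i).prod (E.gr i)
  isInternal := by
    refine isInternal_of_proj (fun i => (D.proj i).prodMap (E.proj i)) ?_ ?_ ?_
    · intro i v hv
      exact Prod.ext (D.proj_self hv.1) (E.proj_self hv.2)
    · intro i j v hv hj
      exact Prod.ext (D.proj_of_ne hv.1 hj) (E.proj_of_ne hv.2 hj)
    · rintro ⟨v, w⟩
      have h1 : (v, (0 : W)) ∈ ⨆ i, (D.gr i).prod (E.gr i) := by
        refine D.induct (P := fun v => (v, (0 : W)) ∈ ⨆ i, (D.gr i).prod (E.gr i)) v
          (fun i v hv => Submodule.mem_iSup_of_mem i ⟨hv, zero_mem _⟩) (zero_mem _) ?_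
        intro v v' hv hv'
        simpa using add_mem hv hv'
      have h2 : ((0 : V), w) ∈ ⨆ i, (D.gr i).prod (E.gr i) := by
        refine E.induct (P := fun w => ((0 : V), w) ∈ ⨆ i, (D.gr i).prod (E.gr i)) w
          (fun i w hw => Submodule.mem_iSup_of_mem i ⟨zero_mem _, hw⟩) (zero_mem _) ?_
        intro v v' hv hv'
        simpa using add_mem hv hv'
      simpa using add_mem h1 h2
  d := D.d.prodMap E.d
  d_mem hv := ⟨D.d_mem hv.1, E.d_mem hv.2⟩
  d_d v := Prod.ext (D.d_d v.1) (E.d_d v.2)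

end constructions
end DGSpace

/-! ### Differential graded algebras -/

/-- A differential graded algebra structure on `A`, not necessarily unital or associative: a
bilinear product of degree `0` satisfying the graded Leibniz rule. DG associative algebras and
DG-Lie algebras are singled out by `DGAlg.IsAssoc` and `DGAlg.IsLie`. -/
structure DGAlg (K A : Type*) [Field K] [AddCommGroup A] [Module K A] extends DGSpace K A where
  mul : A →ₗ[K] A →ₗ[K] A
  mul_mem : ∀ {i j : ℤ} {a b : A}, a ∈ gr i → b ∈ gr j → mul a b ∈ gr (i + j)
  leibniz : ∀ {i : ℤ} {a : A} (b : A), a ∈ gr i →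
    d (mul a b) = mul (d a) b + i.negOnePow • mul a (d b)

namespace DGAlg

section basic

variable {K A B : Type*} [Field K] [AddCommGroup A] [Module K A] [AddCommGroup B] [Module K B]

/-- The DG algebra is associative. -/
class IsAssoc (𝒜 : DGAlg K A) : Prop where
  mul_assoc : ∀ a b c : A, 𝒜.mul (𝒜.mul a b) c = 𝒜.mul a (𝒜.mul b c)

/-- The DG algebra is a DG-Lie algebra, the product being the bracket: graded skew-symmetry and
graded Jacobi identity. -/
class IsLie (𝒜 : DGAlg K A) : Prop where
  skew : ∀ {i j : ℤ} {a b : A}, a ∈ 𝒜.gr i → b ∈ 𝒜.gr j →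
    𝒜.mul a b = -((i * j).negOnePow • 𝒜.mul b a)
  jacobi : ∀ {i j : ℤ} {a b : A} (c : A), a ∈ 𝒜.gr i → b ∈ 𝒜.gr j →
    𝒜.mul a (𝒜.mul b c) = 𝒜.mul (𝒜.mul a b) c + (i * j).negOnePow • 𝒜.mul b (𝒜.mul a c)

theorem sgn_mul (𝒜 : DGAlg K A) (a b : A) :
    𝒜.sgn (𝒜.mul a b) = 𝒜.mul (𝒜.sgn a) (𝒜.sgn b) := by
  refine 𝒜.induct (P := fun a => 𝒜.sgn (𝒜.mul a b) = 𝒜.mul (𝒜.sgn a) (𝒜.sgn b)) a ?_ (by simp) ?_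
  · intro i a ha
    refine 𝒜.induct (P := fun b => 𝒜.sgn (𝒜.mul a b) = 𝒜.mul (𝒜.sgn a) (𝒜.sgn b)) b ?_ (by simp) ?_
    · intro j b hb
      rw [𝒜.sgn_of_mem ha, 𝒜.sgn_of_mem hb, 𝒜.sgn_of_mem (𝒜.mul_mem ha hb), Int.negOnePow_add]
      simp only [map_sign, LinearMap.smul_apply, mul_smul]
    · intro v w hv hw
      simp only [map_add, hv, hw]
  · intro v w hv hw
    simp only [map_add, LinearMap.add_apply, hv, hw]

/-- `φ` is a morphism of DG algebras. -/
structure IsHom (𝒜 : DGAlg K A) (ℬ : DGAlg K B) (φ : A →ₗ[K] B) : Prop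
    extends 𝒜.toDGSpace.IsHom ℬ.toDGSpace φ where
  map_mul : ∀ a b : A, φ (𝒜.mul a b) = ℬ.mul (φ a) (φ b)

/-- `S` is a DG subalgebra. -/
structure IsSubalgebra (𝒜 : DGAlg K A) (S : Submodule K A) : Prop
    extends 𝒜.toDGSpace.IsSubspace S where
  mul_mem : ∀ {a b : A}, a ∈ S → b ∈ S → 𝒜.mul a b ∈ S

/-- A DG subalgebra, as a DG algebra. -/
def restrict (𝒜 : DGAlg K A) (S : Submodule K A) (h : 𝒜.IsSubalgebra S) : DGAlg K S where
  toDGSpace := 𝒜.toDGSpace.restrict S h.toIsSubspace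
  mul := LinearMap.mk₂ K (fun a b => ⟨𝒜.mul a b, h.mul_mem a.2 b.2⟩)
    (by intros; ext; simp) (by intros; ext; simp) (by intros; ext; simp) (by intros; ext; simp)
  mul_mem ha hb := 𝒜.mul_mem ha hb
  leibniz b ha := Subtype.ext (by
    rw [Submodule.coe_add, Units.smul_def, Submodule.coe_smul_of_tower]
    exact 𝒜.leibniz b ha)

/-- A DG vector space with the trivial product. -/
def trivial (D : DGSpace K A) : DGAlg K A where
  toDGSpace := D
  mul := 0
  mul_mem _ _ := zero_mem _
  leibniz _ _ := by simp

/-- The product of two DG algebras. -/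
def prod (𝒜 : DGAlg K A) (ℬ : DGAlg K B) : DGAlg K (A × B) where
  toDGSpace := 𝒜.toDGSpace.prod ℬ.toDGSpace
  mul := LinearMap.mk₂ K (fun x y => (𝒜.mul x.1 y.1, ℬ.mul x.2 y.2))
    (by intros; simp) (by intros; simp) (by intros; simp) (by intros; simp)
  mul_mem ha hb := ⟨𝒜.mul_mem ha.1 hb.1, ℬ.mul_mem ha.2 hb.2⟩
  leibniz b ha := Prod.ext (𝒜.leibniz b.1 ha.1) (ℬ.leibniz b.2 ha.2)

instance (𝒜 : DGAlg K A) [𝒜.IsAssoc] (S : Submodule K A) (h : 𝒜.IsSubalgebra S) :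
    (𝒜.restrict S h).IsAssoc where
  mul_assoc a b c := Subtype.ext (IsAssoc.mul_assoc (𝒜 := 𝒜) a.1 b.1 c.1)

instance (𝒜 : DGAlg K A) [𝒜.IsLie] (S : Submodule K A) (h : 𝒜.IsSubalgebra S) :
    (𝒜.restrict S h).IsLie where
  skew ha hb := Subtype.ext (by
    rw [Submodule.coe_neg, Units.smul_def, Submodule.coe_smul_of_tower]
    exact IsLie.skew (𝒜 := 𝒜) ha hb)
  jacobi c ha hb := Subtype.ext (by
    rw [Submodule.coe_add, Units.smul_def, Submodule.coe_smul_of_tower]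
    exact IsLie.jacobi (𝒜 := 𝒜) c.1 ha hb)

instance (D : DGSpace K A) : (trivial D).IsAssoc where
  mul_assoc _ _ _ := rfl

instance (D : DGSpace K A) : (trivial D).IsLie where
  skew _ _ := by simp [trivial]
  jacobi _ _ _ := by simp [trivial]

instance (𝒜 : DGAlg K A) (ℬ : DGAlg K B) [𝒜.IsAssoc] [ℬ.IsAssoc] : (𝒜.prod ℬ).IsAssoc where
  mul_assoc a b c := Prod.ext (IsAssoc.mul_assoc (𝒜 := 𝒜) a.1 b.1 c.1)
    (IsAssoc.mul_assoc (𝒜 := ℬ) a.2 b.2 c.2)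

instance (𝒜 : DGAlg K A) (ℬ : DGAlg K B) [𝒜.IsLie] [ℬ.IsLie] : (𝒜.prod ℬ).IsLie where
  skew ha hb := Prod.ext (IsLie.skew (𝒜 := 𝒜) ha.1 hb.1) (IsLie.skew (𝒜 := ℬ) ha.2 hb.2)
  jacobi c ha hb := Prod.ext (IsLie.jacobi (𝒜 := 𝒜) c.1 ha.1 hb.1)
    (IsLie.jacobi (𝒜 := ℬ) c.2 ha.2 hb.2)

theorem IsHom.id (𝒜 : DGAlg K A) : 𝒜.IsHom 𝒜 LinearMap.id :=
  { map_mem := fun h => h, map_d := fun _ => rfl, map_mul := fun _ _ => rfl }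

theorem IsHom.comp {C : Type*} [AddCommGroup C] [Module K C] {𝒜 : DGAlg K A} {ℬ : DGAlg K B}
    {𝒞 : DGAlg K C} {ψ : B →ₗ[K] C} {φ : A →ₗ[K] B} (hψ : ℬ.IsHom 𝒞 ψ) (hφ : 𝒜.IsHom ℬ φ) :
    𝒜.IsHom 𝒞 (ψ ∘ₗ φ) where
  map_mem h := hψ.map_mem (hφ.map_mem h)
  map_d v := by simp [hφ.map_d, hψ.map_d]
  map_mul a b := by simp [hφ.map_mul, hψ.map_mul]

theorem IsHom.fst (𝒜 : DGAlg K A) (ℬ : DGAlg K B) : (𝒜.prod ℬ).IsHom 𝒜 (LinearMap.fst K A B) :=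
  { map_mem := fun h => h.1, map_d := fun _ => rfl, map_mul := fun _ _ => rfl }

theorem IsHom.snd (𝒜 : DGAlg K A) (ℬ : DGAlg K B) : (𝒜.prod ℬ).IsHom ℬ (LinearMap.snd K A B) :=
  { map_mem := fun h => h.2, map_d := fun _ => rfl, map_mul := fun _ _ => rfl }

theorem IsHom.subtype (𝒜 : DGAlg K A) (S : Submodule K A) (h : 𝒜.IsSubalgebra S) :
    (𝒜.restrict S h).IsHom 𝒜 S.subtype :=
  { map_mem := fun h => h, map_d := fun _ => rfl, map_mul := fun _ _ => rfl }

theorem IsSubalgebra.inf {𝒜 : DGAlg K A} {S T : Submodule K A} (hS : 𝒜.IsSubalgebra S)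
    (hT : 𝒜.IsSubalgebra T) : 𝒜.IsSubalgebra (S ⊓ T) where
  proj_mem i _ hv := ⟨hS.proj_mem i hv.1, hT.proj_mem i hv.2⟩
  d_mem hv := ⟨hS.d_mem hv.1, hT.d_mem hv.2⟩
  mul_mem ha hb := ⟨hS.mul_mem ha.1 hb.1, hT.mul_mem ha.2 hb.2⟩

theorem IsSubalgebra.comap {𝒜 : DGAlg K A} {ℬ : DGAlg K B} {φ : A →ₗ[K] B} (hφ : 𝒜.IsHom ℬ φ)
    {S : Submodule K B} (hS : ℬ.IsSubalgebra S) : 𝒜.IsSubalgebra (S.comap φ) where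
  proj_mem i v hv := by
    rw [Submodule.mem_comap, hφ.map_proj]; exact hS.proj_mem i hv
  d_mem {v} hv := by
    rw [Submodule.mem_comap, hφ.map_d]; exact hS.d_mem hv
  mul_mem {a b} ha hb := by
    rw [Submodule.mem_comap, hφ.map_mul]; exact hS.mul_mem ha hb

theorem IsSubalgebra.range {𝒜 : DGAlg K A} {ℬ : DGAlg K B} {φ : A →ₗ[K] B} (hφ : 𝒜.IsHom ℬ φ) :
    ℬ.IsSubalgebra (LinearMap.range φ) where
  proj_mem i v hv := by
    obtain ⟨a, rfl⟩ := hv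
    exact ⟨𝒜.proj i a, hφ.map_proj i a⟩
  d_mem {v} hv := by
    obtain ⟨a, rfl⟩ := hv
    exact ⟨𝒜.d a, hφ.map_d a⟩
  mul_mem {a b} ha hb := by
    obtain ⟨a, rfl⟩ := ha
    obtain ⟨b, rfl⟩ := hb
    exact ⟨𝒜.mul a b, hφ.map_mul a b⟩

theorem IsSubalgebra.eqLocus {𝒜 : DGAlg K A} {ℬ : DGAlg K B} {φ ψ : A →ₗ[K] B}
    (hφ : 𝒜.IsHom ℬ φ) (hψ : 𝒜.IsHom ℬ ψ) : 𝒜.IsSubalgebra (LinearMap.eqLocus φ ψ) where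
  proj_mem i v hv := by
    rw [LinearMap.mem_eqLocus] at hv ⊢
    rw [hφ.map_proj, hψ.map_proj, hv]
  d_mem {v} hv := by
    rw [LinearMap.mem_eqLocus] at hv ⊢
    rw [hφ.map_d, hψ.map_d, hv]
  mul_mem {a b} ha hb := by
    rw [LinearMap.mem_eqLocus] at ha hb ⊢
    rw [hφ.map_mul, hψ.map_mul, ha, hb]

theorem IsSubalgebra.ker {𝒜 : DGAlg K A} {ℬ : DGAlg K B} {φ : A →ₗ[K] B}
    (hφ : 𝒜.IsHom ℬ φ) : 𝒜.IsSubalgebra (LinearMap.ker φ) := by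
  have hz : 𝒜.IsHom ℬ (0 : A →ₗ[K] B) :=
    { map_mem := fun _ => zero_mem _, map_d := fun _ => by simp, map_mul := fun _ _ => by simp }
  have : LinearMap.ker φ = LinearMap.eqLocus φ 0 := by ext; simp
  rw [this]
  exact IsSubalgebra.eqLocus hφ hz

end basic

/-! ### The graded commutator -/

section commutator

variable {K A : Type*} [Field K] [AddCommGroup A] [Module K A]

/-- The bilinear map `(a, b) ↦ (-1)^{deg a · deg b} b a`. -/
noncomputable def opMul (𝒜 : DGAlg K A) : A →ₗ[K] A →ₗ[K] A :=
  𝒜.lift fun i => (LinearMap.lcomp K A (𝒜.twist i)) ∘ₗ 𝒜.mul.flip ∘ₗ (𝒜.gr i).subtype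

theorem opMul_of_mem (𝒜 : DGAlg K A) {i j : ℤ} {a b : A} (ha : a ∈ 𝒜.gr i) (hb : b ∈ 𝒜.gr j) :
    𝒜.opMul a b = (i * j).negOnePow • 𝒜.mul b a := by
  rw [opMul, 𝒜.lift_of_mem _ ha]
  simp [𝒜.twist_of_mem i hb]

theorem opMul_mem (𝒜 : DGAlg K A) {i j : ℤ} {a b : A} (ha : a ∈ 𝒜.gr i) (hb : b ∈ 𝒜.gr j) :
    𝒜.opMul a b ∈ 𝒜.gr (i + j) := by
  rw [𝒜.opMul_of_mem ha hb, Units.smul_def, add_comm i j]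
  exact zsmul_mem (𝒜.mul_mem hb ha) _

/-- The graded commutator `[a, b] = a b - (-1)^{deg a · deg b} b a`. -/
noncomputable def commutator (𝒜 : DGAlg K A) : DGAlg K A where
  toDGSpace := 𝒜.toDGSpace
  mul := 𝒜.mul - 𝒜.opMul
  mul_mem ha hb := sub_mem (𝒜.mul_mem ha hb) (𝒜.opMul_mem ha hb)
  leibniz {i a} b ha := by
    refine 𝒜.induct (P := fun b => 𝒜.d ((𝒜.mul - 𝒜.opMul) a b) = (𝒜.mul - 𝒜.opMul) (𝒜.d a) b
      + i.negOnePow • (𝒜.mul - 𝒜.opMul) a (𝒜.d b)) b ?_ (by simp) ?_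
    · intro j b hb
      simp only [LinearMap.sub_apply]
      rw [𝒜.opMul_of_mem ha hb, 𝒜.opMul_of_mem (𝒜.d_mem ha) hb, 𝒜.opMul_of_mem ha (𝒜.d_mem hb),
        map_sub, 𝒜.leibniz b ha, Units.smul_def ((i * j).negOnePow), map_zsmul,
        ← Units.smul_def, 𝒜.leibniz a hb, add_mul, mul_add, Int.negOnePow_add, Int.negOnePow_add,
        mul_one, one_mul]
      have h1 : i.negOnePow * i.negOnePow = 1 := by simp
      have h2 : i.negOnePow • ((i * j).negOnePow * i.negOnePow) • 𝒜.mul (𝒜.d b) a =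
          (i * j).negOnePow • 𝒜.mul (𝒜.d b) a := by
        rw [smul_smul, mul_comm (i * j).negOnePow, ← mul_assoc, h1, one_mul]
      rw [smul_sub, h2, smul_add, smul_smul]
      abel
    · intro v w hv hw
      simp only [map_add, smul_add, hv, hw]; abel

theorem commutator_of_mem (𝒜 : DGAlg K A) {i j : ℤ} {a b : A} (ha : a ∈ 𝒜.gr i)
    (hb : b ∈ 𝒜.gr j) :
    𝒜.commutator.mul a b = 𝒜.mul a b - (i * j).negOnePow • 𝒜.mul b a := by
  rw [← 𝒜.opMul_of_mem ha hb]; rfl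

theorem negOnePow_cases (i : ℤ) : i.negOnePow = 1 ∨ i.negOnePow = -1 :=
  Int.units_eq_one_or _

instance (𝒜 : DGAlg K A) [h : 𝒜.IsAssoc] : 𝒜.commutator.IsLie where
  skew {i j a b} ha hb := by
    rw [𝒜.commutator_of_mem ha hb, 𝒜.commutator_of_mem hb ha, mul_comm j i, smul_sub, smul_smul]
    simp
  jacobi {i j a b} c ha hb := by
    refine 𝒜.induct (P := fun c => 𝒜.commutator.mul a (𝒜.commutator.mul b c) =
      𝒜.commutator.mul (𝒜.commutator.mul a b) c +
      (i * j).negOnePow • 𝒜.commutator.mul b (𝒜.commutator.mul a c)) c ?_ (by simp) ?_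
    · intro k c hc
      rw [𝒜.commutator_of_mem ha (𝒜.commutator.mul_mem hb hc),
        𝒜.commutator_of_mem (𝒜.commutator.mul_mem ha hb) hc,
        𝒜.commutator_of_mem hb (𝒜.commutator.mul_mem ha hc),
        𝒜.commutator_of_mem ha hb, 𝒜.commutator_of_mem hb hc, 𝒜.commutator_of_mem ha hc]
      rw [add_mul, mul_add, mul_add, Int.negOnePow_add, Int.negOnePow_add, Int.negOnePow_add,
        mul_comm j i]
      rcases negOnePow_cases (i * j) with h1 | h1 <;> rcases negOnePow_cases (i * k) with h2 | h2 <;>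
      rcases negOnePow_cases (j * k) with h3 | h3 <;>
      simp only [h1, h2, h3, one_smul, mul_one, one_mul, neg_mul, Units.neg_smul, map_sub,
        map_add, LinearMap.sub_apply, LinearMap.add_apply, h.mul_assoc, neg_neg, sub_neg_eq_add] <;> abel
    · intro v w hv hw
      simp only [map_add, smul_add, hv, hw]; abel

end commutator
end DGAlg

/-! ### Polynomial differential forms with coefficients -/

/-- `W[t] = W ⊗ K[t]`. -/
abbrev PolyCoeff (K W : Type*) [Field K] [AddCommGroup W] [Module K W] : Type _ :=
  W ⊗[K] K[X]

/-- The underlying space of `Ω(Δ¹; W) = W[t, dt] = W[t] ⊕ W[t] dt`: the pair `(p, q)` stands for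
`p(t) + q(t) dt`, coefficients being written on the left of the forms. -/
def Forms (K W : Type*) [Field K] [AddCommGroup W] [Module K W] : Type _ :=
  PolyCoeff K W × PolyCoeff K W

noncomputable instance (K W : Type*) [Field K] [AddCommGroup W] [Module K W] :
    AddCommGroup (Forms K W) := inferInstanceAs (AddCommGroup (PolyCoeff K W × PolyCoeff K W))

noncomputable instance (K W : Type*) [Field K] [AddCommGroup W] [Module K W] :
    Module K (Forms K W) := inferInstanceAs (Module K (PolyCoeff K W × PolyCoeff K W))

namespace PolyCoeff

section

variable {K A B C : Type*} [Field K] [AddCommGroup A] [Module K A] [AddCommGroup B] [Module K B]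
  [AddCommGroup C] [Module K C]

/-- Application of a linear map to the coefficients. -/
noncomputable def map (φ : A →ₗ[K] B) : PolyCoeff K A →ₗ[K] PolyCoeff K B := φ.rTensor K[X]

/-- The derivative with respect to `t`. -/
noncomputable def deriv : PolyCoeff K A →ₗ[K] PolyCoeff K A :=
  (Polynomial.derivative : K[X] →ₗ[K] K[X]).lTensor A

/-- The evaluation at `t = c`. -/
noncomputable def eval (c : K) : PolyCoeff K A →ₗ[K] A :=
  (TensorProduct.rid K A).toLinearMap ∘ₗ (Polynomial.leval c).lTensor A

/-- The primitive `p ↦ ∫₀ᵗ p` of scalar polynomials. -/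
noncomputable def scalarPrim : K[X] →ₗ[K] K[X] :=
  (Polynomial.basisMonomials K).constr K fun n => Polynomial.monomial (n + 1) ((n : K) + 1)⁻¹

/-- The primitive `p ↦ ∫₀ᵗ p`. -/
noncomputable def prim : PolyCoeff K A →ₗ[K] PolyCoeff K A := scalarPrim.lTensor A

/-- The definite integral `p ↦ ∫₀¹ p(t) dt`. -/
noncomputable def integral : PolyCoeff K A →ₗ[K] A := eval 1 ∘ₗ prim

/-- The product `(a p(t)) (b q(t)) = (a b) p(t) q(t)`. -/
noncomputable def mul (μ : A →ₗ[K] B →ₗ[K] C) :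
    PolyCoeff K A →ₗ[K] PolyCoeff K B →ₗ[K] PolyCoeff K C :=
  TensorProduct.map₂ μ (LinearMap.mul K K[X])

/-- The polynomials with coefficients in a subspace. -/
noncomputable def sub (S : Submodule K A) : Submodule K (PolyCoeff K A) := LinearMap.range (map S.subtype)

theorem scalarPrim_monomial (n : ℕ) (c : K) :
    scalarPrim (Polynomial.monomial n c) = Polynomial.monomial (n + 1) (c / ((n : K) + 1)) := by
  have h : (Polynomial.monomial n c : K[X]) = c • Polynomial.basisMonomials K n := by
    simp [Polynomial.smul_monomial]
  rw [h, map_smul, scalarPrim, Module.Basis.constr_basis, Polynomial.smul_monomial, smul_eq_mul,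
    div_eq_mul_inv]

@[simp] theorem map_tmul (φ : A →ₗ[K] B) (a : A) (p : K[X]) :
    map φ (a ⊗ₜ[K] p) = φ a ⊗ₜ[K] p := rfl

@[simp] theorem deriv_tmul (a : A) (p : K[X]) :
    deriv (a ⊗ₜ[K] p) = a ⊗ₜ[K] Polynomial.derivative p := rfl

@[simp] theorem eval_tmul (c : K) (a : A) (p : K[X]) :
    eval c (a ⊗ₜ[K] p) = p.eval c • a := by
  simp [eval, Polynomial.leval]

@[simp] theorem prim_tmul (a : A) (p : K[X]) :
    prim (a ⊗ₜ[K] p) = a ⊗ₜ[K] scalarPrim p := rfl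

@[simp] theorem mul_tmul (μ : A →ₗ[K] B →ₗ[K] C) (a : A) (b : B) (p q : K[X]) :
    mul μ (a ⊗ₜ[K] p) (b ⊗ₜ[K] q) = μ a b ⊗ₜ[K] (p * q) := rfl

theorem tmul_mem_sub {S : Submodule K A} {a : A} (ha : a ∈ S) (p : K[X]) :
    a ⊗ₜ[K] p ∈ sub S := ⟨(⟨a, ha⟩ : S) ⊗ₜ[K] p, rfl⟩

theorem induct {P : PolyCoeff K A → Prop} (x : PolyCoeff K A) (tmul : ∀ a p, P (a ⊗ₜ[K] p))
    (zero : P 0) (add : ∀ x y, P x → P y → P (x + y)) : P x :=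
  TensorProduct.induction_on x zero tmul add

theorem sub_induct {S : Submodule K A} {P : PolyCoeff K A → Prop} {x : PolyCoeff K A}
    (hx : x ∈ sub S) (tmul : ∀ a ∈ S, ∀ p, P (a ⊗ₜ[K] p)) (zero : P 0)
    (add : ∀ x y, P x → P y → P (x + y)) : P x := by
  obtain ⟨y, rfl⟩ := hx
  refine TensorProduct.induction_on y (by simpa using zero) (fun a p => tmul a a.2 p) ?_
  intro x y hx hy
  rw [map_add]; exact add _ _ hx hy

theorem map_mem_sub {S : Submodule K A} {T : Submodule K B} {φ : A →ₗ[K] B}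
    (h : ∀ a ∈ S, φ a ∈ T) {x : PolyCoeff K A} (hx : x ∈ sub S) : map φ x ∈ sub T := by
  refine sub_induct (P := fun x => map φ x ∈ sub T) hx
    (fun a ha p => tmul_mem_sub (h a ha) p) (by simp) ?_
  intro x y hx hy
  rw [map_add]; exact add_mem hx hy

theorem map_congr {S : Submodule K A} {φ ψ : A →ₗ[K] B}
    (h : ∀ a ∈ S, φ a = ψ a) {x : PolyCoeff K A} (hx : x ∈ sub S) : map φ x = map ψ x := by
  refine sub_induct (P := fun x => map φ x = map ψ x) hx
    (fun a ha p => by simp [h a ha]) (by simp) ?_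
  intro x y hx hy
  rw [map_add, map_add, hx, hy]

theorem deriv_mem_sub {S : Submodule K A} {x : PolyCoeff K A} (hx : x ∈ sub S) :
    deriv x ∈ sub S := by
  refine sub_induct (P := fun x => deriv x ∈ sub S) hx
    (fun a ha p => tmul_mem_sub ha _) (by simp) ?_
  intro x y hx hy
  rw [map_add]; exact add_mem hx hy

theorem eval_mem {S : Submodule K A} (c : K) {x : PolyCoeff K A} (hx : x ∈ sub S) :
    eval c x ∈ S := by
  refine sub_induct (P := fun x => eval c x ∈ S) hx
    (fun a ha p => by simpa using S.smul_mem _ ha) (by simp) ?_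
  intro x y hx hy
  rw [map_add]; exact add_mem hx hy

theorem mul_mem_sub {S : Submodule K A} {T : Submodule K B} {U : Submodule K C}
    {μ : A →ₗ[K] B →ₗ[K] C} (h : ∀ a ∈ S, ∀ b ∈ T, μ a b ∈ U) {x : PolyCoeff K A}
    {y : PolyCoeff K B} (hx : x ∈ sub S) (hy : y ∈ sub T) : mul μ x y ∈ sub U := by
  refine sub_induct (P := fun x => mul μ x y ∈ sub U) hx ?_ (by simp) ?_
  · intro a ha p
    refine sub_induct (P := fun y => mul μ (a ⊗ₜ[K] p) y ∈ sub U) hy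
      (fun b hb q => tmul_mem_sub (h a ha b hb) _) (by simp) ?_
    intro x y hx hy
    rw [map_add]; exact add_mem hx hy
  · intro x y hx hy
    rw [map_add]; exact add_mem hx hy

/-- Two bilinear expressions agree if they agree on pure tensors. -/
theorem ext₂ {D : Type*} [AddCommGroup D] [Module K D] {S : Submodule K A}
    {f g : PolyCoeff K A →ₗ[K] PolyCoeff K B →ₗ[K] D} {x : PolyCoeff K A} (hx : x ∈ sub S)
    (y : PolyCoeff K B)
    (h : ∀ a ∈ S, ∀ p b q, f (a ⊗ₜ[K] p) (b ⊗ₜ[K] q) = g (a ⊗ₜ[K] p) (b ⊗ₜ[K] q)) :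
    f x y = g x y := by
  refine sub_induct (P := fun x => f x y = g x y) hx ?_ (by simp) ?_
  · intro a ha p
    refine induct (P := fun y => f (a ⊗ₜ[K] p) y = g (a ⊗ₜ[K] p) y) y (h a ha p) (by simp) ?_
    intro x y hx hy
    rw [map_add, map_add, hx, hy]
  · intro x y hx hy
    simp only [map_add, LinearMap.add_apply, hx, hy]

theorem mem_sub_top (x : PolyCoeff K A) : x ∈ sub (⊤ : Submodule K A) :=
  induct (P := fun x => x ∈ sub ⊤) x (fun _ p => tmul_mem_sub Submodule.mem_top p) (zero_mem _)
    fun _ _ => add_mem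

theorem deriv_map (φ : A →ₗ[K] B) (x : PolyCoeff K A) : deriv (map φ x) = map φ (deriv x) := by
  refine induct (P := fun x => deriv (map φ x) = map φ (deriv x)) x (by simp) (by simp) ?_
  intro x y hx hy
  simp only [map_add, hx, hy]

theorem map_map (ψ : B →ₗ[K] C) (φ : A →ₗ[K] B) (x : PolyCoeff K A) :
    map ψ (map φ x) = map (ψ ∘ₗ φ) x := by
  refine induct (P := fun x => map ψ (map φ x) = map (ψ ∘ₗ φ) x) x (by simp) (by simp) ?_
  intro x y hx hy
  simp only [map_add, hx, hy]

theorem eval_map (c : K) (φ : A →ₗ[K] B) (x : PolyCoeff K A) :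
    eval c (map φ x) = φ (eval c x) := by
  refine induct (P := fun x => eval c (map φ x) = φ (eval c x)) x (by simp) (by simp) ?_
  intro x y hx hy
  simp only [map_add, hx, hy]

theorem map_negHom (φ : A →ₗ[K] B) (x : PolyCoeff K A) : map (-φ) x = -map φ x := by
  refine induct (P := fun x => map (-φ) x = -map φ x) x (by simp [TensorProduct.neg_tmul])
    (by simp) ?_
  intro x y hx hy
  simp only [map_add, hx, hy]; abel

theorem map_sign_smul (u : ℤˣ) (φ : A →ₗ[K] B) (x : PolyCoeff K A) :
    map (u • φ) x = u • map φ x := by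
  rcases Int.units_eq_one_or u with h | h <;> subst h
  · simp
  · rw [Units.neg_smul, one_smul, map_negHom, Units.neg_smul, one_smul]

theorem map_id (x : PolyCoeff K A) : map (LinearMap.id : A →ₗ[K] A) x = x := by
  simp [map]

theorem map_zeroHom (x : PolyCoeff K A) : map (0 : A →ₗ[K] B) x = 0 := by
  simp [map]

theorem deriv_mul (μ : A →ₗ[K] B →ₗ[K] C) (x : PolyCoeff K A) (y : PolyCoeff K B) :
    deriv (mul μ x y) = mul μ (deriv x) y + mul μ x (deriv y) := by
  refine ext₂ (f := (mul μ).compr₂ deriv) (g := (mul μ).comp deriv + (mul μ).compl₂ deriv)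
    (mem_sub_top x) y ?_
  intro a _ p b q
  simp [TensorProduct.tmul_add]

theorem map_mul (μ : A →ₗ[K] A →ₗ[K] A) (ν : B →ₗ[K] B →ₗ[K] B) (φ : A →ₗ[K] B)
    (h : ∀ a b, φ (μ a b) = ν (φ a) (φ b)) (x y : PolyCoeff K A) :
    map φ (mul μ x y) = mul ν (map φ x) (map φ y) := by
  refine ext₂ (f := (mul μ).compr₂ (map φ)) (g := (mul ν).compl₁₂ (map φ) (map φ))
    (mem_sub_top x) y ?_
  intro a _ p b q
  simp [h]

theorem eval_mul (c : K) (μ : A →ₗ[K] B →ₗ[K] C) (x : PolyCoeff K A) (y : PolyCoeff K B) :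
    eval c (mul μ x y) = μ (eval c x) (eval c y) := by
  refine ext₂ (f := (mul μ).compr₂ (eval c)) (g := μ.compl₁₂ (eval c) (eval c))
    (mem_sub_top x) y ?_
  intro a _ p b q
  simp [mul_smul, smul_comm (Polynomial.eval c q)]

end
end PolyCoeff

namespace Forms

section

variable {K V W : Type*} [Field K] [AddCommGroup V] [Module K V] [AddCommGroup W] [Module K W]

/-- The part `p(t)` of `p(t) + q(t) dt`. -/
noncomputable def fnPart : Forms K V →ₗ[K] PolyCoeff K V :=
  LinearMap.fst K (PolyCoeff K V) (PolyCoeff K V)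

/-- The coefficient `q(t)` of `dt` in `p(t) + q(t) dt`. -/
noncomputable def dtCoeff : Forms K V →ₗ[K] PolyCoeff K V :=
  LinearMap.snd K (PolyCoeff K V) (PolyCoeff K V)

/-- The linear map `x ↦ f x + (g x) dt`. -/
noncomputable def pairing (f g : W →ₗ[K] PolyCoeff K V) : W →ₗ[K] Forms K V := f.prod g

/-- The form `p(t) + q(t) dt`. -/
def mk (p q : PolyCoeff K V) : Forms K V := (p, q)

@[simp] theorem fnPart_pairing (f g : W →ₗ[K] PolyCoeff K V) (x : W) :
    fnPart (pairing f g x) = f x := rfl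

@[simp] theorem dtCoeff_pairing (f g : W →ₗ[K] PolyCoeff K V) (x : W) :
    dtCoeff (pairing f g x) = g x := rfl

@[simp] theorem fnPart_mk (p q : PolyCoeff K V) : fnPart (mk p q) = p := rfl

@[simp] theorem dtCoeff_mk (p q : PolyCoeff K V) : dtCoeff (mk p q) = q := rfl

theorem ext {x y : Forms K V} (h1 : fnPart x = fnPart y) (h2 : dtCoeff x = dtCoeff y) : x = y :=
  Prod.ext h1 h2

/-- Application of a linear map to the coefficients of a form. -/
noncomputable def map (φ : V →ₗ[K] W) : Forms K V →ₗ[K] Forms K W :=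
  pairing (PolyCoeff.map φ ∘ₗ fnPart) (PolyCoeff.map φ ∘ₗ dtCoeff)

/-- The restriction of a form to the point `t = c`; the two faces are `c = 0` and `c = 1`. -/
noncomputable def eval (c : K) : Forms K V →ₗ[K] V := PolyCoeff.eval c ∘ₗ fnPart

/-- The integration `∫_{Δ¹} : V[t, dt] → V`, `p(t) + q(t) dt ↦ ∫₀¹ q(t) dt`. -/
noncomputable def integral : Forms K V →ₗ[K] V := PolyCoeff.integral ∘ₗ dtCoeff

end
end Forms

/-- The DG vector space `V[t, dt]`; the differential is determined by
`d (v p(t)) = (d v) p(t) + (-1)^{deg v} v p'(t) dt` and `d (v q(t) dt) = (d v) q(t) dt`. -/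
noncomputable def DGSpace.forms {K V : Type*} [Field K] [AddCommGroup V] [Module K V]
    (D : DGSpace K V) : DGSpace K (Forms K V) where
  gr i := (PolyCoeff.sub (D.gr i)).comap Forms.fnPart ⊓
    (PolyCoeff.sub (D.gr (i - 1))).comap Forms.dtCoeff
  isInternal := by
    refine DGSpace.isInternal_of_proj (fun i => Forms.pairing
      (PolyCoeff.map (D.proj i) ∘ₗ Forms.fnPart)
      (PolyCoeff.map (D.proj (i - 1)) ∘ₗ Forms.dtCoeff)) ?_ ?_ ?_
    · intro i x hx
      refine Forms.ext ?_ ?_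
      · exact (PolyCoeff.map_congr (ψ := LinearMap.id) (fun a ha => D.proj_self ha) hx.1).trans
          (PolyCoeff.map_id _)
      · exact (PolyCoeff.map_congr (ψ := LinearMap.id) (fun a ha => D.proj_self ha) hx.2).trans
          (PolyCoeff.map_id _)
    · intro i j x hx hj
      refine Forms.ext ?_ ?_
      · exact (PolyCoeff.map_congr (ψ := 0) (fun a ha => D.proj_of_ne ha hj) hx.1).trans
          (PolyCoeff.map_zeroHom _)
      · exact (PolyCoeff.map_congr (ψ := 0) (fun a ha => D.proj_of_ne ha (by omega)) hx.2).trans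
          (PolyCoeff.map_zeroHom _)
    · intro x
      set S := ⨆ i, (PolyCoeff.sub (D.gr i)).comap Forms.fnPart ⊓
        (PolyCoeff.sub (D.gr (i - 1))).comap Forms.dtCoeff with hS
      have h1 : ∀ p, (Forms.pairing LinearMap.id 0 : _ →ₗ[K] Forms K V) p ∈ S := by
        intro p
        refine PolyCoeff.induct
          (P := fun p => (Forms.pairing LinearMap.id 0 : _ →ₗ[K] Forms K V) p ∈ S) p ?_
          (by rw [map_zero]; exact zero_mem _) ?_
        · intro a p
          refine D.induct
            (P := fun a => (Forms.pairing LinearMap.id 0 : _ →ₗ[K] Forms K V) (a ⊗ₜ[K] p) ∈ S) a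
            (fun i a ha => Submodule.mem_iSup_of_mem i
              ⟨PolyCoeff.tmul_mem_sub ha p, Submodule.zero_mem (PolyCoeff.sub _)⟩)
            (by rw [TensorProduct.zero_tmul, map_zero]; exact zero_mem _) ?_
          intro v w hv hw
          rw [TensorProduct.add_tmul, map_add]
          exact add_mem hv hw
        · intro v w hv hw
          rw [map_add]
          exact add_mem hv hw
      have h2 : ∀ p, (Forms.pairing 0 LinearMap.id : _ →ₗ[K] Forms K V) p ∈ S := by
        intro p
        refine PolyCoeff.induct
          (P := fun p => (Forms.pairing 0 LinearMap.id : _ →ₗ[K] Forms K V) p ∈ S) p ?_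
          (by rw [map_zero]; exact zero_mem _) ?_
        · intro a p
          refine D.induct
            (P := fun a => (Forms.pairing 0 LinearMap.id : _ →ₗ[K] Forms K V) (a ⊗ₜ[K] p) ∈ S) a
            (fun i a ha => Submodule.mem_iSup_of_mem (i + 1)
              ⟨Submodule.zero_mem (PolyCoeff.sub _),
                PolyCoeff.tmul_mem_sub (by simpa using ha) p⟩)
            (by rw [TensorProduct.zero_tmul, map_zero]; exact zero_mem _) ?_
          intro v w hv hw
          rw [TensorProduct.add_tmul, map_add]
          exact add_mem hv hw
        · intro v w hv hw
          rw [map_add]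
          exact add_mem hv hw
      have : x = (Forms.pairing LinearMap.id 0 : _ →ₗ[K] Forms K V) (Forms.fnPart x) +
          (Forms.pairing 0 LinearMap.id : _ →ₗ[K] Forms K V) (Forms.dtCoeff x) :=
        Forms.ext (by simp) (by simp)
      rw [this]
      exact add_mem (h1 _) (h2 _)
  d := Forms.pairing (PolyCoeff.map D.d ∘ₗ Forms.fnPart)
    (PolyCoeff.deriv ∘ₗ PolyCoeff.map D.sgn ∘ₗ Forms.fnPart + PolyCoeff.map D.d ∘ₗ Forms.dtCoeff)
  d_mem {i x} hx := by
    refine ⟨PolyCoeff.map_mem_sub (fun a ha => D.d_mem ha) hx.1,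
      Submodule.add_mem (PolyCoeff.sub _) ?_ ?_⟩
    · refine PolyCoeff.deriv_mem_sub (PolyCoeff.map_mem_sub (fun a ha => ?_) hx.1)
      rw [D.sgn_of_mem ha, Units.smul_def, add_sub_cancel_right]
      exact zsmul_mem ha _
    · refine PolyCoeff.map_mem_sub (fun a ha => ?_) hx.2
      have := D.d_mem ha
      rwa [sub_add_cancel, ← add_sub_cancel_right i 1] at this
  d_d x := by
    have h1 : D.d ∘ₗ D.d = 0 := LinearMap.ext D.d_d
    have h2 : D.sgn ∘ₗ D.d = -(D.d ∘ₗ D.sgn) := LinearMap.ext D.sgn_d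
    refine Forms.ext ?_ ?_
    · simp [PolyCoeff.map_map, h1, PolyCoeff.map_zeroHom]
    · simp [PolyCoeff.map_map, h1, h2, PolyCoeff.map_zeroHom, PolyCoeff.map_negHom,
        ← PolyCoeff.deriv_map]

namespace DGAlg

section forms

variable {K A B : Type*} [Field K] [AddCommGroup A] [Module K A] [AddCommGroup B] [Module K B]

theorem polyCoeff_sgn (D : DGSpace K A) {i : ℤ} {x : PolyCoeff K A}
    (hx : x ∈ PolyCoeff.sub (D.gr i)) : PolyCoeff.map D.sgn x = i.negOnePow • x := by
  rw [PolyCoeff.map_congr (ψ := i.negOnePow • LinearMap.id) (fun a ha => D.sgn_of_mem ha) hx,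
    PolyCoeff.map_sign_smul, PolyCoeff.map_id]

theorem polyCoeff_leibniz (𝒜 : DGAlg K A) {i : ℤ} {x : PolyCoeff K A} (y : PolyCoeff K A)
    (hx : x ∈ PolyCoeff.sub (𝒜.gr i)) :
    PolyCoeff.map 𝒜.d (PolyCoeff.mul 𝒜.mul x y) = PolyCoeff.mul 𝒜.mul (PolyCoeff.map 𝒜.d x) y +
      i.negOnePow • PolyCoeff.mul 𝒜.mul x (PolyCoeff.map 𝒜.d y) := by
  refine PolyCoeff.ext₂ (f := (PolyCoeff.mul 𝒜.mul).compr₂ (PolyCoeff.map 𝒜.d))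
    (g := (PolyCoeff.mul 𝒜.mul).comp (PolyCoeff.map 𝒜.d) +
      i.negOnePow • (PolyCoeff.mul 𝒜.mul).compl₂ (PolyCoeff.map 𝒜.d)) hx y ?_
  intro a ha p b q
  rcases negOnePow_cases i with h | h <;>
  simp [𝒜.leibniz b ha, h, TensorProduct.add_tmul, TensorProduct.neg_tmul]

theorem polyCoeff_skew (𝒜 : DGAlg K A) [𝒜.IsLie] {i j : ℤ} {x y : PolyCoeff K A}
    (hx : x ∈ PolyCoeff.sub (𝒜.gr i)) (hy : y ∈ PolyCoeff.sub (𝒜.gr j)) :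
    PolyCoeff.mul 𝒜.mul x y = -((i * j).negOnePow • PolyCoeff.mul 𝒜.mul y x) := by
  refine PolyCoeff.sub_induct (P := fun x => PolyCoeff.mul 𝒜.mul x y =
    -((i * j).negOnePow • PolyCoeff.mul 𝒜.mul y x)) hx ?_ (by simp) ?_
  · intro a ha p
    refine PolyCoeff.sub_induct (P := fun y => PolyCoeff.mul 𝒜.mul (a ⊗ₜ[K] p) y =
      -((i * j).negOnePow • PolyCoeff.mul 𝒜.mul y (a ⊗ₜ[K] p))) hy ?_ (by simp) ?_
    · intro b hb q
      rw [PolyCoeff.mul_tmul, PolyCoeff.mul_tmul, IsLie.skew (𝒜 := 𝒜) ha hb, mul_comm q p]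
      rcases negOnePow_cases (i * j) with h | h <;> simp [h, TensorProduct.neg_tmul]
    · intro v w hv hw
      simp only [map_add, LinearMap.add_apply, smul_add, hv, hw]; abel
  · intro v w hv hw
    simp only [map_add, LinearMap.add_apply, smul_add, hv, hw]; abel

theorem polyCoeff_jacobi (𝒜 : DGAlg K A) [𝒜.IsLie] {i j : ℤ} {x y : PolyCoeff K A}
    (z : PolyCoeff K A)
    (hx : x ∈ PolyCoeff.sub (𝒜.gr i)) (hy : y ∈ PolyCoeff.sub (𝒜.gr j)) :
    PolyCoeff.mul 𝒜.mul x (PolyCoeff.mul 𝒜.mul y z) =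
      PolyCoeff.mul 𝒜.mul (PolyCoeff.mul 𝒜.mul x y) z +
      (i * j).negOnePow • PolyCoeff.mul 𝒜.mul y (PolyCoeff.mul 𝒜.mul x z) := by
  refine PolyCoeff.sub_induct (P := fun x => PolyCoeff.mul 𝒜.mul x (PolyCoeff.mul 𝒜.mul y z) =
      PolyCoeff.mul 𝒜.mul (PolyCoeff.mul 𝒜.mul x y) z +
      (i * j).negOnePow • PolyCoeff.mul 𝒜.mul y (PolyCoeff.mul 𝒜.mul x z)) hx ?_ (by simp) ?_
  · intro a ha p
    refine PolyCoeff.sub_induct (P := fun y =>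
      PolyCoeff.mul 𝒜.mul (a ⊗ₜ[K] p) (PolyCoeff.mul 𝒜.mul y z) =
      PolyCoeff.mul 𝒜.mul (PolyCoeff.mul 𝒜.mul (a ⊗ₜ[K] p) y) z +
      (i * j).negOnePow • PolyCoeff.mul 𝒜.mul y (PolyCoeff.mul 𝒜.mul (a ⊗ₜ[K] p) z)) hy ?_
      (by simp) ?_
    · intro b hb q
      refine PolyCoeff.induct (P := fun z =>
        PolyCoeff.mul 𝒜.mul (a ⊗ₜ[K] p) (PolyCoeff.mul 𝒜.mul (b ⊗ₜ[K] q) z) =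
        PolyCoeff.mul 𝒜.mul (PolyCoeff.mul 𝒜.mul (a ⊗ₜ[K] p) (b ⊗ₜ[K] q)) z +
        (i * j).negOnePow •
          PolyCoeff.mul 𝒜.mul (b ⊗ₜ[K] q) (PolyCoeff.mul 𝒜.mul (a ⊗ₜ[K] p) z)) z ?_ (by simp) ?_
      · intro c r
        simp only [PolyCoeff.mul_tmul]
        rw [IsLie.jacobi (𝒜 := 𝒜) c ha hb, mul_assoc, mul_left_comm q p r]
        rcases negOnePow_cases (i * j) with h | h <;>
        simp [h, TensorProduct.add_tmul, TensorProduct.neg_tmul]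
      · intro v w hv hw
        simp only [map_add, smul_add, hv, hw]; abel
    · intro v w hv hw
      simp only [map_add, LinearMap.add_apply, smul_add, hv, hw]; abel
  · intro v w hv hw
    simp only [map_add, LinearMap.add_apply, smul_add, hv, hw]; abel

theorem polyCoeff_assoc (𝒜 : DGAlg K A) [𝒜.IsAssoc] (x y z : PolyCoeff K A) :
    PolyCoeff.mul 𝒜.mul (PolyCoeff.mul 𝒜.mul x y) z =
      PolyCoeff.mul 𝒜.mul x (PolyCoeff.mul 𝒜.mul y z) := by
  refine PolyCoeff.induct (P := fun x => PolyCoeff.mul 𝒜.mul (PolyCoeff.mul 𝒜.mul x y) z =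
      PolyCoeff.mul 𝒜.mul x (PolyCoeff.mul 𝒜.mul y z)) x ?_ (by simp) ?_
  · intro a p
    refine PolyCoeff.ext₂
      (f := (PolyCoeff.mul 𝒜.mul).comp (PolyCoeff.mul 𝒜.mul (a ⊗ₜ[K] p)))
      (g := (PolyCoeff.mul 𝒜.mul).compr₂ (PolyCoeff.mul 𝒜.mul (a ⊗ₜ[K] p)))
      (PolyCoeff.mem_sub_top y) z ?_
    intro b _ q c r
    simp [IsAssoc.mul_assoc (𝒜 := 𝒜), mul_assoc]
  · intro v w hv hw
    simp only [map_add, LinearMap.add_apply, hv, hw]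

/-- The DG algebra `A[t, dt]`, with `(a ω) (b η) = (-1)^{deg ω · deg b} (a b) (ω η)`; hence
`(p + p₁ dt) (q + q₁ dt) = p q + (p q₁ + p₁ q^±) dt`, where `q^±` is obtained by applying
`a ↦ (-1)^{deg a} a` to the coefficients of `q`. -/
noncomputable def forms (𝒜 : DGAlg K A) : DGAlg K (Forms K A) where
  toDGSpace := 𝒜.toDGSpace.forms
  mul := LinearMap.mk₂ K (fun x y => Forms.mk
      (PolyCoeff.mul 𝒜.mul (Forms.fnPart x) (Forms.fnPart y))
      (PolyCoeff.mul 𝒜.mul (Forms.fnPart x) (Forms.dtCoeff y) +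
        PolyCoeff.mul 𝒜.mul (Forms.dtCoeff x) (PolyCoeff.map 𝒜.sgn (Forms.fnPart y))))
    (by intros; apply Forms.ext <;> simp; abel) (by intros; apply Forms.ext <;> simp)
    (by intros; apply Forms.ext <;> simp; abel) (by intros; apply Forms.ext <;> simp)
  mul_mem {i j x y} hx hy := by
    refine ⟨PolyCoeff.mul_mem_sub (fun a ha b hb => 𝒜.mul_mem ha hb) hx.1 hy.1,
      Submodule.add_mem (PolyCoeff.sub _) ?_ ?_⟩
    · rw [show i + j - 1 = i + (j - 1) by ring]
      exact PolyCoeff.mul_mem_sub (fun a ha b hb => 𝒜.mul_mem ha hb) hx.1 hy.2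
    · rw [show i + j - 1 = (i - 1) + j by ring]
      refine PolyCoeff.mul_mem_sub (fun a ha b hb => 𝒜.mul_mem ha hb) hx.2
        (PolyCoeff.map_mem_sub (fun a ha => ?_) hy.1)
      rw [𝒜.sgn_of_mem ha, Units.smul_def]
      exact zsmul_mem ha _
  leibniz {i x} y hx := by
    have h2 : 𝒜.sgn ∘ₗ 𝒜.d = -(𝒜.d ∘ₗ 𝒜.sgn) := LinearMap.ext 𝒜.sgn_d
    refine Forms.ext ?_ ?_
    · rw [map_add, map_sign]
      exact 𝒜.polyCoeff_leibniz _ hx.1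
    simp only [LinearMap.mk₂_apply, DGSpace.forms, Forms.dtCoeff_pairing, Forms.fnPart_pairing,
      Forms.fnPart_mk, Forms.dtCoeff_mk, LinearMap.add_apply, LinearMap.comp_apply, map_add,
      map_sign]
    rw [𝒜.polyCoeff_leibniz _ hx.1, 𝒜.polyCoeff_leibniz _ hx.2,
      PolyCoeff.map_mul 𝒜.mul 𝒜.mul 𝒜.sgn 𝒜.sgn_mul, PolyCoeff.deriv_mul,
      PolyCoeff.map_map 𝒜.sgn 𝒜.d, h2, PolyCoeff.map_negHom, ← PolyCoeff.map_map,
      polyCoeff_sgn 𝒜.toDGSpace hx.1]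
    rcases negOnePow_cases i with h | h <;>
    simp [h, Int.negOnePow_sub] <;> abel

theorem fnPart_mul (𝒜 : DGAlg K A) (x y : Forms K A) :
    Forms.fnPart (𝒜.forms.mul x y) =
      PolyCoeff.mul 𝒜.mul (Forms.fnPart x) (Forms.fnPart y) := rfl

theorem dtCoeff_mul (𝒜 : DGAlg K A) (x y : Forms K A) :
    Forms.dtCoeff (𝒜.forms.mul x y) =
      PolyCoeff.mul 𝒜.mul (Forms.fnPart x) (Forms.dtCoeff y) +
        PolyCoeff.mul 𝒜.mul (Forms.dtCoeff x) (PolyCoeff.map 𝒜.sgn (Forms.fnPart y)) := rfl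

theorem fnPart_d (D : DGSpace K A) (x : Forms K A) :
    Forms.fnPart (D.forms.d x) = PolyCoeff.map D.d (Forms.fnPart x) := rfl

theorem dtCoeff_d (D : DGSpace K A) (x : Forms K A) :
    Forms.dtCoeff (D.forms.d x) = PolyCoeff.deriv (PolyCoeff.map D.sgn (Forms.fnPart x)) +
      PolyCoeff.map D.d (Forms.dtCoeff x) := rfl

instance (𝒜 : DGAlg K A) [𝒜.IsAssoc] : 𝒜.forms.IsAssoc where
  mul_assoc x y z := by
    refine Forms.ext (𝒜.polyCoeff_assoc _ _ _) ?_
    simp only [fnPart_mul, dtCoeff_mul, map_add, LinearMap.add_apply, polyCoeff_assoc,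
      PolyCoeff.map_mul 𝒜.mul 𝒜.mul 𝒜.sgn 𝒜.sgn_mul]
    abel

instance (𝒜 : DGAlg K A) [𝒜.IsLie] : 𝒜.forms.IsLie where
  skew {i j x y} hx hy := by
    refine Forms.ext ?_ ?_
    · rw [map_neg, map_sign]
      exact 𝒜.polyCoeff_skew hx.1 hy.1
    simp only [dtCoeff_mul, map_neg, map_sign]
    rw [polyCoeff_sgn 𝒜.toDGSpace hx.1, polyCoeff_sgn 𝒜.toDGSpace hy.1, map_sign, map_sign,
      𝒜.polyCoeff_skew hx.1 hy.2, 𝒜.polyCoeff_skew hx.2 hy.1, mul_sub, sub_mul,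
      Int.negOnePow_sub, Int.negOnePow_sub]
    rcases negOnePow_cases i with h1 | h1 <;> rcases negOnePow_cases j with h2 | h2 <;>
    rcases negOnePow_cases (i * j) with h3 | h3 <;> simp [h1, h2, h3]
  jacobi {i j x y} z hx hy := by
    refine Forms.ext ?_ ?_
    · rw [map_add, map_sign]
      exact 𝒜.polyCoeff_jacobi _ hx.1 hy.1
    simp only [fnPart_mul, dtCoeff_mul, map_add, map_sign,
      LinearMap.add_apply, PolyCoeff.map_mul 𝒜.mul 𝒜.mul 𝒜.sgn 𝒜.sgn_mul]
    rw [polyCoeff_sgn 𝒜.toDGSpace hx.1, polyCoeff_sgn 𝒜.toDGSpace hy.1]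
    simp only [LinearMap.map_smul_of_tower, LinearMap.smul_apply]
    rw [𝒜.polyCoeff_jacobi _ hx.1 hy.1, 𝒜.polyCoeff_jacobi _ hx.1 hy.2,
      𝒜.polyCoeff_jacobi _ hx.2 hy.1, mul_sub, sub_mul, Int.negOnePow_sub, Int.negOnePow_sub]
    rcases negOnePow_cases i with h1 | h1 <;> rcases negOnePow_cases j with h2 | h2 <;>
    rcases negOnePow_cases (i * j) with h3 | h3 <;> simp [h1, h2, h3] <;> abel

theorem IsHom.formsMap {𝒜 : DGAlg K A} {ℬ : DGAlg K B} {φ : A →ₗ[K] B} (h : 𝒜.IsHom ℬ φ) :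
    𝒜.forms.IsHom ℬ.forms (Forms.map φ) where
  map_mem hx := ⟨PolyCoeff.map_mem_sub (fun _ ha => h.map_mem ha) hx.1,
    PolyCoeff.map_mem_sub (fun _ ha => h.map_mem ha) hx.2⟩
  map_d x := by
    have h1 : φ ∘ₗ 𝒜.d = ℬ.d ∘ₗ φ := LinearMap.ext h.map_d
    have h2 : φ ∘ₗ 𝒜.sgn = ℬ.sgn ∘ₗ φ := LinearMap.ext h.map_sgn
    refine Forms.ext ?_ ?_ <;>
    simp [Forms.map, forms, fnPart_d, dtCoeff_d, PolyCoeff.map_map, h1, ← PolyCoeff.deriv_map, h2]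
  map_mul x y := by
    have h2 : φ ∘ₗ 𝒜.sgn = ℬ.sgn ∘ₗ φ := LinearMap.ext h.map_sgn
    refine Forms.ext ?_ ?_ <;>
    simp [Forms.map, fnPart_mul, dtCoeff_mul, PolyCoeff.map_map,
      PolyCoeff.map_mul 𝒜.mul ℬ.mul φ h.map_mul, h2]

theorem IsHom.formsEval (𝒜 : DGAlg K A) (c : K) : 𝒜.forms.IsHom 𝒜 (Forms.eval c) where
  map_mem hx := PolyCoeff.eval_mem c hx.1
  map_d x := by simp [Forms.eval, forms, fnPart_d, PolyCoeff.eval_map]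
  map_mul x y := by simp [Forms.eval, fnPart_mul, PolyCoeff.eval_mul]

end forms
end DGAlg

/-! ### Endomorphisms and affine endomorphisms of a DG vector space -/

namespace DGSpace

section endo

variable {K V : Type*} [Field K] [AddCommGroup V] [Module K V]

/-- The linear endomorphisms of degree `n`. -/
def homDeg (D : DGSpace K V) (n : ℤ) : Submodule K (Module.End K V) where
  carrier := {f | ∀ i, ∀ v ∈ D.gr i, f v ∈ D.gr (i + n)}
  zero_mem' := fun _ _ _ => zero_mem _
  add_mem' := fun hf hg i v hv => add_mem (hf i v hv) (hg i v hv)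
  smul_mem' := fun c _ hf i v hv => Submodule.smul_mem _ c (hf i v hv)

/-- `End*(V) = ⨁ n, Endⁿ(V)`, as a space of linear endomorphisms of `V = ⨁ i, Vⁱ`. -/
def endStar (D : DGSpace K V) : Submodule K (Module.End K V) := ⨆ n, D.homDeg n

theorem endStar_induct (D : DGSpace K V) {P : Module.End K V → Prop} {f : Module.End K V}
    (hf : f ∈ D.endStar) (hom : ∀ n, ∀ f ∈ D.homDeg n, P f) (zero : P 0)
    (add : ∀ f g, P f → P g → P (f + g)) : P f :=
  Submodule.iSup_induction D.homDeg (motive := P) hf hom zero add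

theorem mem_endStar (D : DGSpace K V) {n : ℤ} {f : Module.End K V} (hf : f ∈ D.homDeg n) :
    f ∈ D.endStar := Submodule.mem_iSup_of_mem n hf

theorem comp_mem_homDeg (D : DGSpace K V) {m n : ℤ} {f g : Module.End K V} (hf : f ∈ D.homDeg m)
    (hg : g ∈ D.homDeg n) : f ∘ₗ g ∈ D.homDeg (m + n) := by
  intro i v hv
  have := hf _ _ (hg i v hv)
  rwa [add_assoc, add_comm n m] at this

theorem comp_mem_endStar (D : DGSpace K V) {f g : Module.End K V} (hf : f ∈ D.endStar)
    (hg : g ∈ D.endStar) : f ∘ₗ g ∈ D.endStar := by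
  refine D.endStar_induct (P := fun f => f ∘ₗ g ∈ D.endStar) hf ?_ (by simp) ?_
  · intro m f hf
    refine D.endStar_induct (P := fun g => f ∘ₗ g ∈ D.endStar) hg
      (fun n g hg => D.mem_endStar (D.comp_mem_homDeg hf hg)) (by simp) ?_
    intro g h hg hh
    rw [LinearMap.comp_add]; exact add_mem hg hh
  · intro g h hg hh
    rw [LinearMap.add_comp]; exact add_mem hg hh

/-- The differential `[d, f] = d f - (-1)^{deg f} f d` of `End*(V)`. -/
noncomputable def endD (D : DGSpace K V) : Module.End K V →ₗ[K] Module.End K V where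
  toFun f := D.d ∘ₗ f - D.sgn ∘ₗ f ∘ₗ D.sgn ∘ₗ D.d
  map_add' f g := by ext; simp; abel
  map_smul' c f := by ext; simp [smul_sub]

theorem sgn_comp_comp_sgn (D : DGSpace K V) {n : ℤ} {f : Module.End K V} (hf : f ∈ D.homDeg n)
    (v : V) : D.sgn (f (D.sgn v)) = n.negOnePow • f v := by
  refine D.induct (P := fun v => D.sgn (f (D.sgn v)) = n.negOnePow • f v) v ?_ (by simp) ?_
  · intro i v hv
    rw [D.sgn_of_mem hv, map_sign, map_sign, D.sgn_of_mem (hf i v hv), smul_smul,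
      Int.negOnePow_add, ← mul_assoc]
    simp
  · intro v w hv hw
    simp only [map_add, smul_add, hv, hw]

theorem endD_of_mem (D : DGSpace K V) {n : ℤ} {f : Module.End K V} (hf : f ∈ D.homDeg n)
    (v : V) : D.endD f v = D.d (f v) - n.negOnePow • f (D.d v) := by
  rw [← D.sgn_comp_comp_sgn hf]; rfl

theorem endD_mem_homDeg (D : DGSpace K V) {n : ℤ} {f : Module.End K V} (hf : f ∈ D.homDeg n) :
    D.endD f ∈ D.homDeg (n + 1) := by
  intro i v hv
  rw [D.endD_of_mem hf, ← add_assoc]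
  refine sub_mem (D.d_mem (hf i v hv)) ?_
  have := hf _ _ (D.d_mem hv)
  rw [Units.smul_def, add_right_comm]
  exact zsmul_mem this _

theorem endD_mem_endStar (D : DGSpace K V) {f : Module.End K V} (hf : f ∈ D.endStar) :
    D.endD f ∈ D.endStar := by
  refine D.endStar_induct (P := fun f => D.endD f ∈ D.endStar) hf
    (fun n f hf => D.mem_endStar (D.endD_mem_homDeg hf)) (by simp) ?_
  intro f g hf hg
  rw [map_add]; exact add_mem hf hg

/-- `End*(V)`, as a type. -/
def EndStar (D : DGSpace K V) : Type _ := ↥D.endStar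

noncomputable instance (D : DGSpace K V) : AddCommGroup D.EndStar :=
  inferInstanceAs (AddCommGroup D.endStar)

noncomputable instance (D : DGSpace K V) : Module K D.EndStar :=
  inferInstanceAs (Module K D.endStar)

/-- The inclusion of `End*(V)` in the linear endomorphisms of `V`. -/
noncomputable def toEnd (D : DGSpace K V) : D.EndStar →ₗ[K] Module.End K V := D.endStar.subtype

theorem endStar_ext {D : DGSpace K V} {f g : D.EndStar} (h : ∀ v, D.toEnd f v = D.toEnd g v) :
    f = g := Subtype.ext (LinearMap.ext h)

theorem toEnd_mem (D : DGSpace K V) (f : D.EndStar) : D.toEnd f ∈ D.endStar := f.2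

/-- An element of `End*(V)` from a linear endomorphism. -/
noncomputable def endMk (D : DGSpace K V) (f : Module.End K V) (hf : f ∈ D.endStar) : D.EndStar := ⟨f, hf⟩

@[simp] theorem toEnd_endMk (D : DGSpace K V) (f : Module.End K V) (hf : f ∈ D.endStar) :
    D.toEnd (D.endMk f hf) = f := rfl

/-- The DG associative algebra `End*(V) = Hom*(V, V)`, with the composition product and the
differential `f ↦ d f - (-1)^{deg f} f d`. -/
noncomputable def endAlg (D : DGSpace K V) : DGAlg K D.EndStar where
  gr n := (D.homDeg n).comap D.toEnd
  isInternal := by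
    refine DirectSum.isInternal_submodule_of_iSupIndep_of_iSup_eq_top ?_ ?_
    · intro i
      rw [Submodule.disjoint_def]
      intro f hf hf'
      have hf : D.toEnd f ∈ D.homDeg i := hf
      refine endStar_ext fun v => ?_
      rw [map_zero]
      refine D.induct (P := fun v => D.toEnd f v = 0) v ?_ (by simp) ?_
      · intro k v hv
        have key : (⨆ j, ⨆ (_ : j ≠ i), (D.homDeg j).comap D.toEnd) ≤
            LinearMap.ker (D.proj (k + i) ∘ₗ LinearMap.applyₗ v ∘ₗ D.toEnd) :=
          iSup₂_le fun j hj g hg => D.proj_of_ne (hg k v hv) (by omega)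
        have h1 : D.proj (k + i) (D.toEnd f v) = 0 := key hf'
        rwa [D.proj_self (hf k v hv)] at h1
      · intro v w hv hw
        rw [map_add, hv, hw, add_zero]
    · rw [eq_top_iff]
      rintro ⟨f, hf⟩ -
      refine Submodule.iSup_induction' D.homDeg
        (motive := fun f hf => D.endMk f hf ∈ ⨆ n, (D.homDeg n).comap D.toEnd) ?_ ?_ ?_ hf
      · intro n f hf
        exact Submodule.mem_iSup_of_mem n hf
      · exact zero_mem _
      · intro f g hf hg h1 h2
        exact add_mem h1 h2
  d := D.endD.restrict fun _ hf => D.endD_mem_endStar hf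
  d_mem hf := D.endD_mem_homDeg hf
  d_d f := by
    refine endStar_ext fun v => ?_
    change D.endD (D.endD (D.toEnd f)) v = 0
    simp [endD, D.d_d, D.sgn_d]
  mul := LinearMap.mk₂ K
    (fun f g => D.endMk (D.toEnd f ∘ₗ D.toEnd g) (D.comp_mem_endStar f.2 g.2))
    (by intros; apply endStar_ext; intro v; simp)
    (by intros; apply endStar_ext; intro v; simp)
    (by intros; apply endStar_ext; intro v; simp)
    (by intros; apply endStar_ext; intro v; simp)
  mul_mem hf hg := D.comp_mem_homDeg hf hg
  leibniz {n f} g hf := by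
    have hf : D.toEnd f ∈ D.homDeg n := hf
    have hf' : ∀ v, D.toEnd f v = n.negOnePow • D.sgn (D.toEnd f (D.sgn v)) := by
      intro v
      rw [D.sgn_comp_comp_sgn hf, smul_smul]; simp
    refine endStar_ext fun v => ?_
    change D.endD (D.toEnd f ∘ₗ D.toEnd g) v =
      D.endD (D.toEnd f) (D.toEnd g v) + n.negOnePow • D.toEnd f (D.endD (D.toEnd g) v)
    rw [D.endD_of_mem hf]
    simp only [endD, LinearMap.coe_mk, AddHom.coe_mk, LinearMap.sub_apply, LinearMap.comp_apply,
      map_sub, smul_sub]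
    rw [hf' (D.sgn (D.toEnd g (D.sgn (D.d v)))), smul_smul, D.sgn_sgn]
    simp

instance (D : DGSpace K V) : D.endAlg.IsAssoc where
  mul_assoc _ _ _ := rfl

theorem endAlg_proj_apply (D : DGSpace K V) (n : ℤ) (f : D.EndStar) {i : ℤ} {v : V}
    (hv : v ∈ D.gr i) : D.toEnd (D.endAlg.proj n f) v = D.proj (i + n) (D.toEnd f v) := by
  refine D.endAlg.induct
    (P := fun f => D.toEnd (D.endAlg.proj n f) v = D.proj (i + n) (D.toEnd f v)) f ?_ (by simp) ?_
  · intro m f hf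
    have hf' : D.toEnd f ∈ D.homDeg m := hf
    by_cases h : m = n
    · subst h
      rw [D.endAlg.proj_self hf, D.proj_self (hf' i v hv)]
    · rw [D.endAlg.proj_of_ne hf h, D.proj_of_ne (hf' i v hv) (by omega)]; simp
  · intro f g hf hg
    simp only [map_add, LinearMap.add_apply, hf, hg]

/-- `Aff(V) = End*(V) ⊕ V`, the affine endomorphisms of `V`, as a DG associative algebra with
product `(f, v) (g, u) = (f g, f u)`. -/
noncomputable def affAlg (D : DGSpace K V) : DGAlg K (D.EndStar × V) where
  toDGSpace := D.endAlg.toDGSpace.prod D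
  mul := LinearMap.mk₂ K (fun x y => (D.endAlg.mul x.1 y.1, D.toEnd x.1 y.2))
    (by intros; simp) (by intros; simp) (by intros; simp) (by intros; simp)
  mul_mem {i j a b} ha hb := by
    refine ⟨D.endAlg.mul_mem ha.1 hb.1, ?_⟩
    have := ha.1 _ _ hb.2
    rwa [add_comm] at this
  leibniz {i a} b ha := by
    refine Prod.ext (D.endAlg.leibniz b.1 ha.1) ?_
    have h : D.toEnd a.1 ∈ D.homDeg i := ha.1
    change D.d (D.toEnd a.1 b.2) =
      D.endD (D.toEnd a.1) b.2 + i.negOnePow • D.toEnd a.1 (D.d b.2)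
    rw [D.endD_of_mem h]
    abel

instance (D : DGSpace K V) : D.affAlg.IsAssoc where
  mul_assoc _ _ _ := rfl

/-- `End*(V; F) = {f | f(F) ⊆ F}`. -/
noncomputable def endSub (D : DGSpace K V) (F : Submodule K V) : Submodule K D.EndStar where
  carrier := {f | ∀ v ∈ F, D.toEnd f v ∈ F}
  zero_mem' := fun _ _ => zero_mem _
  add_mem' := fun hf hg v hv => add_mem (hf v hv) (hg v hv)
  smul_mem' := fun c _ hf v hv => Submodule.smul_mem _ c (hf v hv)

/-- `Aff(V; F) = End*(V; F) ⊕ F`. -/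
noncomputable def affSub (D : DGSpace K V) (F : Submodule K V) : Submodule K (D.EndStar × V) :=
  (D.endSub F).prod F

theorem IsSubspace.sgn_mem {D : DGSpace K V} {F : Submodule K V} (hF : D.IsSubspace F) {v : V}
    (hv : v ∈ F) : D.sgn v ∈ F := by
  obtain ⟨s, hs⟩ := D.exists_sum_proj v
  rw [hs s subset_rfl, map_sum]
  refine sum_mem fun i _ => ?_
  rw [D.sgn_of_mem (D.proj_mem i v), Units.smul_def]
  exact zsmul_mem (hF.proj_mem i hv) _

theorem IsSubspace.endSub {D : DGSpace K V} {F : Submodule K V} (hF : D.IsSubspace F) :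
    D.endAlg.IsSubalgebra (D.endSub F) where
  proj_mem n f hf := by
    intro v hv
    obtain ⟨s, hs⟩ := D.exists_sum_proj v
    rw [hs s subset_rfl, map_sum]
    refine sum_mem fun i _ => ?_
    rw [D.endAlg_proj_apply n f (D.proj_mem i v)]
    exact hF.proj_mem _ (hf _ (hF.proj_mem i hv))
  d_mem {f} hf := fun v hv => sub_mem (hF.d_mem (hf v hv))
    (hF.sgn_mem (hf _ (hF.sgn_mem (hF.d_mem hv))))
  mul_mem hf hg := fun v hv => hf _ (hg v hv)

theorem prod_proj {W : Type*} [AddCommGroup W] [Module K W] (D : DGSpace K V) (E : DGSpace K W)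
    (i : ℤ) (x : V × W) : (D.prod E).proj i x = (D.proj i x.1, E.proj i x.2) := by
  have h1 : (D.prod E).IsHom D (LinearMap.fst K V W) :=
    { map_mem := fun h => h.1, map_d := fun _ => rfl }
  have h2 : (D.prod E).IsHom E (LinearMap.snd K V W) :=
    { map_mem := fun h => h.2, map_d := fun _ => rfl }
  exact Prod.ext (h1.map_proj i x) (h2.map_proj i x)

theorem IsSubspace.affSub {D : DGSpace K V} {F : Submodule K V} (hF : D.IsSubspace F) :
    D.affAlg.IsSubalgebra (D.affSub F) where
  proj_mem n x hx := by
    have h := prod_proj D.endAlg.toDGSpace D n x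
    change (D.endAlg.toDGSpace.prod D).proj n x ∈ D.affSub F
    rw [h]
    exact ⟨hF.endSub.proj_mem n hx.1, hF.proj_mem n hx.2⟩
  d_mem hx := ⟨hF.endSub.d_mem hx.1, hF.d_mem hx.2⟩
  mul_mem hx hy := ⟨hF.endSub.mul_mem hx.1 hy.1, hx.1 _ hy.2⟩

end endo
end DGSpace

/-! ### The Thom-Whitney double fibre of a commutative square -/

/-- A commutative square of DG algebras
```
  A₀₀ --h₀--> A₀₁
   |v₀         |v₁
  A₁₀ --h₁--> A₁₁
``` -/
structure DGSquare (K A₀₀ A₀₁ A₁₀ A₁₁ : Type*) [Field K] [AddCommGroup A₀₀] [Module K A₀₀]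
    [AddCommGroup A₀₁] [Module K A₀₁] [AddCommGroup A₁₀] [Module K A₁₀]
    [AddCommGroup A₁₁] [Module K A₁₁] where
  alg₀₀ : DGAlg K A₀₀
  alg₀₁ : DGAlg K A₀₁
  alg₁₀ : DGAlg K A₁₀
  alg₁₁ : DGAlg K A₁₁
  h₀ : A₀₀ →ₗ[K] A₀₁
  v₀ : A₀₀ →ₗ[K] A₁₀
  h₁ : A₁₀ →ₗ[K] A₁₁
  v₁ : A₀₁ →ₗ[K] A₁₁
  isHom_h₀ : alg₀₀.IsHom alg₀₁ h₀
  isHom_v₀ : alg₀₀.IsHom alg₁₀ v₀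
  isHom_h₁ : alg₁₀.IsHom alg₁₁ h₁
  isHom_v₁ : alg₀₁.IsHom alg₁₁ v₁
  comm : ∀ a, v₁ (h₀ a) = h₁ (v₀ a)

namespace DGSquare

section

variable {K A₀₀ A₀₁ A₁₀ A₁₁ : Type*} [Field K] [AddCommGroup A₀₀] [Module K A₀₀]
    [AddCommGroup A₀₁] [Module K A₀₁] [AddCommGroup A₁₀] [Module K A₁₀]
    [AddCommGroup A₁₁] [Module K A₁₁]

/-- The DG algebra `A₀₀ × Ω(Δ¹; A₀₁) × Ω(Δ¹; A₁₀) × Ω(Δ¹ × Δ¹; A₁₁)`. Here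
`Ω(Δ¹ × Δ¹; A₁₁) = A₁₁[s, ds][t, dt]`, where `s` is the coordinate of the first factor and `t`
that of the second one. -/
noncomputable def ambient (Q : DGSquare K A₀₀ A₀₁ A₁₀ A₁₁) :
    DGAlg K (A₀₀ × Forms K A₀₁ × Forms K A₁₀ × Forms K (Forms K A₁₁)) :=
  Q.alg₀₀.prod (Q.alg₀₁.forms.prod (Q.alg₁₀.forms.prod Q.alg₁₁.forms.forms))

/-- The quadruples `(ω₀₀, ω₀₁, ω₁₀, ω₁₁)` with `ω₀₁|₀ = 0`, `ω₀₁|₁ = h₀ ω₀₀`, `ω₁₀|₀ = 0`,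
`ω₁₀|₁ = v₀ ω₀₀`, `ω₁₁|_{s=0} = 0`, `ω₁₁|_{s=1} = h₁ ω₁₀`, `ω₁₁|_{t=0} = 0` and
`ω₁₁|_{t=1} = v₁ ω₀₁`. -/
noncomputable def tw (Q : DGSquare K A₀₀ A₀₁ A₁₀ A₁₁) :
    Submodule K (A₀₀ × Forms K A₀₁ × Forms K A₁₀ × Forms K (Forms K A₁₁)) where
  carrier := {ω |
    (Forms.eval 0 ω.2.1 = 0 ∧ Forms.eval 1 ω.2.1 = Q.h₀ ω.1) ∧
    (Forms.eval 0 ω.2.2.1 = 0 ∧ Forms.eval 1 ω.2.2.1 = Q.v₀ ω.1) ∧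
    (Forms.map (Forms.eval 0) ω.2.2.2 = 0 ∧
      Forms.map (Forms.eval 1) ω.2.2.2 = Forms.map Q.h₁ ω.2.2.1) ∧
    (Forms.eval 0 ω.2.2.2 = 0 ∧ Forms.eval 1 ω.2.2.2 = Forms.map Q.v₁ ω.2.1)}
  zero_mem' := by simp
  add_mem' := by
    rintro x y ⟨⟨h1, h2⟩, ⟨h3, h4⟩, ⟨h5, h6⟩, h7, h8⟩ ⟨⟨k1, k2⟩, ⟨k3, k4⟩, ⟨k5, k6⟩, k7, k8⟩
    refine ⟨⟨?_, ?_⟩, ⟨?_, ?_⟩, ⟨?_, ?_⟩, ?_, ?_⟩ <;>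
    simp only [Prod.snd_add, Prod.fst_add, map_add, h1, h2, h3, h4, h5, h6, h7, h8, k1, k2, k3,
      k4, k5, k6, k7, k8, add_zero]
  smul_mem' := by
    rintro c x ⟨⟨h1, h2⟩, ⟨h3, h4⟩, ⟨h5, h6⟩, h7, h8⟩
    refine ⟨⟨?_, ?_⟩, ⟨?_, ?_⟩, ⟨?_, ?_⟩, ?_, ?_⟩ <;>
    simp only [Prod.smul_snd, Prod.smul_fst, map_smul, h1, h2, h3, h4, h5, h6, h7, h8, smul_zero]

theorem tw_isSubalgebra (Q : DGSquare K A₀₀ A₀₁ A₁₀ A₁₁) : Q.ambient.IsSubalgebra Q.tw := by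
  have p0 : Q.ambient.IsHom Q.alg₀₀ _ := DGAlg.IsHom.fst _ _
  have q0 := DGAlg.IsHom.snd Q.alg₀₀ (Q.alg₀₁.forms.prod (Q.alg₁₀.forms.prod Q.alg₁₁.forms.forms))
  have q1 := (DGAlg.IsHom.snd Q.alg₀₁.forms (Q.alg₁₀.forms.prod Q.alg₁₁.forms.forms)).comp q0
  have p1 : Q.ambient.IsHom Q.alg₀₁.forms _ := (DGAlg.IsHom.fst _ _).comp q0
  have p2 : Q.ambient.IsHom Q.alg₁₀.forms _ := (DGAlg.IsHom.fst _ _).comp q1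
  have p3 : Q.ambient.IsHom Q.alg₁₁.forms.forms _ := (DGAlg.IsHom.snd _ _).comp q1
  have e (c : K) := DGAlg.IsHom.formsEval Q.alg₁₁.forms c
  have e' (c : K) := (DGAlg.IsHom.formsEval Q.alg₁₁ c).formsMap
  have h := ((DGAlg.IsSubalgebra.ker ((DGAlg.IsHom.formsEval Q.alg₀₁ 0).comp p1)).inf
      (DGAlg.IsSubalgebra.eqLocus ((DGAlg.IsHom.formsEval Q.alg₀₁ 1).comp p1)
        (Q.isHom_h₀.comp p0))).inf
    (((DGAlg.IsSubalgebra.ker ((DGAlg.IsHom.formsEval Q.alg₁₀ 0).comp p2)).inf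
      (DGAlg.IsSubalgebra.eqLocus ((DGAlg.IsHom.formsEval Q.alg₁₀ 1).comp p2)
        (Q.isHom_v₀.comp p0))).inf
    (((DGAlg.IsSubalgebra.ker ((e' 0).comp p3)).inf
      (DGAlg.IsSubalgebra.eqLocus ((e' 1).comp p3) (Q.isHom_h₁.formsMap.comp p2))).inf
    ((DGAlg.IsSubalgebra.ker ((e 0).comp p3)).inf
      (DGAlg.IsSubalgebra.eqLocus ((e 1).comp p3) (Q.isHom_v₁.formsMap.comp p1)))))
  exact h

/-- The Thom-Whitney model `TW^{[2]}` of the double homotopy fibre of a commutative square. -/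
noncomputable def twAlg (Q : DGSquare K A₀₀ A₀₁ A₁₀ A₁₁) : DGAlg K Q.tw :=
  Q.ambient.restrict Q.tw Q.tw_isSubalgebra

instance (Q : DGSquare K A₀₀ A₀₁ A₁₀ A₁₁) [Q.alg₀₀.IsLie] [Q.alg₀₁.IsLie] [Q.alg₁₀.IsLie]
    [Q.alg₁₁.IsLie] : Q.twAlg.IsLie :=
  have : Q.ambient.IsLie := inferInstanceAs
    (Q.alg₀₀.prod (Q.alg₀₁.forms.prod (Q.alg₁₀.forms.prod Q.alg₁₁.forms.forms))).IsLie
  inferInstanceAs (Q.ambient.restrict Q.tw Q.tw_isSubalgebra).IsLie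

end
end DGSquare

/-! ### The Jacobian square -/

namespace DGAlg

theorem IsHom.commutator {K A B : Type*} [Field K] [AddCommGroup A] [Module K A] [AddCommGroup B]
    [Module K B] {𝒜 : DGAlg K A} {ℬ : DGAlg K B} {φ : A →ₗ[K] B} (h : 𝒜.IsHom ℬ φ) :
    𝒜.commutator.IsHom ℬ.commutator φ where
  map_mem := h.map_mem
  map_d := h.map_d
  map_mul a b := by
    refine 𝒜.induct (P := fun a => φ (𝒜.commutator.mul a b) = ℬ.commutator.mul (φ a) (φ b)) a ?_
      (by simp) ?_
    · intro i a ha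
      refine 𝒜.induct (P := fun b => φ (𝒜.commutator.mul a b) = ℬ.commutator.mul (φ a) (φ b)) b ?_
        (by simp) ?_
      · intro j b hb
        rw [𝒜.commutator_of_mem ha hb, ℬ.commutator_of_mem (h.map_mem ha) (h.map_mem hb), map_sub,
          map_sign, h.map_mul, h.map_mul]
      · intro v w hv hw
        simp only [map_add, hv, hw]
    · intro v w hv hw
      simp only [map_add, LinearMap.add_apply, hv, hw]

end DGAlg

namespace DGSpace

section jacobian

variable {K V : Type*} [Field K] [AddCommGroup V] [Module K V]

/-- The Jacobian square of DG-Lie algebras of the pair `(V, F)`: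
```
  End*(V; F) ----> End*(V)
     |σ₀              |σ₀
  Aff(V; F)  ----> Aff(V)
```
The brackets are the graded commutators, the horizontal maps the inclusions, and
`σ₀ f = (f, 0)`. -/
noncomputable def jacobianSquare (D : DGSpace K V) (F : Submodule K V) (hF : D.IsSubspace F) :
    DGSquare K (D.endSub F) D.EndStar (D.affSub F) (D.EndStar × V) where
  alg₀₀ := (D.endAlg.restrict (D.endSub F) hF.endSub).commutator
  alg₀₁ := D.endAlg.commutator
  alg₁₀ := (D.affAlg.restrict (D.affSub F) hF.affSub).commutator
  alg₁₁ := D.affAlg.commutator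
  h₀ := (D.endSub F).subtype
  v₀ := (LinearMap.inl K D.EndStar V).restrict fun _ hf => ⟨hf, zero_mem _⟩
  h₁ := (D.affSub F).subtype
  v₁ := LinearMap.inl K D.EndStar V
  isHom_h₀ := (DGAlg.IsHom.subtype _ _ _).commutator
  isHom_v₀ := DGAlg.IsHom.commutator
    { map_mem := fun h => ⟨h, zero_mem _⟩
      map_d := fun _ => Subtype.ext (Prod.ext rfl (map_zero D.d).symm)
      map_mul := fun f _ => Subtype.ext (Prod.ext rfl (map_zero (D.toEnd f.1)).symm) }
  isHom_h₁ := (DGAlg.IsHom.subtype _ _ _).commutator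
  isHom_v₁ := DGAlg.IsHom.commutator
    { map_mem := fun h => ⟨h, zero_mem _⟩
      map_d := fun _ => Prod.ext rfl (map_zero D.d).symm
      map_mul := fun f _ => Prod.ext rfl (map_zero (D.toEnd f)).symm }
  comm _ := rfl

instance (D : DGSpace K V) (F : Submodule K V) (hF : D.IsSubspace F) :
    (D.jacobianSquare F hF).twAlg.IsLie :=
  have : (D.jacobianSquare F hF).alg₀₀.IsLie := inferInstanceAs
    (D.endAlg.restrict (D.endSub F) hF.endSub).commutator.IsLie
  have : (D.jacobianSquare F hF).alg₀₁.IsLie := inferInstanceAs D.endAlg.commutator.IsLie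
  have : (D.jacobianSquare F hF).alg₁₀.IsLie := inferInstanceAs
    (D.affAlg.restrict (D.affSub F) hF.affSub).commutator.IsLie
  have : (D.jacobianSquare F hF).alg₁₁.IsLie := inferInstanceAs D.affAlg.commutator.IsLie
  inferInstance

/-- The subspace of `(End*(V) ⊕ V)[s, ds][t, dt]` underlying
`TW^{[2]}(End*(V) / End*(V; F), V / F)`: the forms `ω = (a, m)` which vanish for `s = 0` and for
`t = 0`, with `ω|_{s=1}` in `(End*(V; F) ⊕ F)[t, dt]` and `m|_{t=1} = 0`. -/
noncomputable def twAssocSub (D : DGSpace K V) (F : Submodule K V) :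
    Submodule K (Forms K (Forms K (D.EndStar × V))) :=
  (LinearMap.ker (Forms.map (Forms.eval 0)) ⊓
    (LinearMap.range (Forms.map (D.affSub F).subtype)).comap (Forms.map (Forms.eval 1))) ⊓
  (LinearMap.ker (Forms.eval 0) ⊓
    (LinearMap.range (Forms.map (LinearMap.inl K D.EndStar V))).comap (Forms.eval 1))

theorem IsSubspace.twAssocSub {D : DGSpace K V} {F : Submodule K V} (hF : D.IsSubspace F) :
    D.affAlg.forms.forms.IsSubalgebra (D.twAssocSub F) := by
  have e (c : K) := DGAlg.IsHom.formsEval D.affAlg.forms c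
  have e' (c : K) := (DGAlg.IsHom.formsEval D.affAlg c).formsMap
  have h : D.endAlg.IsHom D.affAlg (LinearMap.inl K D.EndStar V) :=
    { map_mem := fun h => ⟨h, zero_mem _⟩
      map_d := fun _ => Prod.ext rfl (map_zero D.d).symm
      map_mul := fun f _ => Prod.ext rfl (map_zero (D.toEnd f)).symm }
  exact ((DGAlg.IsSubalgebra.ker (e' 0)).inf ((DGAlg.IsSubalgebra.range
    (DGAlg.IsHom.subtype D.affAlg (D.affSub F) hF.affSub).formsMap).comap (e' 1))).inf
    ((DGAlg.IsSubalgebra.ker (e 0)).inf ((DGAlg.IsSubalgebra.range h.formsMap).comap (e 1)))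

/-- The DG associative algebra `TW^{[2]}(End*(V) / End*(V; F), V / F)`. -/
noncomputable def twAssoc (D : DGSpace K V) (F : Submodule K V) (hF : D.IsSubspace F) :
    DGAlg K (D.twAssocSub F) :=
  D.affAlg.forms.forms.restrict (D.twAssocSub F) hF.twAssocSub

instance (D : DGSpace K V) (F : Submodule K V) (hF : D.IsSubspace F) :
    (D.twAssoc F hF).IsAssoc :=
  inferInstanceAs (D.affAlg.forms.forms.restrict (D.twAssocSub F) hF.twAssocSub).IsAssoc

end jacobian
end DGSpace

/-! ### `A_∞`-morphisms and `L_∞`-morphisms -/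

namespace DGAlg

section infinity

variable {K A B : Type*} [Field K] [AddCommGroup A] [Module K A] [AddCommGroup B] [Module K B]

/-- The component `q₁ = -d` on `A[1]` of the bar differential. -/
def barD (𝒜 : DGAlg K A) : A →ₗ[K] A := -𝒜.d

/-- The component `q₂ (a, b) = (-1)^{deg a} a b` on `A[1]` of the bar differential, where `deg a`
is the degree of `a` in `A`. -/
noncomputable def barMul (𝒜 : DGAlg K A) : A →ₗ[K] A →ₗ[K] A := 𝒜.mul ∘ₗ 𝒜.sgn

end infinity
end DGAlg

/-- The value of a multilinear map on the first `n` terms of a sequence. -/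
def MultilinearMap.onSeq {K A B : Type*} [Field K] [AddCommGroup A] [Module K A] [AddCommGroup B]
    [Module K B] {n : ℕ} (f : MultilinearMap K (fun _ : Fin n => A) B) (x : ℕ → A) : B :=
  f fun j => x j

/-- The sequence `x₀, …, x_{i-1}, y, x_{i+2}, x_{i+3}, …`. -/
def seqContract {A : Type*} (x : ℕ → A) (i : ℕ) (y : A) : ℕ → A := fun j =>
  if j < i then x j else if j = i then y else x (j + 1)

/-- An `A_∞`-morphism between two DG associative algebras, i.e. a morphism of DG coalgebras
between the reduced bar constructions, given by its components `A[1]^{⊗ n} → B[1]`, `n ≥ 1`, which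
are maps of degree `0`. The degree of `a` in `A[1]` is `deg a - 1`. -/
structure AInfMorphism {K A B : Type*} [Field K] [AddCommGroup A] [Module K A] [AddCommGroup B]
    [Module K B] (𝒜 : DGAlg K A) (ℬ : DGAlg K B) [𝒜.IsAssoc] [ℬ.IsAssoc] where
  toFun : ∀ n : ℕ, MultilinearMap K (fun _ : Fin n => A) B
  /-- there is no component with `n = 0` -/
  zero : toFun 0 = 0
  map_mem : ∀ (n : ℕ) (x : Fin n → A) (deg : Fin n → ℤ), (∀ i, x i ∈ 𝒜.gr (deg i)) →
    toFun n x ∈ ℬ.gr ((∑ i, (deg i - 1)) + 1)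
  /-- compatibility with the bar differentials -/
  rel : ∀ (n : ℕ) (x : ℕ → A) (deg : ℕ → ℤ), (∀ i, x i ∈ 𝒜.gr (deg i)) →
    (∑ i ∈ Finset.range n, (∑ j ∈ Finset.range i, (deg j - 1)).negOnePow •
        (toFun n).onSeq (Function.update x i (𝒜.barD (x i)))) +
      (∑ i ∈ Finset.range (n - 1), (∑ j ∈ Finset.range i, (deg j - 1)).negOnePow •
        (toFun (n - 1)).onSeq (seqContract x i (𝒜.barMul (x i) (x (i + 1))))) =
    ℬ.barD ((toFun n).onSeq x) +
      ∑ k ∈ Finset.range (n + 1),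
        ℬ.barMul ((toFun k).onSeq x) ((toFun (n - k)).onSeq fun j => x (k + j))

/-- The linear component of an `A_∞`-morphism. -/
def AInfMorphism.linear {K A B : Type*} [Field K] [AddCommGroup A] [Module K A] [AddCommGroup B]
    [Module K B] {𝒜 : DGAlg K A} {ℬ : DGAlg K B} [𝒜.IsAssoc] [ℬ.IsAssoc]
    (f : AInfMorphism 𝒜 ℬ) : A →ₗ[K] B :=
  (MultilinearMap.ofSubsingleton K A B (0 : Fin 1)).symm (f.toFun 1)

/-- An `A_∞`-morphism is a quasi-isomorphism if its linear component is. -/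
def AInfMorphism.IsQuasiIso {K A B : Type*} [Field K] [AddCommGroup A] [Module K A]
    [AddCommGroup B] [Module K B] {𝒜 : DGAlg K A} {ℬ : DGAlg K B} [𝒜.IsAssoc] [ℬ.IsAssoc]
    (f : AInfMorphism 𝒜 ℬ) : Prop :=
  𝒜.toDGSpace.IsQuasiIso ℬ.toDGSpace f.linear

/-- The sequence `x_{σ 0}, …, x_{σ (n-1)}, x_n, x_{n+1}, …`. -/
def seqPerm {A : Type*} {n : ℕ} (σ : Equiv.Perm (Fin n)) (x : ℕ → A) : ℕ → A := fun j =>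
  if h : j < n then x (σ ⟨j, h⟩) else x j

/-- The Koszul sign `ε` with `x_0 ⊙ ⋯ ⊙ x_{n-1} = ε x_{σ 0} ⊙ ⋯ ⊙ x_{σ (n-1)}` in the symmetric
coalgebra of `A[1]`, where `x_i` has degree `deg i - 1` in `A[1]`. -/
def koszulSign {n : ℕ} (σ : Equiv.Perm (Fin n)) (deg : ℕ → ℤ) : ℤˣ :=
  ∏ i : Fin n, ∏ j : Fin n,
    if i < j ∧ σ j < σ i then ((deg (σ i) - 1) * (deg (σ j) - 1)).negOnePow else 1

/-- The unshuffles of type `(k, n - k)`: the permutations with `σ 0 < ⋯ < σ (k-1)` and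
`σ k < ⋯ < σ (n-1)`. -/
def unshuffles (n k : ℕ) : Finset (Equiv.Perm (Fin n)) :=
  Finset.univ.filter fun σ =>
    ∀ i j : Fin n, i < j → ((j : ℕ) < k ∨ k ≤ (i : ℕ)) → σ i < σ j

/-- An `L_∞`-morphism between two DG-Lie algebras, i.e. a morphism of DG coalgebras between the
reduced symmetric coalgebras of `A[1]` and `B[1]`, given by its components `A[1]^{⊙ n} → B[1]`,
`n ≥ 1`, which are graded symmetric maps of degree `0`. -/
structure LInfMorphism {K A B : Type*} [Field K] [AddCommGroup A] [Module K A] [AddCommGroup B]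
    [Module K B] (𝒜 : DGAlg K A) (ℬ : DGAlg K B) [𝒜.IsLie] [ℬ.IsLie] where
  toFun : ∀ n : ℕ, MultilinearMap K (fun _ : Fin n => A) B
  /-- there is no component with `n = 0` -/
  zero : toFun 0 = 0
  map_mem : ∀ (n : ℕ) (x : Fin n → A) (deg : Fin n → ℤ), (∀ i, x i ∈ 𝒜.gr (deg i)) →
    toFun n x ∈ ℬ.gr ((∑ i, (deg i - 1)) + 1)
  symm : ∀ (n : ℕ) (x : ℕ → A) (deg : ℕ → ℤ), (∀ i, x i ∈ 𝒜.gr (deg i)) →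
    ∀ σ : Equiv.Perm (Fin n),
      koszulSign σ deg • (toFun n).onSeq (seqPerm σ x) = (toFun n).onSeq x
  /-- compatibility with the differentials of the symmetric coalgebras -/
  rel : ∀ (n : ℕ) (x : ℕ → A) (deg : ℕ → ℤ), (∀ i, x i ∈ 𝒜.gr (deg i)) →
    (∑ σ ∈ unshuffles n 1, koszulSign σ deg •
        (toFun n).onSeq (Function.update (seqPerm σ x) 0 (𝒜.barD (seqPerm σ x 0)))) +
      (∑ σ ∈ unshuffles n 2, koszulSign σ deg •
        (toFun (n - 1)).onSeq
          (seqContract (seqPerm σ x) 0 (𝒜.barMul (seqPerm σ x 0) (seqPerm σ x 1)))) =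
    ℬ.barD ((toFun n).onSeq x) +
      (2 : K)⁻¹ • ∑ k ∈ Finset.range (n + 1), ∑ σ ∈ unshuffles n k, koszulSign σ deg •
        ℬ.barMul ((toFun k).onSeq (seqPerm σ x))
          ((toFun (n - k)).onSeq fun j => seqPerm σ x (k + j))

/-- The linear component of an `L_∞`-morphism. -/
def LInfMorphism.linear {K A B : Type*} [Field K] [AddCommGroup A] [Module K A] [AddCommGroup B]
    [Module K B] {𝒜 : DGAlg K A} {ℬ : DGAlg K B} [𝒜.IsLie] [ℬ.IsLie]
    (f : LInfMorphism 𝒜 ℬ) : A →ₗ[K] B :=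
  (MultilinearMap.ofSubsingleton K A B (0 : Fin 1)).symm (f.toFun 1)

/-- An `L_∞`-morphism is a quasi-isomorphism if its linear component is. -/
def LInfMorphism.IsQuasiIso {K A B : Type*} [Field K] [AddCommGroup A] [Module K A]
    [AddCommGroup B] [Module K B] {𝒜 : DGAlg K A} {ℬ : DGAlg K B} [𝒜.IsLie] [ℬ.IsLie]
    (f : LInfMorphism 𝒜 ℬ) : Prop :=
  𝒜.toDGSpace.IsQuasiIso ℬ.toDGSpace f.linear

/-! ### Iterated integrals -/

namespace DGAlg

section iterated

variable {K A : Type*} [Field K] [AddCommGroup A] [Module K A]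

/-- `iterPrim n (x_0, …, x_n)` is the polynomial
`t ↦ ∫_{0 ≤ t_0 ≤ ⋯ ≤ t_n ≤ t} x_0(t_0) ⋯ x_n(t_n) dt_0 ⋯ dt_n`, the products being taken in `A`. -/
noncomputable def iterPrim (𝒜 : DGAlg K A) :
    ∀ n : ℕ, MultilinearMap K (fun _ : Fin (n + 1) => PolyCoeff K A) (PolyCoeff K A)
  | 0 => MultilinearMap.ofSubsingleton K (PolyCoeff K A) (PolyCoeff K A) (0 : Fin 1) PolyCoeff.prim
  | n + 1 => MultilinearMap.uncurryRight
      (LinearMap.compMultilinearMap ((PolyCoeff.mul 𝒜.mul).compr₂ PolyCoeff.prim) (iterPrim 𝒜 n))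

/-- The iterated integral `∫_{0 ≤ t_0 ≤ ⋯ ≤ t_n ≤ 1} x_0(t_0) ⋯ x_n(t_n) dt_0 ⋯ dt_n`. -/
noncomputable def iterIntegral (𝒜 : DGAlg K A) (n : ℕ) :
    MultilinearMap K (fun _ : Fin (n + 1) => PolyCoeff K A) A :=
  (PolyCoeff.eval 1).compMultilinearMap (𝒜.iterPrim n)

end iterated
end DGAlg

namespace DGSpace

section iterated

variable {K V : Type*} [Field K] [AddCommGroup V] [Module K V]

/-- The multilinear map which sends `ω_0, …, ω_n ∈ (End*(V) ⊕ V)[s, ds][t, dt]`, with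
`ω_i = … + x_i(t) dt` for `x_i(t) ∈ (End*(V) ⊕ V)[s, ds][t]`, to the class modulo `F` of the
component in `V` of `∫_{0 ≤ s ≤ 1} ∫_{0 ≤ t_0 ≤ ⋯ ≤ t_n ≤ 1} x_0(t_0) ⋯ x_n(t_n) dt_0 ⋯ dt_n`.
The products are those of the DG algebra `(End*(V) ⊕ V)[s, ds]`. -/
noncomputable def iteratedIntegral (D : DGSpace K V) (F : Submodule K V) (n : ℕ) :
    MultilinearMap K (fun _ : Fin (n + 1) => Forms K (Forms K (D.EndStar × V))) (V ⧸ F) :=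
  (F.mkQ ∘ₗ LinearMap.snd K D.EndStar V ∘ₗ Forms.integral).compMultilinearMap
    ((D.affAlg.forms.iterIntegral n).compLinearMap fun _ => Forms.dtCoeff)

/-- The form `e s^j (ds)^b t^k dt` in `(End*(V) ⊕ V)[s, ds][t, dt]`, for `b = 0` or `b = 1`. -/
noncomputable def monomialForm (D : DGSpace K V) (e : D.EndStar × V) (j : ℕ) (b : Bool) (k : ℕ) :
    Forms K (Forms K (D.EndStar × V)) :=
  let p : PolyCoeff K (D.EndStar × V) := e ⊗ₜ[K] (Polynomial.X ^ j)
  Forms.mk 0 ((if b then Forms.mk 0 p else Forms.mk p 0) ⊗ₜ[K] (Polynomial.X ^ k))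

end iterated
end DGSpace

/-!
The `A_∞`-relations are instances of Stokes' formula. For forms `ω_i = y_i(t) + x_i(t) dt` with
coefficients in a DG algebra, the iterated integral of `x_0 dt, …, x_n dt` over the simplex
`0 ≤ t_0 ≤ ⋯ ≤ t_n ≤ 1` has a boundary: the faces `t_i = t_{i+1}` give the products of neighbouring
forms, the face `t_0 = 0` gives nothing because `ω_0` vanishes there, and the face `t_n = 1` gives
a product with last factor `y_n(1)` (`DGAlg.sum_iter_forms_d`, which is proved by induction on `n`
from integration by parts). In `TW^{[2]}` the forms `ω|_{t=1}` have no component in `V`, so that the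
last face does not contribute to the component in `V`. The coefficients are themselves forms in `s`;
the differential of their integral over `0 ≤ s ≤ 1` produces the values at `s = 0`, which vanish,
and at `s = 1`, which lie in `F` (`DGSpace.endpointIntegral_map_d`). Together these are the
relations `DGSpace.integralComponent_rel`, the product of `V / F [-2]` being zero.

The linear component is `ω ↦ ∫∫ ω` modulo `F`. It is surjective on cohomology because `v ds dt` can
be completed to a cocycle (`DGSpace.exists_cocycle`). If `ω` is a cocycle with exact integral, then
integration in the direction of `t` gives a primitive of `ω` which satisfies all the boundary
conditions except the one for the component in `V` at `t = 1`; the defect is a closed form in `s`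
with exact integral, hence has a primitive in the direction of `s` which allows to correct the first
one (`DGSpace.exists_primitive`).

The maps of the Jacobian square are injective, so an element of the double fibre is determined by
its last component (`DGSpace.doubleFibreEquiv`); that the bracket is the commutator amounts to
`DGAlg.commutator_forms`.

Finally, the symmetrization of an `A_∞`-morphism to a complex with zero product is an `L_∞`-morphism
on the commutator Lie algebra (`AInfMorphism.symmetrize_rel`). The sum of the `A_∞`-relations over
all orders `τ` of the entries, with Koszul signs, is rearranged: a pair of an order `τ` and a
position `i` amounts to the choice of the entry put in the position `i`, which is an unshuffle of type
`(1, n)`, and an order of the result of applying the differential to it. In the same way, `τ` and a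
pair of neighbours `i`, `i + 1` amount to an ordered pair of entries and an order of the result of
multiplying them, and the ordered pairs are the unshuffles of type `(2, n)` together with the two
orders of the first two entries, which make up the commutator. The signs match by the cocycle
property `koszulSign_mul`.
-/

/-! ### Primitives of polynomials with coefficients -/

namespace PolyCoeff

section primitives

variable {K A B C : Type*} [Field K] [AddCommGroup A] [Module K A] [AddCommGroup B] [Module K B]
  [AddCommGroup C] [Module K C]

theorem prim_mem_sub {S : Submodule K A} {x : PolyCoeff K A} (hx : x ∈ sub S) :
    prim x ∈ sub S := by
  refine sub_induct (P := fun x => prim x ∈ sub S) hx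
    (fun a ha p => tmul_mem_sub ha _) (by simp) ?_
  intro x y hx hy
  rw [map_add]; exact add_mem hx hy

theorem prim_map (φ : A →ₗ[K] B) (x : PolyCoeff K A) : prim (map φ x) = map φ (prim x) := by
  refine induct (P := fun x => prim (map φ x) = map φ (prim x)) x (by simp) (by simp) ?_
  intro x y hx hy
  simp only [map_add, hx, hy]

theorem integral_map (φ : A →ₗ[K] B) (x : PolyCoeff K A) :
    integral (map φ x) = φ (integral x) := by
  simp [integral, prim_map, eval_map]

theorem derivative_scalarPrim [CharZero K] (p : K[X]) :
    Polynomial.derivative (scalarPrim p) = p := by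
  induction p using Polynomial.induction_on' with
  | add p q hp hq => simp only [map_add, hp, hq]
  | monomial n c =>
    have h : (n : K) + 1 ≠ 0 := by exact_mod_cast Nat.succ_ne_zero n
    rw [scalarPrim_monomial, Polynomial.derivative_monomial]
    simp [h]

theorem eval_zero_scalarPrim (p : K[X]) : (scalarPrim p).eval 0 = 0 := by
  induction p using Polynomial.induction_on' with
  | add p q hp hq => simp only [map_add, Polynomial.eval_add, hp, hq, add_zero]
  | monomial n c => rw [scalarPrim_monomial]; simp

theorem scalarPrim_derivative [CharZero K] (p : K[X]) :
    scalarPrim (Polynomial.derivative p) = p - Polynomial.C (p.eval 0) := by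
  induction p using Polynomial.induction_on' with
  | add p q hp hq => simp only [map_add, Polynomial.eval_add, hp, hq]; ring
  | monomial n c =>
    rw [Polynomial.derivative_monomial, scalarPrim_monomial]
    rcases n with _ | n
    · simp
    · have h : (n : K) + 1 ≠ 0 := by exact_mod_cast Nat.succ_ne_zero n
      simp [h]

theorem deriv_prim [CharZero K] (x : PolyCoeff K A) : deriv (prim x) = x := by
  refine induct (P := fun x => deriv (prim x) = x) x
    (fun a p => by simp [derivative_scalarPrim]) (by simp) ?_
  intro x y hx hy
  simp only [map_add, hx, hy]

theorem eval_zero_prim (x : PolyCoeff K A) : eval 0 (prim x) = 0 := by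
  refine induct (P := fun x => eval 0 (prim x) = 0) x
    (fun a p => by simp [eval_zero_scalarPrim]) (by simp) ?_
  intro x y hx hy
  simp only [map_add, hx, hy, add_zero]

theorem prim_deriv [CharZero K] (x : PolyCoeff K A) :
    prim (deriv x) = x - eval 0 x ⊗ₜ[K] 1 := by
  refine induct (P := fun x => prim (deriv x) = x - eval 0 x ⊗ₜ[K] 1) x ?_ (by simp) ?_
  · intro a p
    rw [deriv_tmul, prim_tmul, scalarPrim_derivative, TensorProduct.tmul_sub, eval_tmul,
      TensorProduct.smul_tmul, Polynomial.smul_eq_C_mul, mul_one]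
  · intro x y hx hy
    simp only [map_add, hx, hy, TensorProduct.add_tmul]; abel

theorem prim_deriv_of_eval_zero [CharZero K] {x : PolyCoeff K A} (hx : eval 0 x = 0) :
    prim (deriv x) = x := by
  rw [prim_deriv, hx, TensorProduct.zero_tmul, sub_zero]

theorem integral_deriv [CharZero K] (x : PolyCoeff K A) :
    integral (deriv x) = eval 1 x - eval 0 x := by
  simp [integral, prim_deriv]

/-- Integration by parts. -/
theorem prim_mul_deriv [CharZero K] (μ : A →ₗ[K] B →ₗ[K] C) (a : PolyCoeff K A)
    (y : PolyCoeff K B) :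
    prim (mul μ (prim a) (deriv y)) = mul μ (prim a) y - prim (mul μ a y) := by
  have h := prim_deriv_of_eval_zero (x := mul μ (prim a) y)
    (by rw [eval_mul, eval_zero_prim, map_zero, LinearMap.zero_apply])
  rw [deriv_mul, deriv_prim, map_add] at h
  rw [eq_sub_iff_add_eq', h]

end primitives
end PolyCoeff

/-! ### Iterated integrals of sequences -/

section sequences

theorem seqContract_of_lt {A : Type*} (x : ℕ → A) {i j : ℕ} (y : A) (h : j < i) :
    seqContract x i y j = x j := by
  simp [seqContract, h]

theorem seqContract_self {A : Type*} (x : ℕ → A) (i : ℕ) (y : A) :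
    seqContract x i y i = y := by
  simp [seqContract]

theorem seqContract_of_gt {A : Type*} (x : ℕ → A) {i j : ℕ} (y : A) (h : i < j) :
    seqContract x i y j = x (j + 1) := by
  simp [seqContract, h.not_gt, h.ne']

theorem seqContract_eq_update {A : Type*} (x : ℕ → A) (i : ℕ) (y z : A) :
    seqContract x i y = Function.update (seqContract x i z) i y := by
  funext j
  rcases lt_trichotomy j i with h | rfl | h
  · rw [Function.update_of_ne h.ne, seqContract_of_lt _ _ h, seqContract_of_lt _ _ h]
  · rw [Function.update_self, seqContract_self]
  · rw [Function.update_of_ne h.ne', seqContract_of_gt _ _ h, seqContract_of_gt _ _ h]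

theorem comp_seqContract {A B : Type*} (φ : A → B) (x : ℕ → A) (i : ℕ) (y : A) :
    (fun j => φ (seqContract x i y j)) = seqContract (fun j => φ (x j)) i (φ y) := by
  funext j
  rcases lt_trichotomy j i with h | rfl | h
  · rw [seqContract_of_lt _ _ h, seqContract_of_lt _ _ h]
  · rw [seqContract_self, seqContract_self]
  · rw [seqContract_of_gt _ _ h, seqContract_of_gt _ _ h]

theorem comp_update {A B : Type*} (φ : A → B) (x : ℕ → A) (i : ℕ) (y : A) :
    (fun j => φ (Function.update x i y j)) = Function.update (fun j => φ (x j)) i (φ y) := by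
  funext j
  exact Function.apply_update (fun _ => φ) x i y j

variable {K A B : Type*} [Field K] [AddCommGroup A] [Module K A] [AddCommGroup B] [Module K B]

theorem MultilinearMap.onSeq_congr {n : ℕ} (f : MultilinearMap K (fun _ : Fin n => A) B)
    {x y : ℕ → A} (h : ∀ j < n, x j = y j) : f.onSeq x = f.onSeq y := by
  unfold MultilinearMap.onSeq
  congr 1
  funext j
  exact h j j.2

theorem MultilinearMap.onSeq_update {n : ℕ} (f : MultilinearMap K (fun _ : Fin n => A) B)
    (x : ℕ → A) {i : ℕ} (hi : i < n) (y : A) :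
    f.onSeq (Function.update x i y) = f.toLinearMap (fun j => x j) ⟨i, hi⟩ y := by
  unfold MultilinearMap.onSeq
  rw [MultilinearMap.toLinearMap_apply]
  congr 1
  funext j
  by_cases h : j = ⟨i, hi⟩
  · subst h; simp
  · rw [Function.update_of_ne h, Function.update_of_ne (fun h' => h (Fin.ext h'))]

end sequences

namespace DGAlg

section iterated

variable {K A : Type*} [Field K] [AddCommGroup A] [Module K A]

/-- `iter x n` is the iterated primitive `iterPrim` of `x 0, …, x (n - 1)`, and `0` for `n = 0`. -/
noncomputable def iter (𝒜 : DGAlg K A) :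
    ∀ n : ℕ, MultilinearMap K (fun _ : Fin n => PolyCoeff K A) (PolyCoeff K A)
  | 0 => 0
  | n + 1 => 𝒜.iterPrim n

/-- Left multiplication by `iter n` on `x`; the empty iterated integral acts as a unit. -/
noncomputable def iterMul (𝒜 : DGAlg K A) (x : ℕ → PolyCoeff K A) :
    ℕ → PolyCoeff K A →ₗ[K] PolyCoeff K A
  | 0 => LinearMap.id
  | n + 1 => PolyCoeff.mul 𝒜.mul ((𝒜.iter (n + 1)).onSeq x)

theorem iter_succ (𝒜 : DGAlg K A) (x : ℕ → PolyCoeff K A) (n : ℕ) :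
    (𝒜.iter (n + 1)).onSeq x = PolyCoeff.prim (𝒜.iterMul x n (x n)) := by
  cases n with
  | zero => rfl
  | succ n => rfl

theorem iterMul_congr (𝒜 : DGAlg K A) {x y : ℕ → PolyCoeff K A} {n : ℕ}
    (h : ∀ j < n, x j = y j) : 𝒜.iterMul x n = 𝒜.iterMul y n := by
  cases n with
  | zero => rfl
  | succ n => rw [iterMul, iterMul, MultilinearMap.onSeq_congr _ h]

theorem iterMul_mul (𝒜 : DGAlg K A) [𝒜.IsAssoc] (x : ℕ → PolyCoeff K A) (n : ℕ)
    (y z : PolyCoeff K A) :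
    PolyCoeff.mul 𝒜.mul (𝒜.iterMul x n y) z = 𝒜.iterMul x n (PolyCoeff.mul 𝒜.mul y z) := by
  cases n with
  | zero => rfl
  | succ n => exact 𝒜.polyCoeff_assoc _ _ _

theorem iter_update_succ (𝒜 : DGAlg K A) (x : ℕ → PolyCoeff K A) {i n : ℕ} (hi : i ≤ n)
    (y : PolyCoeff K A) :
    (𝒜.iter (n + 2)).onSeq (Function.update x i y) = PolyCoeff.prim
      (PolyCoeff.mul 𝒜.mul ((𝒜.iter (n + 1)).onSeq (Function.update x i y)) (x (n + 1))) := by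
  rw [iter_succ, iterMul, Function.update_of_ne (by omega)]

theorem iter_update_last (𝒜 : DGAlg K A) (x : ℕ → PolyCoeff K A) (n : ℕ)
    (y : PolyCoeff K A) :
    (𝒜.iter (n + 1)).onSeq (Function.update x n y) = PolyCoeff.prim (𝒜.iterMul x n y) := by
  rw [iter_succ, Function.update_self,
    𝒜.iterMul_congr (y := x) fun j hj => Function.update_of_ne hj.ne _ _]

theorem iter_seqContract_succ (𝒜 : DGAlg K A) (x : ℕ → PolyCoeff K A) {i n : ℕ} (hi : i ≤ n)
    (y : PolyCoeff K A) :
    (𝒜.iter (n + 2)).onSeq (seqContract x i y) = PolyCoeff.prim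
      (PolyCoeff.mul 𝒜.mul ((𝒜.iter (n + 1)).onSeq (seqContract x i y)) (x (n + 2))) := by
  rw [iter_succ, iterMul, seqContract_of_gt _ _ (by omega)]

theorem iter_seqContract_last (𝒜 : DGAlg K A) (x : ℕ → PolyCoeff K A) (n : ℕ)
    (y : PolyCoeff K A) :
    (𝒜.iter (n + 1)).onSeq (seqContract x n y) = PolyCoeff.prim (𝒜.iterMul x n y) := by
  rw [iter_succ, seqContract_self,
    𝒜.iterMul_congr (y := x) fun j hj => seqContract_of_lt _ _ hj]

theorem prim_sign (u : ℤˣ) (x : PolyCoeff K A) :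
    PolyCoeff.prim (u • x) = u • PolyCoeff.prim x := map_sign _ u x

/-- Integration by parts in the last variable. -/
theorem iterMul_deriv_last [CharZero K] (𝒜 : DGAlg K A) [𝒜.IsAssoc] (x : ℕ → PolyCoeff K A)
    (n : ℕ) (y : PolyCoeff K A) :
    PolyCoeff.prim (𝒜.iterMul x (n + 1) (PolyCoeff.deriv y)) = 𝒜.iterMul x (n + 1) y -
      (𝒜.iter (n + 1)).onSeq (seqContract x n (PolyCoeff.mul 𝒜.mul (x n) y)) := by
  rw [iterMul, iter_succ, PolyCoeff.prim_mul_deriv, iter_seqContract_last, iterMul_mul]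

/-- Integration by parts for iterated integrals: the derivative of the `i`-th factor is integrated
over `t_{i-1} ≤ t_i ≤ t_{i+1}`, and its values at the two ends are absorbed by the neighbouring
factors. The signs `s` are arbitrary, so that the identity holds term by term. -/
theorem sum_iter_deriv [CharZero K] (𝒜 : DGAlg K A) [𝒜.IsAssoc] (x y : ℕ → PolyCoeff K A)
    (hy : PolyCoeff.eval 0 (y 0) = 0) (s : ℕ → ℤˣ) (n : ℕ) :
    ∑ i ∈ Finset.range (n + 1),
        s i • (𝒜.iter (n + 1)).onSeq (Function.update x i (PolyCoeff.deriv (y i))) =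
      ∑ i ∈ Finset.range n,
        (s i • (𝒜.iter n).onSeq (seqContract x i (PolyCoeff.mul 𝒜.mul (y i) (x (i + 1)))) -
          s (i + 1) •
            (𝒜.iter n).onSeq (seqContract x i (PolyCoeff.mul 𝒜.mul (x i) (y (i + 1))))) +
      s n • 𝒜.iterMul x n (y n) := by
  induction n with
  | zero =>
    simp [iter_succ, iterMul, PolyCoeff.prim_deriv_of_eval_zero hy]
  | succ n ih =>
    rw [Finset.sum_range_succ]
    have h1 : ∑ i ∈ Finset.range (n + 1),
        s i • (𝒜.iter (n + 2)).onSeq (Function.update x i (PolyCoeff.deriv (y i))) =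
        PolyCoeff.prim (PolyCoeff.mul 𝒜.mul (∑ i ∈ Finset.range (n + 1),
          s i • (𝒜.iter (n + 1)).onSeq (Function.update x i (PolyCoeff.deriv (y i))))
          (x (n + 1))) := by
      rw [map_sum, LinearMap.sum_apply, map_sum]
      refine Finset.sum_congr rfl fun i hi => ?_
      rw [Finset.mem_range] at hi
      rw [iter_update_succ _ _ (by omega), map_sign, LinearMap.smul_apply, prim_sign]
    rw [h1, ih, iter_update_last, iterMul_deriv_last, Finset.sum_range_succ, map_add,
      LinearMap.add_apply, map_add, map_sum, LinearMap.sum_apply, map_sum, map_sign,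
      LinearMap.smul_apply, prim_sign, iterMul_mul, iter_seqContract_last, iter_seqContract_last,
      smul_sub]
    have h2 : ∀ i ∈ Finset.range n, PolyCoeff.prim (PolyCoeff.mul 𝒜.mul
        (s i • (𝒜.iter n).onSeq (seqContract x i (PolyCoeff.mul 𝒜.mul (y i) (x (i + 1)))) -
          s (i + 1) •
            (𝒜.iter n).onSeq (seqContract x i (PolyCoeff.mul 𝒜.mul (x i) (y (i + 1)))))
          (x (n + 1))) =
        s i • (𝒜.iter (n + 1)).onSeq (seqContract x i (PolyCoeff.mul 𝒜.mul (y i) (x (i + 1)))) -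
          s (i + 1) •
            (𝒜.iter (n + 1)).onSeq (seqContract x i (PolyCoeff.mul 𝒜.mul (x i) (y (i + 1)))) := by
      intro i hi
      rw [Finset.mem_range] at hi
      obtain ⟨m, rfl⟩ : ∃ m, n = m + 1 := ⟨n - 1, by omega⟩
      rw [iter_seqContract_succ _ _ (by omega), iter_seqContract_succ _ _ (by omega), map_sub,
        LinearMap.sub_apply, map_sub, map_sign, map_sign, LinearMap.smul_apply,
        LinearMap.smul_apply, prim_sign, prim_sign]
    rw [Finset.sum_congr rfl h2]
    abel

theorem iter_mem_sub (𝒜 : DGAlg K A) {x : ℕ → PolyCoeff K A} {p : ℕ → ℤ}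
    (hx : ∀ i, x i ∈ PolyCoeff.sub (𝒜.gr (p i))) (n : ℕ) :
    (𝒜.iter n).onSeq x ∈ PolyCoeff.sub (𝒜.gr (∑ i ∈ Finset.range n, p i)) := by
  induction n with
  | zero => exact zero_mem _
  | succ n ih =>
    rw [iter_succ]
    refine PolyCoeff.prim_mem_sub ?_
    cases n with
    | zero => simpa [iterMul] using hx 0
    | succ n =>
      rw [Finset.sum_range_succ]
      exact PolyCoeff.mul_mem_sub (fun a ha b hb => 𝒜.mul_mem ha hb) ih (hx _)

/-- The Leibniz rule for iterated integrals. -/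
theorem sum_iter_d (𝒜 : DGAlg K A) {x : ℕ → PolyCoeff K A} {p : ℕ → ℤ}
    (hx : ∀ i, x i ∈ PolyCoeff.sub (𝒜.gr (p i))) (n : ℕ) :
    ∑ i ∈ Finset.range n, (∑ j ∈ Finset.range i, p j).negOnePow •
        (𝒜.iter n).onSeq (Function.update x i (PolyCoeff.map 𝒜.d (x i))) =
      PolyCoeff.map 𝒜.d ((𝒜.iter n).onSeq x) := by
  induction n with
  | zero => simp [iter, MultilinearMap.onSeq]
  | succ n ih =>
    rw [Finset.sum_range_succ]
    cases n with
    | zero => simp [iter_succ, iterMul, PolyCoeff.prim_map]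
    | succ n =>
      have h1 : ∑ i ∈ Finset.range (n + 1), (∑ j ∈ Finset.range i, p j).negOnePow •
          (𝒜.iter (n + 2)).onSeq (Function.update x i (PolyCoeff.map 𝒜.d (x i))) =
          PolyCoeff.prim (PolyCoeff.mul 𝒜.mul (∑ i ∈ Finset.range (n + 1),
            (∑ j ∈ Finset.range i, p j).negOnePow •
            (𝒜.iter (n + 1)).onSeq (Function.update x i (PolyCoeff.map 𝒜.d (x i))))
            (x (n + 1))) := by
        rw [map_sum, LinearMap.sum_apply, map_sum]
        refine Finset.sum_congr rfl fun i hi => ?_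
        rw [Finset.mem_range] at hi
        rw [iter_update_succ _ _ (by omega), map_sign, LinearMap.smul_apply, prim_sign]
      rw [h1, ih, iter_update_last, iter_succ 𝒜 x (n + 1), iterMul, ← PolyCoeff.prim_map,
        𝒜.polyCoeff_leibniz _ (𝒜.iter_mem_sub hx (n + 1)), map_add, prim_sign]

/-- Stokes' formula for iterated integrals of forms `ω i = y i + x i dt` which vanish at `0`: the
boundary faces `t_i = t_{i+1}` give the products of neighbouring forms, and the face `t_n = t` the
last term. -/
theorem sum_iter_forms_d [CharZero K] (𝒜 : DGAlg K A) [𝒜.IsAssoc] {ω : ℕ → Forms K A}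
    {deg : ℕ → ℤ} (hω : ∀ i, ω i ∈ 𝒜.forms.gr (deg i)) (h0 : Forms.eval 0 (ω 0) = 0) (n : ℕ) :
    ∑ i ∈ Finset.range (n + 1), (∑ j ∈ Finset.range i, (deg j - 1)).negOnePow •
        (𝒜.iter (n + 1)).onSeq (Function.update (fun j => Forms.dtCoeff (ω j)) i
          (Forms.dtCoeff (𝒜.forms.d (ω i)))) =
      PolyCoeff.map 𝒜.d ((𝒜.iter (n + 1)).onSeq fun j => Forms.dtCoeff (ω j)) +
      ∑ i ∈ Finset.range n, (∑ j ∈ Finset.range i, (deg j - 1)).negOnePow •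
        (𝒜.iter n).onSeq (seqContract (fun j => Forms.dtCoeff (ω j)) i
          (Forms.dtCoeff (𝒜.forms.barMul (ω i) (ω (i + 1))))) +
      ((∑ j ∈ Finset.range n, (deg j - 1)) + deg n).negOnePow •
        𝒜.iterMul (fun j => Forms.dtCoeff (ω j)) n (Forms.fnPart (ω n)) := by
  set x : ℕ → PolyCoeff K A := fun j => Forms.dtCoeff (ω j) with hx
  set y : ℕ → PolyCoeff K A := fun j => Forms.fnPart (ω j) with hy
  set s : ℕ → ℤˣ := fun i => ((∑ j ∈ Finset.range i, (deg j - 1)) + deg i).negOnePow with hs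
  -- `d ω` has a part along the coefficients, for the Leibniz rule, and a part along `t`, to be
  -- integrated by parts
  have e1 := 𝒜.sum_iter_d (x := x) (fun i => (hω i).2) (n + 1)
  have e2 := 𝒜.sum_iter_deriv x y h0 s n
  have e3 : ∀ i ∈ Finset.range (n + 1), (∑ j ∈ Finset.range i, (deg j - 1)).negOnePow •
        (𝒜.iter (n + 1)).onSeq (Function.update x i (Forms.dtCoeff (𝒜.forms.d (ω i)))) =
      (∑ j ∈ Finset.range i, (deg j - 1)).negOnePow •
        (𝒜.iter (n + 1)).onSeq (Function.update x i (PolyCoeff.map 𝒜.d (x i))) +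
      s i • (𝒜.iter (n + 1)).onSeq (Function.update x i (PolyCoeff.deriv (y i))) := by
    intro i hi
    rw [Finset.mem_range] at hi
    have h : Forms.dtCoeff (𝒜.forms.d (ω i)) =
        (deg i).negOnePow • PolyCoeff.deriv (y i) + PolyCoeff.map 𝒜.d (x i) := by
      rw [← map_sign, ← polyCoeff_sgn 𝒜.toDGSpace (hω i).1]; rfl
    simp only [MultilinearMap.onSeq_update _ _ hi]
    rw [h, map_add, smul_add, map_sign, smul_smul, hs, add_comm]
    simp only [Int.negOnePow_add]
  have e4 : ∀ i ∈ Finset.range n, (∑ j ∈ Finset.range i, (deg j - 1)).negOnePow •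
        (𝒜.iter n).onSeq (seqContract x i (Forms.dtCoeff (𝒜.forms.barMul (ω i) (ω (i + 1))))) =
      s i • (𝒜.iter n).onSeq (seqContract x i (PolyCoeff.mul 𝒜.mul (y i) (x (i + 1)))) -
      s (i + 1) •
        (𝒜.iter n).onSeq (seqContract x i (PolyCoeff.mul 𝒜.mul (x i) (y (i + 1)))) := by
    intro i hi
    rw [Finset.mem_range] at hi
    have h : Forms.dtCoeff (𝒜.forms.barMul (ω i) (ω (i + 1))) =
        (deg i).negOnePow • (PolyCoeff.mul 𝒜.mul (y i) (x (i + 1)) +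
          (deg (i + 1)).negOnePow • PolyCoeff.mul 𝒜.mul (x i) (y (i + 1))) := by
      rw [barMul, LinearMap.comp_apply, 𝒜.forms.sgn_of_mem (hω i), map_sign, LinearMap.smul_apply,
        map_sign, dtCoeff_mul, polyCoeff_sgn 𝒜.toDGSpace (hω (i + 1)).1, map_sign]
    rw [seqContract_eq_update x i (Forms.dtCoeff _) 0,
      seqContract_eq_update x i (PolyCoeff.mul 𝒜.mul (y i) _) 0,
      seqContract_eq_update x i (PolyCoeff.mul 𝒜.mul (x i) _) 0]
    simp only [MultilinearMap.onSeq_update _ _ hi]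
    rw [h, map_sign, map_add, map_sign, smul_add, smul_add, smul_smul, smul_smul, smul_smul, hs]
    have hsign : ((∑ j ∈ Finset.range (i + 1), (deg j - 1)) + deg (i + 1)).negOnePow =
        -((∑ j ∈ Finset.range i, (deg j - 1)).negOnePow *
          ((deg i).negOnePow * (deg (i + 1)).negOnePow)) := by
      rw [Finset.sum_range_succ, Int.negOnePow_add, Int.negOnePow_add, Int.negOnePow_sub,
        Int.negOnePow_one]
      simp [mul_assoc]
    dsimp only
    rw [hsign, Int.negOnePow_add]
    rw [sub_eq_add_neg, ← Units.neg_smul, neg_neg, mul_assoc _ _ (deg (i + 1)).negOnePow]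
  rw [Finset.sum_congr rfl e3, Finset.sum_add_distrib, e1, e2, Finset.sum_congr rfl e4, add_assoc]

end iterated
end DGAlg

/-! ### Explicit values of the iterated integrals -/

namespace PolyCoeff

section products

variable {K A B C E : Type*} [Field K] [AddCommGroup A] [Module K A] [AddCommGroup B] [Module K B]
  [AddCommGroup C] [Module K C] [AddCommGroup E] [Module K E]

theorem mul_zeroHom (x : PolyCoeff K A) (y : PolyCoeff K B) :
    mul (0 : A →ₗ[K] B →ₗ[K] C) x y = 0 := by
  refine ext₂ (f := mul (0 : A →ₗ[K] B →ₗ[K] C)) (g := 0) (mem_sub_top x) y ?_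
  intro a _ p b q
  simp

theorem mul_map_left (μ : B →ₗ[K] E →ₗ[K] C) (φ : A →ₗ[K] B) (x : PolyCoeff K A)
    (y : PolyCoeff K E) : mul μ (map φ x) y = mul (μ ∘ₗ φ) x y := by
  refine ext₂ (f := mul μ ∘ₗ map φ) (g := mul (μ ∘ₗ φ)) (mem_sub_top x) y ?_
  intro a _ p b q
  simp

theorem map_mul_map_right (μ : A →ₗ[K] B →ₗ[K] C) (φ : E →ₗ[K] B) {H : Type*} [AddCommGroup H]
    [Module K H] (ψ : C →ₗ[K] H) (x : PolyCoeff K A) (y : PolyCoeff K E) :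
    map ψ (mul μ x (map φ y)) = mul ((μ.compl₂ φ).compr₂ ψ) x y := by
  refine ext₂ (f := ((mul μ).compl₂ (map φ)).compr₂ (map ψ)) (g := mul ((μ.compl₂ φ).compr₂ ψ))
    (mem_sub_top x) y ?_
  intro a _ p b q
  simp

theorem map_addHom (φ ψ : A →ₗ[K] B) (x : PolyCoeff K A) :
    map (φ + ψ) x = map φ x + map ψ x := by
  simp [map, LinearMap.rTensor_add]

/-- An element without component in `A` lies in the image of `B`. -/
theorem eq_map_inr {x : PolyCoeff K (A × B)} (h : map (LinearMap.fst K A B) x = 0) :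
    x = map (LinearMap.inr K A B) (map (LinearMap.snd K A B) x) := by
  have h1 : (LinearMap.id : A × B →ₗ[K] A × B) = LinearMap.inl K A B ∘ₗ LinearMap.fst K A B +
      LinearMap.inr K A B ∘ₗ LinearMap.snd K A B := by ext <;> simp
  conv_lhs => rw [← map_id x, h1, map_addHom, ← map_map, h, map_zero, zero_add, ← map_map]

/-- An element without component in `B` lies in the image of `A`. -/
theorem eq_map_inl {x : PolyCoeff K (A × B)} (h : map (LinearMap.snd K A B) x = 0) :
    x = map (LinearMap.inl K A B) (map (LinearMap.fst K A B) x) := by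
  have h1 : (LinearMap.id : A × B →ₗ[K] A × B) = LinearMap.inl K A B ∘ₗ LinearMap.fst K A B +
      LinearMap.inr K A B ∘ₗ LinearMap.snd K A B := by ext <;> simp
  conv_lhs => rw [← map_id x, h1, map_addHom, ← map_map, ← map_map, h, map_zero, add_zero]

theorem scalarPrim_X_pow (n : ℕ) :
    scalarPrim (Polynomial.X ^ n : K[X]) = ((n + 1 : ℕ) : K)⁻¹ • Polynomial.X ^ (n + 1) := by
  rw [Polynomial.X_pow_eq_monomial, Polynomial.X_pow_eq_monomial, scalarPrim_monomial,
    Polynomial.smul_monomial]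
  simp

theorem integral_tmul_one (a : A) : integral (a ⊗ₜ[K] (1 : K[X])) = a := by
  have h := scalarPrim_X_pow (K := K) 0
  rw [pow_zero] at h
  simp [integral, h]

end products
end PolyCoeff

namespace DGAlg

section values

variable {K A : Type*} [Field K] [AddCommGroup A] [Module K A]

/-- The product `(⋯ (u₀ u₁) ⋯) uₙ`. -/
noncomputable def leftProd (𝒜 : DGAlg K A) : ∀ n : ℕ, (Fin (n + 1) → A) → A
  | 0, u => u 0
  | n + 1, u => 𝒜.mul (leftProd 𝒜 n (Fin.init u)) (u (Fin.last (n + 1)))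

theorem iterPrim_succ (𝒜 : DGAlg K A) (n : ℕ) (x : Fin (n + 2) → PolyCoeff K A) :
    𝒜.iterPrim (n + 1) x = PolyCoeff.prim (PolyCoeff.mul 𝒜.mul (𝒜.iterPrim n (Fin.init x))
      (x (Fin.last (n + 1)))) := rfl

/-- Iterated integrals of monomials: the `l`-th integration is that of `t^(k_0 + ⋯ + k_l + l)`. -/
theorem iterPrim_tmul_X_pow (𝒜 : DGAlg K A) (n : ℕ) (u : Fin (n + 1) → A)
    (k : Fin (n + 1) → ℕ) :
    𝒜.iterPrim n (fun i => u i ⊗ₜ[K] (Polynomial.X ^ k i : K[X])) =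
      (∏ l : Fin (n + 1), (((∑ i ∈ Finset.univ.filter (fun i => i ≤ l), (k i + 1) : ℕ) :
        K))⁻¹) • 𝒜.leftProd n u ⊗ₜ[K] (Polynomial.X ^ (∑ i, (k i + 1))) := by
  induction n with
  | zero =>
    change PolyCoeff.prim (u 0 ⊗ₜ[K] (Polynomial.X ^ k 0 : K[X])) = _
    rw [PolyCoeff.prim_tmul, PolyCoeff.scalarPrim_X_pow, TensorProduct.tmul_smul]
    simp [leftProd]
  | succ n ih =>
    have h1 : (Fin.init (α := fun _ => PolyCoeff K A)
        fun i => u i ⊗ₜ[K] (Polynomial.X ^ k i : K[X])) =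
      fun i : Fin (n + 1) => u i.castSucc ⊗ₜ[K] (Polynomial.X ^ k i.castSucc : K[X]) := rfl
    rw [iterPrim_succ, h1, ih (fun i => u i.castSucc) (fun i => k i.castSucc), map_smul,
      LinearMap.smul_apply, map_smul, PolyCoeff.mul_tmul, ← pow_add, PolyCoeff.prim_tmul,
      PolyCoeff.scalarPrim_X_pow, TensorProduct.tmul_smul, smul_smul,
      Fin.prod_univ_castSucc (n := n + 1), Fin.sum_univ_castSucc (n := n + 1), ← add_assoc]
    congr 1
    congr 1
    · refine Finset.prod_congr rfl fun l _ => ?_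
      rw [Finset.sum_filter, Finset.sum_filter, Fin.sum_univ_castSucc (n := n + 1),
        if_neg (Fin.castSucc_lt_last l).not_ge, add_zero]
      simp only [Fin.castSucc_le_castSucc_iff]
    · rw [Finset.filter_true_of_mem fun i _ => Fin.le_last i, Fin.sum_univ_castSucc (n := n + 1),
        ← add_assoc]

/-- The form `e s^j (ds)^b` for `b = 0` or `b = 1`. -/
noncomputable def monomial (e : A) (j : ℕ) (b : Bool) : Forms K A :=
  if b then Forms.mk 0 (e ⊗ₜ[K] (Polynomial.X ^ j)) else Forms.mk (e ⊗ₜ[K] (Polynomial.X ^ j)) 0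

theorem mul_monomial (𝒜 : DGAlg K A) (a e : A) (J j : ℕ) (b : Bool) :
    𝒜.forms.mul (monomial a J false) (monomial e j b) =
      (monomial (𝒜.mul a e) (J + j) b : Forms K A) := by
  cases b <;> refine Forms.ext ?_ ?_ <;>
  simp [monomial, fnPart_mul, dtCoeff_mul, pow_add]

theorem mul_monomial_true_false (𝒜 : DGAlg K A) {i : ℤ} (a : A) {e : A} (he : e ∈ 𝒜.gr i)
    (J j : ℕ) :
    𝒜.forms.mul (monomial a J true) (monomial e j false) =
      i.negOnePow • (monomial (𝒜.mul a e) (J + j) true : Forms K A) := by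
  refine Forms.ext ?_ ?_
  · simp [monomial, fnPart_mul]
  · rcases negOnePow_cases i with h | h <;>
    simp [monomial, dtCoeff_mul, 𝒜.sgn_of_mem he, h, pow_add, TensorProduct.neg_tmul]

theorem mul_monomial_true_true (𝒜 : DGAlg K A) (a e : A) (J j : ℕ) :
    𝒜.forms.mul (monomial a J true) (monomial e j true) = (0 : Forms K A) := by
  refine Forms.ext ?_ ?_ <;> simp [monomial, fnPart_mul, dtCoeff_mul]

/-- A product of monomial forms in one variable `s` vanishes if it contains `ds` twice. If `ds`
occurs once, the sign is that of moving it to the right of the coefficients which follow it. -/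
theorem leftProd_monomial (𝒜 : DGAlg K A) (n : ℕ) (e : Fin (n + 1) → A) (deg : Fin (n + 1) → ℤ)
    (he : ∀ i, e i ∈ 𝒜.gr (deg i)) (j : Fin (n + 1) → ℕ) (b : Fin (n + 1) → Bool) :
    𝒜.forms.leftProd n (fun i => monomial (e i) (j i) (b i)) =
      if (Finset.univ.filter fun i => b i = true).card = 0 then
        (monomial (𝒜.leftProd n e) (∑ i, j i) false : Forms K A)
      else if (Finset.univ.filter fun i => b i = true).card = 1 then
        (∏ i, ∏ l, if i < l ∧ b i = true then (deg l).negOnePow else 1) •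
          (monomial (𝒜.leftProd n e) (∑ i, j i) true : Forms K A)
      else 0 := by
  induction n with
  | zero =>
    have hcard : (Finset.univ.filter fun i : Fin (0 + 1) => b i = true).card =
        if b 0 = true then 1 else 0 := by
      rw [Finset.card_filter, Fin.sum_univ_one]
    rw [hcard]
    cases h : b 0 <;> simp [leftProd, h]
  | succ n ih =>
    have ih' := ih (fun i => e i.castSucc) (fun i => deg i.castSucc) (fun i => he i.castSucc)
      (fun i => j i.castSucc) (fun i => b i.castSucc)
    have hl : 𝒜.forms.leftProd (n + 1) (fun i => monomial (e i) (j i) (b i)) =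
        𝒜.forms.mul (𝒜.forms.leftProd n
          (fun i : Fin (n + 1) => monomial (e i.castSucc) (j i.castSucc) (b i.castSucc)))
          (monomial (e (Fin.last _)) (j (Fin.last _)) (b (Fin.last _))) := rfl
    have hl' : 𝒜.leftProd (n + 1) e =
        𝒜.mul (𝒜.leftProd n (fun i => e i.castSucc)) (e (Fin.last _)) := rfl
    have hcard : (Finset.univ.filter fun i => b i = true).card =
        (Finset.univ.filter fun i : Fin (n + 1) => b i.castSucc = true).card +
          if b (Fin.last _) = true then 1 else 0 := by
      rw [Finset.card_filter, Finset.card_filter, Fin.sum_univ_castSucc]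
    have hsign : (∏ i, ∏ l, if i < l ∧ b i = true then (deg l).negOnePow else 1) =
        (∏ i : Fin (n + 1), ∏ l : Fin (n + 1),
          if i < l ∧ b i.castSucc = true then (deg l.castSucc).negOnePow else 1) *
        (deg (Fin.last _)).negOnePow ^
          (Finset.univ.filter fun i : Fin (n + 1) => b i.castSucc = true).card := by
      have h2 : ∀ l : Fin (n + 2), ¬ Fin.last (n + 1) < l := fun l => (Fin.le_last l).not_gt
      rw [Fin.prod_univ_castSucc]
      simp only [Fin.prod_univ_castSucc (n := n + 1), Fin.castSucc_lt_castSucc_iff,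
        Fin.castSucc_lt_last, true_and, h2, false_and, if_false, Finset.prod_const_one, mul_one,
        Finset.prod_mul_distrib]
      rw [Finset.prod_ite, Finset.prod_const, Finset.prod_const_one, mul_one]
    rw [hl, ih', hl', hcard, hsign, Fin.sum_univ_castSucc (n := n + 1)]
    by_cases h0 : (Finset.univ.filter fun i : Fin (n + 1) => b i.castSucc = true).card = 0
    · have hone : (∏ i : Fin (n + 1), ∏ l : Fin (n + 1),
          if i < l ∧ b i.castSucc = true then (deg l.castSucc).negOnePow else 1) = 1 := by
        rw [Finset.card_eq_zero, Finset.filter_eq_empty_iff] at h0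
        refine Finset.prod_eq_one fun i _ => Finset.prod_eq_one fun l _ => ?_
        rw [if_neg fun h => h0 (Finset.mem_univ i) h.2]
      rw [h0, if_pos rfl, mul_monomial, hone]
      cases h : b (Fin.last (n + 1)) <;> simp
    · rw [if_neg h0]
      by_cases h1 : (Finset.univ.filter fun i : Fin (n + 1) => b i.castSucc = true).card = 1
      · rw [h1, if_pos rfl, map_sign, LinearMap.smul_apply]
        cases h : b (Fin.last (n + 1))
        · rw [mul_monomial_true_false 𝒜 _ (he _)]
          simp [mul_smul]
        · rw [mul_monomial_true_true]
          simp
      · rw [if_neg h1, map_zero, LinearMap.zero_apply]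
        cases h : b (Fin.last (n + 1)) <;> simp [h0, h1]

theorem integral_monomial (e : A) (j : ℕ) (b : Bool) :
    Forms.integral (monomial e j b : Forms K A) =
      if b = true then ((j : K) + 1)⁻¹ • e else 0 := by
  cases b
  · simp [Forms.integral, monomial]
  · simp [Forms.integral, PolyCoeff.integral, monomial, PolyCoeff.scalarPrim_X_pow]

end values
end DGAlg

namespace DGSpace

section values

variable {K V : Type*} [Field K] [AddCommGroup V] [Module K V]

theorem toEnd_fst_leftProd (D : DGSpace K V) (n : ℕ) (a : Fin (n + 1) → D.EndStar) :
    D.toEnd (D.affAlg.leftProd n fun i => (a i, 0)).1 =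
      (List.ofFn fun i => D.toEnd (a i)).prod := by
  induction n with
  | zero => simp [DGAlg.leftProd]
  | succ n ih =>
    have h1 : D.toEnd (D.affAlg.leftProd (n + 1) fun i => (a i, 0)).1 =
      D.toEnd (D.affAlg.leftProd n fun i => (a i.castSucc, 0)).1 *
        D.toEnd (a (Fin.last _)) := rfl
    rw [h1, ih fun i => a i.castSucc, List.ofFn_succ' fun i => D.toEnd (a i),
      List.concat_eq_append, List.prod_append, List.prod_singleton]

theorem snd_leftProd (D : DGSpace K V) (n : ℕ) (a : Fin n → D.EndStar) (v : V) :
    (D.affAlg.leftProd n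
      (Fin.snoc (α := fun _ => D.EndStar × V) (fun i : Fin n => (a i, (0 : V))) (0, v))).2 =
      (List.ofFn fun i => D.toEnd (a i)).prod v := by
  cases n with
  | zero => simp [DGAlg.leftProd]; rfl
  | succ n =>
    have h1 : (D.affAlg.leftProd (n + 1)
      (Fin.snoc (α := fun _ => D.EndStar × V) (fun i : Fin (n + 1) => (a i, (0 : V))) (0, v))) =
      D.affAlg.mul (D.affAlg.leftProd n fun i => (a i, 0)) (0, v) := by
      rw [DGAlg.leftProd, Fin.init_snoc, Fin.snoc_last]
    rw [h1, ← toEnd_fst_leftProd]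
    rfl

theorem iteratedIntegral_monomial (D : DGSpace K V) (F : Submodule K V) (n : ℕ)
    (a : Fin n → D.EndStar) (v : V) (deg : Fin (n + 1) → ℤ)
    (ha : ∀ i : Fin n, a i ∈ D.endAlg.gr (deg i.castSucc)) (hv : v ∈ D.gr (deg (Fin.last n)))
    (j k : Fin (n + 1) → ℕ) (b : Fin (n + 1) → Bool) :
    D.iteratedIntegral F n
        (Fin.snoc (fun i : Fin n => D.monomialForm (a i, 0) (j i.castSucc) (b i.castSucc)
            (k i.castSucc))
          (D.monomialForm (0, v) (j (Fin.last n)) (b (Fin.last n)) (k (Fin.last n)))) =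
      if (Finset.univ.filter fun i => b i = true).card = 1 then
        (∏ i, ∏ l, if i < l ∧ b i = true then (deg l).negOnePow else 1) •
          ((((∑ i, j i : ℕ) : K) + 1)⁻¹ *
            ∏ l : Fin (n + 1), (((∑ i ∈ Finset.univ.filter (fun i => i ≤ l), (k i + 1) : ℕ) :
              K))⁻¹) •
          F.mkQ ((List.ofFn fun i => D.toEnd (a i)).prod v)
      else 0 := by
  set e : Fin (n + 1) → D.EndStar × V :=
    Fin.snoc (α := fun _ => D.EndStar × V) (fun i : Fin n => (a i, (0 : V))) (0, v) with he
  have hdeg : ∀ i, e i ∈ D.affAlg.gr (deg i) := by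
    intro i
    refine Fin.lastCases ?_ (fun i => ?_) i
    · rw [he, Fin.snoc_last]; exact ⟨zero_mem _, hv⟩
    · rw [he, Fin.snoc_castSucc]; exact ⟨ha i, zero_mem _⟩
  have h1 : (fun i => Forms.dtCoeff ((Fin.snoc (α := fun _ => Forms K (Forms K (D.EndStar × V)))
        (fun i : Fin n => D.monomialForm (a i, 0) (j i.castSucc) (b i.castSucc) (k i.castSucc))
        (D.monomialForm (0, v) (j (Fin.last n)) (b (Fin.last n)) (k (Fin.last n))) :
          Fin (n + 1) → Forms K (Forms K (D.EndStar × V))) i)) =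
      fun i => DGAlg.monomial (e i) (j i) (b i) ⊗ₜ[K] (Polynomial.X ^ k i : K[X]) := by
    funext i
    refine Fin.lastCases ?_ (fun i => ?_) i
    · rw [he, Fin.snoc_last, Fin.snoc_last]; rfl
    · rw [he, Fin.snoc_castSucc, Fin.snoc_castSucc]; rfl
  have h2 : D.iteratedIntegral F n
        (Fin.snoc (fun i : Fin n => D.monomialForm (a i, 0) (j i.castSucc) (b i.castSucc)
            (k i.castSucc))
          (D.monomialForm (0, v) (j (Fin.last n)) (b (Fin.last n)) (k (Fin.last n)))) =
      F.mkQ (Forms.integral (PolyCoeff.eval 1 (D.affAlg.forms.iterPrim n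
        fun i => DGAlg.monomial (e i) (j i) (b i) ⊗ₜ[K] (Polynomial.X ^ k i : K[X])))).2 := by
    rw [← h1]; rfl
  rw [h2, DGAlg.iterPrim_tmul_X_pow, map_smul, PolyCoeff.eval_tmul,
    DGAlg.leftProd_monomial _ _ _ _ hdeg, ← snd_leftProd]
  simp only [Polynomial.eval_pow, Polynomial.eval_X, one_pow, one_smul]
  by_cases hc : (Finset.univ.filter fun i => b i = true).card = 1
  · rw [hc, if_neg one_ne_zero, if_pos rfl, if_pos rfl, map_smul, map_sign,
      DGAlg.integral_monomial, if_pos rfl]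
    rcases Int.units_eq_one_or
      (∏ i, ∏ l, if i < l ∧ b i = true then (deg l).negOnePow else 1) with h | h <;>
    (rw [h]; simp [mul_smul]; exact smul_comm _ _ _)
  · rw [if_neg hc, if_neg hc]
    split_ifs <;> simp [DGAlg.integral_monomial]

end values
end DGSpace

/-! ### Vanishing of the iterated integrals -/

section vanishing

theorem exists_seq {A : Type*} [Zero A] {n : ℕ} (x : Fin n → A) :
    ∃ y : ℕ → A, x = fun i : Fin n => y i :=
  ⟨fun j => if h : j < n then x ⟨j, h⟩ else 0, by funext i; simp⟩

theorem MultilinearMap.onSeq_eq_zero {K A B : Type*} [Field K] [AddCommGroup A] [Module K A]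
    [AddCommGroup B] [Module K B] {n : ℕ} (f : MultilinearMap K (fun _ : Fin n => A) B)
    {x : ℕ → A} {i : ℕ} (hi : i < n) (h : x i = 0) : f.onSeq x = 0 :=
  f.map_coord_zero (⟨i, hi⟩ : Fin n) h

end vanishing

namespace DGAlg

section functoriality

variable {K A B : Type*} [Field K] [AddCommGroup A] [Module K A] [AddCommGroup B] [Module K B]

theorem IsHom.map_iter {𝒜 : DGAlg K A} {ℬ : DGAlg K B} {φ : A →ₗ[K] B} (h : 𝒜.IsHom ℬ φ)
    (x : ℕ → PolyCoeff K A) (n : ℕ) :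
    PolyCoeff.map φ ((𝒜.iter n).onSeq x) = (ℬ.iter n).onSeq fun j => PolyCoeff.map φ (x j) := by
  induction n with
  | zero => simp [iter, MultilinearMap.onSeq]
  | succ n ih =>
    rw [iter_succ, iter_succ, ← PolyCoeff.prim_map]
    cases n with
    | zero => rfl
    | succ n => rw [iterMul, iterMul, PolyCoeff.map_mul _ _ _ h.map_mul, ih]

theorem iter_mem_sub_of_mul_mem (𝒜 : DGAlg K A) {S : Submodule K A}
    (hS : ∀ a ∈ S, ∀ b ∈ S, 𝒜.mul a b ∈ S) {x : ℕ → PolyCoeff K A}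
    (hx : ∀ j, x j ∈ PolyCoeff.sub S) (n : ℕ) : (𝒜.iter n).onSeq x ∈ PolyCoeff.sub S := by
  induction n with
  | zero => exact zero_mem _
  | succ n ih =>
    rw [iter_succ]
    refine PolyCoeff.prim_mem_sub ?_
    cases n with
    | zero => exact hx 0
    | succ n => exact PolyCoeff.mul_mem_sub hS ih (hx _)

end functoriality
end DGAlg

namespace DGSpace

section integrals

variable {K V : Type*} [Field K] [AddCommGroup V] [Module K V]

theorem isHom_fst (D : DGSpace K V) : D.affAlg.IsHom D.endAlg (LinearMap.fst K D.EndStar V) :=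
  { map_mem := fun h => h.1, map_d := fun _ => rfl, map_mul := fun _ _ => rfl }

theorem isHom_snd (D : DGSpace K V) :
    D.affAlg.toDGSpace.IsHom D (LinearMap.snd K D.EndStar V) :=
  { map_mem := fun h => h.2, map_d := fun _ => rfl }

/-- A product whose left factor lies in `V` is zero. -/
theorem affAlg_mul_comp_inr (D : DGSpace K V) :
    D.affAlg.mul ∘ₗ LinearMap.inr K D.EndStar V = 0 := by
  refine LinearMap.ext fun v => LinearMap.ext fun y => Prod.ext ?_ ?_
  · change D.endAlg.mul 0 y.1 = 0
    rw [map_zero, LinearMap.zero_apply]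
  · change D.toEnd 0 y.2 = 0
    rw [map_zero, LinearMap.zero_apply]

/-- A product whose right factor lies in `End*(V)` has no component in `V`. -/
theorem affAlg_mul_comp_inl (D : DGSpace K V) :
    (D.affAlg.mul.compl₂ (LinearMap.inl K D.EndStar V)).compr₂
      (LinearMap.snd K D.EndStar V) = 0 :=
  LinearMap.ext fun x => LinearMap.ext fun _ => map_zero (D.toEnd x.1)

theorem forms_mul_eq_zero (D : DGSpace K V) {x : Forms K (D.EndStar × V)}
    (hx : Forms.map (LinearMap.fst K D.EndStar V) x = 0) (y : Forms K (D.EndStar × V)) :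
    D.affAlg.forms.mul x y = 0 := by
  have key : ∀ x y : PolyCoeff K (D.EndStar × V),
      PolyCoeff.map (LinearMap.fst K D.EndStar V) x = 0 →
      PolyCoeff.mul D.affAlg.mul x y = 0 := by
    intro x y h
    rw [PolyCoeff.eq_map_inr h, PolyCoeff.mul_map_left, affAlg_mul_comp_inr,
      PolyCoeff.mul_zeroHom]
  have h1 : PolyCoeff.map (LinearMap.fst K D.EndStar V) (Forms.fnPart x) = 0 :=
    congrArg Forms.fnPart hx
  have h2 : PolyCoeff.map (LinearMap.fst K D.EndStar V) (Forms.dtCoeff x) = 0 :=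
    congrArg Forms.dtCoeff hx
  refine Forms.ext (key _ _ h1) ?_
  rw [DGAlg.dtCoeff_mul, key _ _ h1, key _ _ h2, add_zero, map_zero]

theorem map_snd_sgn (D : DGSpace K V) (x : PolyCoeff K (D.EndStar × V)) :
    PolyCoeff.map (LinearMap.snd K D.EndStar V) (PolyCoeff.map D.affAlg.sgn x) =
      PolyCoeff.map D.sgn (PolyCoeff.map (LinearMap.snd K D.EndStar V) x) := by
  rw [PolyCoeff.map_map, PolyCoeff.map_map]
  congr 1
  exact congrArg _ (LinearMap.ext D.isHom_snd.map_sgn)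

theorem map_snd_forms_mul (D : DGSpace K V) (x : Forms K (D.EndStar × V))
    {y : Forms K (D.EndStar × V)} (hy : Forms.map (LinearMap.snd K D.EndStar V) y = 0) :
    Forms.map (LinearMap.snd K D.EndStar V) (D.affAlg.forms.mul x y) = 0 := by
  have h1 : PolyCoeff.map (LinearMap.snd K D.EndStar V) (Forms.fnPart y) = 0 :=
    congrArg Forms.fnPart hy
  have h2 : PolyCoeff.map (LinearMap.snd K D.EndStar V) (Forms.dtCoeff y) = 0 :=
    congrArg Forms.dtCoeff hy
  have h3 : PolyCoeff.map (LinearMap.snd K D.EndStar V)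
      (PolyCoeff.map D.affAlg.sgn (Forms.fnPart y)) = 0 := by rw [map_snd_sgn, h1, map_zero]
  have key : ∀ x y : PolyCoeff K (D.EndStar × V),
      PolyCoeff.map (LinearMap.snd K D.EndStar V) y = 0 →
      PolyCoeff.map (LinearMap.snd K D.EndStar V) (PolyCoeff.mul D.affAlg.mul x y) = 0 := by
    intro x y h
    rw [PolyCoeff.eq_map_inl h, PolyCoeff.map_mul_map_right, affAlg_mul_comp_inl,
      PolyCoeff.mul_zeroHom]
  refine Forms.ext (key _ _ h1) ?_
  change PolyCoeff.map _ (Forms.dtCoeff (D.affAlg.forms.mul x y)) = 0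
  rw [DGAlg.dtCoeff_mul, map_add, key _ _ h2, key _ _ h3, add_zero]

/-- The map which sends `x(t) ∈ (End*(V) ⊕ V)[s, ds][t]` to the class in `V / F` of the component in
`V` of `∫_{0 ≤ s ≤ 1} x(1)`. -/
noncomputable def endpointIntegral (D : DGSpace K V) (F : Submodule K V) :
    PolyCoeff K (Forms K (D.EndStar × V)) →ₗ[K] V ⧸ F :=
  F.mkQ ∘ₗ LinearMap.snd K D.EndStar V ∘ₗ Forms.integral ∘ₗ PolyCoeff.eval 1

theorem endpointIntegral_eq_zero (D : DGSpace K V) (F : Submodule K V)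
    {x : PolyCoeff K (Forms K (D.EndStar × V))}
    (hx : Forms.map (LinearMap.snd K D.EndStar V) (PolyCoeff.eval 1 x) = 0) :
    D.endpointIntegral F x = 0 := by
  change F.mkQ (LinearMap.snd K D.EndStar V (PolyCoeff.integral (Forms.dtCoeff _))) = 0
  rw [← PolyCoeff.integral_map]
  have : PolyCoeff.map (LinearMap.snd K D.EndStar V) (Forms.dtCoeff (PolyCoeff.eval 1 x)) = 0 :=
    congrArg Forms.dtCoeff hx
  rw [this, map_zero, map_zero]

theorem iteratedIntegral_eq (D : DGSpace K V) (F : Submodule K V) (n : ℕ)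
    (ω : ℕ → Forms K (Forms K (D.EndStar × V))) :
    D.iteratedIntegral F n (fun i => ω i) =
      D.endpointIntegral F ((D.affAlg.forms.iter (n + 1)).onSeq fun j => Forms.dtCoeff (ω j)) :=
  rfl

theorem iteratedIntegral_eq_zero (D : DGSpace K V) (F : Submodule K V) (n : ℕ)
    (ω : Fin (n + 1) → Forms K (Forms K (D.EndStar × V)))
    (h : (∃ i, Forms.dtCoeff (ω i) = 0) ∨
        (∃ i, i ≠ Fin.last n ∧
          Forms.map (Forms.map (LinearMap.fst K D.EndStar V)) (ω i) = 0) ∨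
        Forms.map (Forms.map (LinearMap.snd K D.EndStar V)) (ω (Fin.last n)) = 0) :
    D.iteratedIntegral F n ω = 0 := by
  obtain ⟨ω, rfl⟩ := exists_seq ω
  rw [iteratedIntegral_eq]
  rcases h with ⟨i, hi⟩ | ⟨i, hin, hi⟩ | h
  · rw [MultilinearMap.onSeq_eq_zero _ i.2 hi, map_zero]
  · have hi' : PolyCoeff.map (Forms.map (LinearMap.fst K D.EndStar V)) (Forms.dtCoeff (ω i)) = 0 :=
      congrArg Forms.dtCoeff hi
    obtain ⟨m, rfl⟩ : ∃ m, n = m + 1 :=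
      ⟨n - 1, by have := Fin.val_lt_last hin; omega⟩
    have him : (i : ℕ) < m + 1 := Fin.val_lt_last hin
    -- the product of the factors before the last one has no component in `End*(V)`
    have hz := D.isHom_fst.formsMap.map_iter (fun j => Forms.dtCoeff (ω j)) (m + 1)
    rw [MultilinearMap.onSeq_eq_zero
      (x := fun j => PolyCoeff.map (Forms.map (LinearMap.fst K D.EndStar V)) (Forms.dtCoeff (ω j)))
      _ him hi'] at hz
    have hmul : ∀ x y : PolyCoeff K (Forms K (D.EndStar × V)),
        PolyCoeff.map (Forms.map (LinearMap.fst K D.EndStar V)) x = 0 →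
        PolyCoeff.mul D.affAlg.forms.mul x y = 0 := by
      intro x y hx
      have hμ : D.affAlg.forms.mul = D.affAlg.forms.mul ∘ₗ
          Forms.map (LinearMap.inl K D.EndStar V) ∘ₗ Forms.map (LinearMap.fst K D.EndStar V) := by
        refine LinearMap.ext fun u => LinearMap.ext fun w => ?_
        rw [← sub_eq_zero, LinearMap.comp_apply, LinearMap.comp_apply, ← LinearMap.sub_apply,
          ← map_sub]
        refine D.forms_mul_eq_zero ?_ w
        rw [map_sub, sub_eq_zero]
        refine Forms.ext ?_ ?_ <;> simp [Forms.map, PolyCoeff.map_map, ← LinearMap.comp_assoc]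
      rw [hμ, ← LinearMap.comp_assoc, ← PolyCoeff.mul_map_left, hx, map_zero,
        LinearMap.zero_apply]
    rw [DGAlg.iter_succ, DGAlg.iterMul, hmul _ _ hz, map_zero, map_zero]
  · have h' : PolyCoeff.map (Forms.map (LinearMap.snd K D.EndStar V)) (Forms.dtCoeff (ω n)) = 0 :=
      congrArg Forms.dtCoeff h
    refine D.endpointIntegral_eq_zero F ?_
    rw [← PolyCoeff.eval_map, DGAlg.iter_succ, ← PolyCoeff.prim_map]
    cases n with
    | zero => rw [DGAlg.iterMul, LinearMap.id_apply, h', map_zero, map_zero]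
    | succ n =>
      have hμ : (D.affAlg.forms.mul).compr₂ (Forms.map (LinearMap.snd K D.EndStar V)) =
          ((D.affAlg.forms.mul).compl₂ (Forms.map (LinearMap.inr K D.EndStar V) ∘ₗ
            Forms.map (LinearMap.snd K D.EndStar V))).compr₂
              (Forms.map (LinearMap.snd K D.EndStar V)) := by
        refine LinearMap.ext fun u => LinearMap.ext fun w => ?_
        simp only [LinearMap.compr₂_apply, LinearMap.compl₂_apply]
        rw [← sub_eq_zero, ← map_sub, ← map_sub]
        refine D.map_snd_forms_mul u ?_
        rw [map_sub, sub_eq_zero]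
        refine Forms.ext ?_ ?_ <;> simp [Forms.map, PolyCoeff.map_map, ← LinearMap.comp_assoc]
      have h2 : PolyCoeff.map (Forms.map (LinearMap.snd K D.EndStar V))
          (PolyCoeff.mul D.affAlg.forms.mul
            ((D.affAlg.forms.iter (n + 1)).onSeq fun j => Forms.dtCoeff (ω j))
            (Forms.dtCoeff (ω (n + 1)))) = 0 := by
        have e1 := PolyCoeff.map_mul_map_right D.affAlg.forms.mul LinearMap.id
          (Forms.map (LinearMap.snd K D.EndStar V))
          ((D.affAlg.forms.iter (n + 1)).onSeq fun j => Forms.dtCoeff (ω j))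
          (Forms.dtCoeff (ω (n + 1)))
        rw [PolyCoeff.map_id] at e1
        rw [e1, LinearMap.compl₂_id, hμ, ← PolyCoeff.map_mul_map_right, ← PolyCoeff.map_map, h',
          map_zero, map_zero, map_zero]
      rw [DGAlg.iterMul, h2, map_zero, map_zero]

end integrals
end DGSpace

/-! ### The `A_∞`-morphism -/

namespace DGSpace

section aInf

variable {K V : Type*} [Field K] [AddCommGroup V] [Module K V]

theorem shift_neg_two_d (D : DGSpace K V) : (D.shift (-2)).d = D.d := by
  change (-2 : ℤ).negOnePow • D.d = _
  rw [Int.negOnePow_even (-2) ⟨-1, rfl⟩, one_smul]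

/-- The components of the `A_∞`-morphism given by the iterated integrals. -/
noncomputable def integralComponent (D : DGSpace K V) (F : Submodule K V) :
    ∀ n : ℕ, MultilinearMap K (fun _ : Fin n => D.twAssocSub F) (V ⧸ F)
  | 0 => 0
  | n + 1 => (D.iteratedIntegral F n).compLinearMap fun _ => (D.twAssocSub F).subtype

theorem integralComponent_onSeq (D : DGSpace K V) (F : Submodule K V) (n : ℕ)
    (x : ℕ → D.twAssocSub F) :
    (D.integralComponent F n).onSeq x = D.endpointIntegral F
      ((D.affAlg.forms.iter n).onSeq fun j => Forms.dtCoeff (x j : Forms K (Forms K _))) := by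
  cases n with
  | zero => exact (map_zero _).symm
  | succ n => rfl

theorem endpointIntegral_mem (D : DGSpace K V) {F : Submodule K V} (hF : D.IsSubspace F) {i : ℤ}
    {x : PolyCoeff K (Forms K (D.EndStar × V))}
    (hx : x ∈ PolyCoeff.sub (D.affAlg.forms.gr i)) :
    D.endpointIntegral F x ∈ (D.quotient F hF).gr (i - 1) := by
  have h := (PolyCoeff.eval_mem 1 hx).2
  exact ⟨_, (PolyCoeff.eval_mem 1 (PolyCoeff.prim_mem_sub h)).2, rfl⟩

/-- Stokes' formula on the `s`-interval: the boundary terms are `0` at `s = 0`, and in `F` at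
`s = 1`. -/
theorem endpointIntegral_map_d [CharZero K] (D : DGSpace K V) {F : Submodule K V}
    (hF : D.IsSubspace F) {x : PolyCoeff K (Forms K (D.EndStar × V))}
    (h0 : Forms.eval 0 (PolyCoeff.eval 1 x) = 0)
    (h1 : Forms.eval 1 (PolyCoeff.eval 1 x) ∈ D.affSub F) :
    D.endpointIntegral F (PolyCoeff.map D.affAlg.forms.d x) =
      (D.quotient F hF).d (D.endpointIntegral F x) := by
  set z := PolyCoeff.eval 1 x with hz
  have e1 : D.endpointIntegral F (PolyCoeff.map D.affAlg.forms.d x) =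
      F.mkQ (LinearMap.snd K D.EndStar V (PolyCoeff.integral (Forms.dtCoeff
        (D.affAlg.forms.d z)))) := by
    rw [hz, ← PolyCoeff.eval_map]; rfl
  have e2 : D.endpointIntegral F x =
      F.mkQ (LinearMap.snd K D.EndStar V (PolyCoeff.integral (Forms.dtCoeff z))) := rfl
  have e3 : Forms.dtCoeff (D.affAlg.forms.d z) =
      PolyCoeff.deriv (PolyCoeff.map D.affAlg.sgn (Forms.fnPart z)) +
        PolyCoeff.map D.affAlg.d (Forms.dtCoeff z) := rfl
  have e4 : LinearMap.snd K D.EndStar V (D.affAlg.sgn (PolyCoeff.eval 1 (Forms.fnPart z))) ∈ F :=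
    (hF.affSub.toIsSubspace.sgn_mem h1).2
  have h0' : PolyCoeff.eval 0 (Forms.fnPart z) = 0 := h0
  rw [e1, e2, e3, map_add, PolyCoeff.integral_deriv, PolyCoeff.eval_map, PolyCoeff.eval_map, h0',
    map_zero, sub_zero, PolyCoeff.integral_map, map_add, map_add, Submodule.mkQ_apply,
    (Submodule.Quotient.mk_eq_zero F).2 e4, zero_add]
  rfl

theorem mem_sub_affSub (D : DGSpace K V) {F : Submodule K V} {ω : Forms K (Forms K (D.EndStar × V))}
    (hω : ω ∈ D.twAssocSub F) :
    PolyCoeff.map (Forms.eval 1) (Forms.dtCoeff ω) ∈ PolyCoeff.sub (D.affSub F) := by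
  obtain ⟨η, hη⟩ := hω.1.2
  exact ⟨Forms.dtCoeff η, congrArg Forms.dtCoeff hη⟩

theorem map_snd_eval_one (D : DGSpace K V) {F : Submodule K V}
    {ω : Forms K (Forms K (D.EndStar × V))} (hω : ω ∈ D.twAssocSub F) :
    Forms.map (LinearMap.snd K D.EndStar V) (Forms.eval 1 ω) = 0 := by
  obtain ⟨η, hη⟩ := hω.2.2
  rw [← hη]
  refine Forms.ext ?_ ?_ <;> simp [Forms.map, PolyCoeff.map_map, PolyCoeff.map_zeroHom]

/-- The boundary term of the face `t_n = 1` vanishes, because `ω|_{t=1}` has no component in `V`. -/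
theorem endpointIntegral_iterMul (D : DGSpace K V) (F : Submodule K V) (n : ℕ)
    (x : ℕ → PolyCoeff K (Forms K (D.EndStar × V))) {ω : Forms K (Forms K (D.EndStar × V))}
    (hω : ω ∈ D.twAssocSub F) :
    D.endpointIntegral F (D.affAlg.forms.iterMul x n (Forms.fnPart ω)) = 0 := by
  refine D.endpointIntegral_eq_zero F ?_
  cases n with
  | zero => exact D.map_snd_eval_one hω
  | succ n =>
    rw [DGAlg.iterMul, PolyCoeff.eval_mul]
    exact D.map_snd_forms_mul _ (D.map_snd_eval_one hω)

/-- The `A_∞`-relations are Stokes' formulas: the boundary faces `t_i = t_{i+1}` of the simplex give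
the products, the faces `t_0 = 0` and `t_n = 1` do not contribute, and those of the `s`-interval
vanish modulo `F`. -/
theorem integralComponent_rel [CharZero K] (D : DGSpace K V) {F : Submodule K V}
    (hF : D.IsSubspace F) (n : ℕ) (x : ℕ → D.twAssocSub F) (deg : ℕ → ℤ)
    (hx : ∀ i, x i ∈ (D.twAssoc F hF).gr (deg i)) :
    (∑ i ∈ Finset.range (n + 1), (∑ j ∈ Finset.range i, (deg j - 1)).negOnePow •
        (D.integralComponent F (n + 1)).onSeq
          (Function.update x i ((D.twAssoc F hF).barD (x i)))) +
      (∑ i ∈ Finset.range n, (∑ j ∈ Finset.range i, (deg j - 1)).negOnePow •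
        (D.integralComponent F n).onSeq
          (seqContract x i ((D.twAssoc F hF).barMul (x i) (x (i + 1))))) =
    -(D.quotient F hF).d ((D.integralComponent F (n + 1)).onSeq x) := by
  set ω : ℕ → Forms K (Forms K (D.EndStar × V)) := fun j => x j with hωdef
  have hsub := DGAlg.IsHom.subtype D.affAlg.forms.forms (D.twAssocSub F) hF.twAssocSub
  have hω : ∀ i, ω i ∈ D.affAlg.forms.forms.gr (deg i) := fun i => hsub.map_mem (hx i)
  have key := congrArg (D.endpointIntegral F)
    (D.affAlg.forms.sum_iter_forms_d hω (LinearMap.mem_ker.1 (x 0).2.2.1) n)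
  rw [map_sum, map_add, map_add, map_sum, map_sign, D.endpointIntegral_iterMul F n _ (x n).2,
    smul_zero, add_zero] at key
  have e1 : ∀ i ∈ Finset.range (n + 1), (∑ j ∈ Finset.range i, (deg j - 1)).negOnePow •
        (D.integralComponent F (n + 1)).onSeq
          (Function.update x i ((D.twAssoc F hF).barD (x i))) =
      - D.endpointIntegral F ((∑ j ∈ Finset.range i, (deg j - 1)).negOnePow •
        (D.affAlg.forms.iter (n + 1)).onSeq (Function.update (fun j => Forms.dtCoeff (ω j)) i
          (Forms.dtCoeff (D.affAlg.forms.forms.d (ω i))))) := by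
    intro i hi
    rw [Finset.mem_range] at hi
    have h1 : Forms.dtCoeff (((D.twAssoc F hF).barD (x i) : D.twAssocSub F) :
        Forms K (Forms K (D.EndStar × V))) = -Forms.dtCoeff (D.affAlg.forms.forms.d (ω i)) := rfl
    rw [integralComponent_onSeq, comp_update (fun y : D.twAssocSub F =>
      Forms.dtCoeff (y : Forms K (Forms K (D.EndStar × V)))), h1, map_sign, ← smul_neg]
    simp only [MultilinearMap.onSeq_update _ _ hi]
    rw [map_neg, map_neg]
  have e2 : ∀ i ∈ Finset.range n, (∑ j ∈ Finset.range i, (deg j - 1)).negOnePow •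
        (D.integralComponent F n).onSeq
          (seqContract x i ((D.twAssoc F hF).barMul (x i) (x (i + 1)))) =
      D.endpointIntegral F ((∑ j ∈ Finset.range i, (deg j - 1)).negOnePow •
        (D.affAlg.forms.iter n).onSeq (seqContract (fun j => Forms.dtCoeff (ω j)) i
          (Forms.dtCoeff (D.affAlg.forms.forms.barMul (ω i) (ω (i + 1)))))) := by
    intro i hi
    have h1 : (((D.twAssoc F hF).barMul (x i) (x (i + 1)) : D.twAssocSub F) :
        Forms K (Forms K (D.EndStar × V))) =
        D.affAlg.forms.forms.barMul (ω i) (ω (i + 1)) := by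
      change D.affAlg.forms.forms.mul (((D.twAssoc F hF).sgn (x i) : D.twAssocSub F) :
        Forms K (Forms K (D.EndStar × V))) (x (i + 1)) = _
      have := hsub.map_sgn (x i)
      exact congrArg (fun y => D.affAlg.forms.forms.mul y (ω (i + 1))) this
    rw [integralComponent_onSeq, comp_seqContract (fun y : D.twAssocSub F =>
      Forms.dtCoeff (y : Forms K (Forms K (D.EndStar × V)))), h1, map_sign]
  have hev : ∀ c : K, Forms.eval c (PolyCoeff.eval 1
      ((D.affAlg.forms.iter (n + 1)).onSeq fun j => Forms.dtCoeff (ω j))) =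
      PolyCoeff.eval 1 ((D.affAlg.iter (n + 1)).onSeq
        fun j => PolyCoeff.map (Forms.eval c) (Forms.dtCoeff (ω j))) := by
    intro c
    rw [← PolyCoeff.eval_map, (DGAlg.IsHom.formsEval D.affAlg c).map_iter]
  have h0 : Forms.eval 0 (PolyCoeff.eval 1
      ((D.affAlg.forms.iter (n + 1)).onSeq fun j => Forms.dtCoeff (ω j))) = 0 := by
    have : PolyCoeff.map (Forms.eval 0) (Forms.dtCoeff (ω 0)) = 0 :=
      congrArg Forms.dtCoeff (LinearMap.mem_ker.1 (x 0).2.1.1)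
    rw [hev, MultilinearMap.onSeq_eq_zero _ n.succ_pos this, map_zero]
  have h1 : Forms.eval 1 (PolyCoeff.eval 1
      ((D.affAlg.forms.iter (n + 1)).onSeq fun j => Forms.dtCoeff (ω j))) ∈ D.affSub F := by
    rw [hev]
    exact PolyCoeff.eval_mem 1 (D.affAlg.iter_mem_sub_of_mul_mem
      (fun a ha b hb => hF.affSub.mul_mem ha hb) (fun j => D.mem_sub_affSub (x j).2) _)
  rw [Finset.sum_congr rfl e1, Finset.sum_congr rfl e2, Finset.sum_neg_distrib, key,
    D.endpointIntegral_map_d hF h0 h1, integralComponent_onSeq]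
  abel

/-- The `A_∞`-morphism whose components are the iterated integrals. -/
noncomputable def integralAInf [CharZero K] (D : DGSpace K V) (F : Submodule K V)
    (hF : D.IsSubspace F) :
    AInfMorphism (D.twAssoc F hF) (DGAlg.trivial ((D.quotient F hF).shift (-2))) where
  toFun := D.integralComponent F
  zero := rfl
  map_mem n x deg hx := by
    cases n with
    | zero => exact zero_mem _
    | succ n =>
      obtain ⟨y, rfl⟩ := exists_seq x
      obtain ⟨deg, rfl⟩ := exists_seq deg
      have h := D.integralComponent_onSeq F (n + 1) y
      -- only the first `n + 1` terms of the sequence are known to be homogeneous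
      have hy : ∀ j, (fun j => if j < n + 1 then y j else 0) j ∈ (D.twAssoc F hF).gr (deg j) := by
        intro j
        by_cases hj : j < n + 1
        · simpa [hj] using hx ⟨j, hj⟩
        · simp [hj]
      have hz : (D.integralComponent F (n + 1)).onSeq y =
          (D.integralComponent F (n + 1)).onSeq fun j => if j < n + 1 then y j else 0 :=
        MultilinearMap.onSeq_congr _ fun j hj => by simp [hj]
      change (D.integralComponent F (n + 1)).onSeq y ∈
        (D.quotient F hF).gr (-2 + ((∑ i : Fin (n + 1), (deg i - 1)) + 1))
      rw [hz, integralComponent_onSeq, Fin.sum_univ_eq_sum_range fun i => deg i - 1,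
        show ∀ a : ℤ, -2 + (a + 1) = a - 1 by intro a; ring]
      exact D.endpointIntegral_mem hF (D.affAlg.forms.iter_mem_sub (fun i => (hy i).2) _)
  rel n x deg hx := by
    have hR : ∀ m, ∑ k ∈ Finset.range (m + 1),
        (DGAlg.trivial ((D.quotient F hF).shift (-2))).barMul
          ((D.integralComponent F k).onSeq x)
          ((D.integralComponent F (m - k)).onSeq fun j => x (k + j)) = 0 :=
      fun m => Finset.sum_eq_zero fun _ _ => rfl
    rw [hR, add_zero]
    cases n with
    | zero =>
      have : (D.integralComponent F 0).onSeq x = 0 := rfl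
      rw [this, map_zero]
      simp
    | succ n =>
      rw [Nat.add_sub_cancel, D.integralComponent_rel hF n x deg hx]
      rw [← shift_neg_two_d]
      rfl

end aInf
end DGSpace

/-! ### A criterion for quasi-isomorphisms -/

namespace DGSpace

section criterion

variable {K V W : Type*} [Field K] [AddCommGroup V] [Module K V] [AddCommGroup W] [Module K W]

theorem proj_d (D : DGSpace K V) (i : ℤ) (v : V) : D.proj (i + 1) (D.d v) = D.d (D.proj i v) := by
  refine D.induct (P := fun v => D.proj (i + 1) (D.d v) = D.d (D.proj i v)) v ?_ (by simp) ?_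
  · intro j v hv
    by_cases h : j = i
    · subst h; rw [D.proj_self hv, D.proj_self (D.d_mem hv)]
    · rw [D.proj_of_ne hv h, D.proj_of_ne (D.d_mem hv) (by omega), map_zero]
  · intro v w hv hw
    simp only [map_add, hv, hw]

/-- A morphism is a quasi-isomorphism if it is bijective on the total cohomology, the degrees of
cocycles and primitives being disregarded: they are restored by taking homogeneous components. -/
theorem IsHom.isQuasiIso {D : DGSpace K V} {E : DGSpace K W} {φ : V →ₗ[K] W} (hφ : D.IsHom E φ)
    (surj : ∀ w, E.d w = 0 → ∃ v, D.d v = 0 ∧ ∃ u, φ v - w = E.d u)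
    (inj : ∀ v, D.d v = 0 → (∃ u, φ v = E.d u) → ∃ u, v = D.d u) : D.IsQuasiIso E φ := by
  refine ⟨hφ, fun i => ⟨?_, ?_⟩⟩
  · rw [injective_iff_map_eq_zero]
    intro x hx
    obtain ⟨⟨v, hv⟩, rfl⟩ := Submodule.mkQ_surjective _ x
    have hx' := (Submodule.Quotient.mk_eq_zero _).1 hx
    obtain ⟨u, hu, huv⟩ := hx'
    obtain ⟨u', hu'⟩ := inj v (LinearMap.mem_ker.1 hv.2) ⟨u, huv.symm⟩
    refine (Submodule.Quotient.mk_eq_zero _).2 ⟨D.proj (i - 1) u', D.proj_mem _ _, ?_⟩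
    rw [← proj_d, ← hu', sub_add_cancel]
    exact D.proj_self hv.1
  · intro y
    obtain ⟨⟨w, hw⟩, rfl⟩ := Submodule.mkQ_surjective _ y
    obtain ⟨v, hv, u, hu⟩ := surj w (LinearMap.mem_ker.1 hw.2)
    refine ⟨Submodule.Quotient.mk ⟨D.proj i v, D.proj_mem _ _, ?_⟩, ?_⟩
    · change D.d (D.proj i v) = 0
      rw [← proj_d, hv, map_zero]
    · refine (Submodule.Quotient.eq _).2 ⟨E.proj (i - 1) u, E.proj_mem _ _, ?_⟩
      rw [← proj_d, ← hu, sub_add_cancel, map_sub, E.proj_self hw.1, ← hφ.map_proj]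
      rfl

end criterion

/-! ### The Poincaré lemma on the interval -/

section poincare

variable {K V W : Type*} [Field K] [AddCommGroup V] [Module K V] [AddCommGroup W] [Module K W]

/-- The contracting homotopy `p(t) + q(t) dt ↦ (∫₀ᵗ q)^±` of the forms which vanish at `t = 0`,
where `^±` is the application of `v ↦ (-1)^{deg v} v` to the coefficients. -/
noncomputable def formsPrim (D : DGSpace K V) : Forms K V →ₗ[K] Forms K V :=
  Forms.pairing (PolyCoeff.map D.sgn ∘ₗ PolyCoeff.prim ∘ₗ Forms.dtCoeff) 0

theorem eval_zero_formsPrim (D : DGSpace K V) (ω : Forms K V) :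
    Forms.eval 0 (D.formsPrim ω) = 0 := by
  change PolyCoeff.eval 0 (PolyCoeff.map D.sgn (PolyCoeff.prim (Forms.dtCoeff ω))) = 0
  rw [PolyCoeff.eval_map, PolyCoeff.eval_zero_prim, map_zero]

theorem eval_one_formsPrim (D : DGSpace K V) (ω : Forms K V) :
    Forms.eval 1 (D.formsPrim ω) = D.sgn (Forms.integral ω) := by
  change PolyCoeff.eval 1 (PolyCoeff.map D.sgn (PolyCoeff.prim (Forms.dtCoeff ω))) = _
  rw [PolyCoeff.eval_map]; rfl

/-- The Poincaré lemma for the forms which vanish at `t = 0`. -/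
theorem forms_d_formsPrim [CharZero K] (D : DGSpace K V) {ω : Forms K V}
    (hω : D.forms.d ω = 0) (h0 : Forms.eval 0 ω = 0) : D.forms.d (D.formsPrim ω) = ω := by
  have h2 : D.sgn ∘ₗ D.d = -(D.d ∘ₗ D.sgn) := LinearMap.ext D.sgn_d
  have h3 : D.sgn ∘ₗ D.sgn = LinearMap.id := LinearMap.ext D.sgn_sgn
  have hd : PolyCoeff.deriv (PolyCoeff.map D.sgn (Forms.fnPart ω)) +
      PolyCoeff.map D.d (Forms.dtCoeff ω) = 0 := congrArg Forms.dtCoeff hω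
  refine Forms.ext ?_ ?_
  · change PolyCoeff.map D.d (PolyCoeff.map D.sgn (PolyCoeff.prim (Forms.dtCoeff ω))) = _
    have h4 := congrArg (fun x => PolyCoeff.prim (PolyCoeff.map D.sgn x)) hd
    simp only [map_add, map_zero, ← PolyCoeff.deriv_map, PolyCoeff.map_map, h3, PolyCoeff.map_id,
      h2, PolyCoeff.map_negHom, map_neg, PolyCoeff.prim_map] at h4
    rw [PolyCoeff.prim_deriv_of_eval_zero h0, add_neg_eq_zero] at h4
    rw [PolyCoeff.map_map, h4]
  · change PolyCoeff.deriv (PolyCoeff.map D.sgn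
      (PolyCoeff.map D.sgn (PolyCoeff.prim (Forms.dtCoeff ω)))) + PolyCoeff.map D.d 0 = _
    rw [PolyCoeff.map_map, h3, PolyCoeff.map_id, PolyCoeff.deriv_prim, map_zero, add_zero]

theorem IsHom.map_formsPrim {D : DGSpace K V} {E : DGSpace K W} {φ : V →ₗ[K] W}
    (h : D.IsHom E φ) (ω : Forms K V) :
    Forms.map φ (D.formsPrim ω) = E.formsPrim (Forms.map φ ω) := by
  have h2 : φ ∘ₗ D.sgn = E.sgn ∘ₗ φ := LinearMap.ext h.map_sgn
  refine Forms.ext ?_ ?_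
  · simp [Forms.map, formsPrim, PolyCoeff.map_map, PolyCoeff.prim_map, h2]
  · simp [Forms.map, formsPrim]

theorem forms_sgn (D : DGSpace K V) (ω : Forms K V) :
    Forms.dtCoeff (D.forms.sgn ω) = -PolyCoeff.map D.sgn (Forms.dtCoeff ω) := by
  refine D.forms.induct (P := fun ω => Forms.dtCoeff (D.forms.sgn ω) =
    -PolyCoeff.map D.sgn (Forms.dtCoeff ω)) ω ?_ (by simp) ?_
  · intro i ω hω
    rw [D.forms.sgn_of_mem hω, map_sign, DGAlg.polyCoeff_sgn D hω.2, Int.negOnePow_sub]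
    simp [Units.smul_def]
  · intro v w hv hw
    simp only [map_add, hv, hw]; abel

theorem integral_sgn (D : DGSpace K V) (ω : Forms K V) :
    Forms.integral (D.forms.sgn ω) = -D.sgn (Forms.integral ω) := by
  change PolyCoeff.integral (Forms.dtCoeff _) = -D.sgn (PolyCoeff.integral _)
  rw [forms_sgn, map_neg, PolyCoeff.integral_map]

theorem IsHom.forms_map_d {D : DGSpace K V} {E : DGSpace K W} {φ : V →ₗ[K] W}
    (h : D.IsHom E φ) (ω : Forms K V) :
    Forms.map φ (D.forms.d ω) = E.forms.d (Forms.map φ ω) := by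
  have h1 : φ ∘ₗ D.d = E.d ∘ₗ φ := LinearMap.ext h.map_d
  have h2 : φ ∘ₗ D.sgn = E.sgn ∘ₗ φ := LinearMap.ext h.map_sgn
  refine Forms.ext ?_ ?_ <;>
  simp [Forms.map, DGAlg.fnPart_d, DGAlg.dtCoeff_d, PolyCoeff.map_map, h1, ← PolyCoeff.deriv_map,
    h2]

theorem eval_forms_d (D : DGSpace K V) (c : K) (ω : Forms K V) :
    Forms.eval c (D.forms.d ω) = D.d (Forms.eval c ω) := by
  simp [Forms.eval, DGAlg.fnPart_d, PolyCoeff.eval_map]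

/-- The function `t ↦ v t`. -/
noncomputable def ramp (v : V) : Forms K V := Forms.mk (v ⊗ₜ[K] Polynomial.X) 0

theorem eval_ramp (c : K) (v : V) : Forms.eval c (ramp v : Forms K V) = c • v := by
  simp [ramp, Forms.eval]

theorem map_ramp (φ : V →ₗ[K] W) (v : V) :
    Forms.map φ (ramp v : Forms K V) = ramp (φ v) := by
  refine Forms.ext ?_ ?_ <;> simp [ramp, Forms.map]

end poincare
end DGSpace

/-! ### The linear component is a quasi-isomorphism -/

theorem AInfMorphism.linear_isHom {K A B : Type*} [Field K] [AddCommGroup A] [Module K A]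
    [AddCommGroup B] [Module K B] {𝒜 : DGAlg K A} {ℬ : DGAlg K B} [𝒜.IsAssoc] [ℬ.IsAssoc]
    (f : AInfMorphism 𝒜 ℬ) : 𝒜.toDGSpace.IsHom ℬ.toDGSpace f.linear where
  map_mem {i v} hv := by
    have := f.map_mem 1 (fun _ => v) (fun _ => i) fun _ => hv
    simpa [AInfMorphism.linear, MultilinearMap.ofSubsingleton] using this
  map_d v := by
    refine 𝒜.induct (P := fun v => f.linear (𝒜.d v) = ℬ.d (f.linear v)) v ?_ (by simp) ?_
    · intro i v hv
      have h := f.rel 1 (fun _ => v) (fun _ => i) fun _ => hv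
      have h0 : ∀ x : ℕ → A, (f.toFun 0).onSeq x = 0 := fun x => by
        rw [f.zero]; rfl
      have h1 : (f.toFun 1).onSeq (Function.update (fun _ => v) 0 (𝒜.barD v)) =
          f.linear (𝒜.barD v) := by
        refine congrArg (f.toFun 1) (funext fun j => ?_)
        rw [Subsingleton.elim j 0]; simp
      have h2 : (f.toFun 1).onSeq (fun _ => v) = f.linear v := rfl
      simp only [Finset.sum_range_succ, Finset.sum_range_zero, Nat.sub_self, Nat.sub_zero, h0,
        map_zero, LinearMap.zero_apply, h1, h2, Int.negOnePow_zero, one_smul, add_zero,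
        zero_add] at h
      simpa [DGAlg.barD] using h
    · intro v w hv hw
      simp only [map_add, hv, hw]

namespace Forms

variable {K V W : Type*} [Field K] [AddCommGroup V] [Module K V] [AddCommGroup W] [Module K W]

theorem eval_map (c : K) (φ : V →ₗ[K] W) (ω : Forms K V) :
    eval c (map φ ω) = φ (eval c ω) := PolyCoeff.eval_map c φ _

theorem integral_map (φ : V →ₗ[K] W) (ω : Forms K V) :
    integral (map φ ω) = φ (integral ω) := PolyCoeff.integral_map φ _

theorem map_map {U : Type*} [AddCommGroup U] [Module K U] (ψ : V →ₗ[K] U) (φ : W →ₗ[K] V)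
    (ω : Forms K W) : map ψ (map φ ω) = map (ψ ∘ₗ φ) ω :=
  ext (PolyCoeff.map_map ψ φ _) (PolyCoeff.map_map ψ φ _)

theorem map_id (ω : Forms K V) : map LinearMap.id ω = ω :=
  ext (PolyCoeff.map_id _) (PolyCoeff.map_id _)

theorem mem_range_map_inl {ω : Forms K (V × W)} (h : map (LinearMap.snd K V W) ω = 0) :
    ω ∈ LinearMap.range (map (LinearMap.inl K V W)) :=
  ⟨map (LinearMap.fst K V W) ω, (ext (PolyCoeff.eq_map_inl (congrArg fnPart h))
    (PolyCoeff.eq_map_inl (congrArg dtCoeff h))).symm⟩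

end Forms

namespace DGSpace

section quasiIso

variable {K V : Type*} [Field K] [AddCommGroup V] [Module K V]

theorem integralAInf_linear [CharZero K] (D : DGSpace K V) (F : Submodule K V)
    (hF : D.IsSubspace F) (x : D.twAssocSub F) : (D.integralAInf F hF).linear x =
      F.mkQ (Forms.integral (Forms.integral (x : Forms K (Forms K (D.EndStar × V))))).2 :=
  rfl

theorem isHom_inr (D : DGSpace K V) :
    D.IsHom D.affAlg.toDGSpace (LinearMap.inr K D.EndStar V) :=
  { map_mem := fun h => ⟨zero_mem _, h⟩
    map_d := fun _ => Prod.ext (map_zero D.endAlg.d).symm rfl }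

/-- A class of `V / F` represented by `v` is the integral of the cocycle
`d (± v s dt) = ± (d v) s dt + v ds dt`. -/
theorem exists_cocycle (D : DGSpace K V) {F : Submodule K V} (hF : D.IsSubspace F) {v : V}
    (hv : D.d v ∈ F) : ∃ ω : Forms K (Forms K (D.EndStar × V)), ω ∈ D.twAssocSub F ∧
      D.affAlg.forms.forms.d ω = 0 ∧ (Forms.integral (Forms.integral ω)).2 = v := by
  set u : Forms K (D.EndStar × V) := ramp (LinearMap.inr K D.EndStar V (D.sgn v)) with hu
  set θ : Forms K (Forms K (D.EndStar × V)) := Forms.mk 0 (u ⊗ₜ[K] 1) with hθ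
  have hmap : ∀ c : K, Forms.map (Forms.eval c) θ =
      Forms.mk 0 ((c • LinearMap.inr K D.EndStar V (D.sgn v)) ⊗ₜ[K] 1) := by
    intro c
    rw [← eval_ramp]
    refine Forms.ext ?_ ?_ <;> simp [Forms.map, hθ, hu]
  have heval : ∀ c : K, Forms.eval c θ = 0 := fun c => map_zero (PolyCoeff.eval c)
  have hcomm : ∀ c : K, Forms.map (Forms.eval c) (D.affAlg.forms.forms.d θ) =
      D.affAlg.forms.d (Forms.map (Forms.eval c) θ) := fun c =>
    (DGAlg.IsHom.formsEval D.affAlg c).toIsHom.forms_map_d θ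
  refine ⟨D.affAlg.forms.forms.d θ, ⟨⟨?_, ?_⟩, ?_, ?_⟩, D.affAlg.forms.forms.d_d θ, ?_⟩
  · change Forms.map (Forms.eval 0) _ = 0
    rw [hcomm, hmap, zero_smul, TensorProduct.zero_tmul]
    exact map_zero _
  · have hmem : D.affAlg.d (LinearMap.inr K D.EndStar V (D.sgn v)) ∈ D.affSub F := by
      refine ⟨?_, ?_⟩
      · change D.endAlg.d 0 ∈ D.endSub F
        rw [map_zero]; exact zero_mem _
      · change D.d (D.sgn v) ∈ F
        rw [← neg_neg (D.d (D.sgn v)), ← D.sgn_d]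
        exact neg_mem (hF.sgn_mem hv)
    refine ⟨Forms.mk 0 ((⟨_, hmem⟩ : D.affSub F) ⊗ₜ[K] 1), ?_⟩
    rw [hcomm, hmap, one_smul]
    refine Forms.ext ?_ ?_
    · simp [Forms.map, DGAlg.forms, DGAlg.fnPart_d]
    · simp [Forms.map, DGAlg.forms, DGAlg.dtCoeff_d]
  · change Forms.eval 0 _ = 0
    refine (D.affAlg.forms.toDGSpace.eval_forms_d 0 θ).trans ?_
    rw [heval, map_zero]
  · change Forms.eval 1 _ ∈ LinearMap.range _
    have : Forms.eval 1 (D.affAlg.forms.forms.d θ) = 0 := by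
      refine (D.affAlg.forms.toDGSpace.eval_forms_d 1 θ).trans ?_
      rw [heval, map_zero]
    rw [this]; exact zero_mem _
  · have h1 : Forms.dtCoeff (D.affAlg.forms.forms.d θ) = (D.affAlg.forms.d u) ⊗ₜ[K] 1 := by
      simp [DGAlg.forms, DGAlg.dtCoeff_d, hθ]
    have h2 : Forms.dtCoeff (D.affAlg.forms.d u) =
        D.affAlg.sgn (LinearMap.inr K D.EndStar V (D.sgn v)) ⊗ₜ[K] 1 := by
      simp [DGAlg.forms, DGAlg.dtCoeff_d, hu, ramp]
    change (PolyCoeff.integral (Forms.dtCoeff (PolyCoeff.integral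
      (Forms.dtCoeff (D.affAlg.forms.forms.d θ))))).2 = v
    rw [h1, PolyCoeff.integral_tmul_one, h2, PolyCoeff.integral_tmul_one,
      ← D.isHom_inr.map_sgn, D.sgn_sgn]
    rfl

/-- A cocycle whose integral is exact modulo `F` is a coboundary. Its primitive in the direction
of `t` satisfies all the conditions, except that its component in `V` may be nonzero for `t = 1`;
this component is closed and has, by the hypothesis on the integral, a primitive `b` in the
direction of `s` with `b(0) = 0` and `b(1) ∈ F`. The correction is `d (b t)`. -/
theorem exists_primitive [CharZero K] (D : DGSpace K V) {F : Submodule K V}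
    (hF : D.IsSubspace F) {ω : Forms K (Forms K (D.EndStar × V))} (hω : ω ∈ D.twAssocSub F)
    (hd : D.affAlg.forms.forms.d ω = 0) {v : V}
    (hv : (Forms.integral (Forms.integral ω)).2 - D.d v ∈ F) :
    ∃ η ∈ D.twAssocSub F, D.affAlg.forms.forms.d η = ω := by
  set 𝒮 := D.affAlg.forms.toDGSpace with h𝒮
  set η := 𝒮.formsPrim ω with hη
  have hdη : 𝒮.forms.d η = ω := 𝒮.forms_d_formsPrim hd (LinearMap.mem_ker.1 hω.2.1)
  set c := Forms.eval 1 η with hc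
  have hs : ∀ a : K, Forms.map (Forms.eval a) η =
      D.affAlg.toDGSpace.formsPrim (Forms.map (Forms.eval a) ω) := fun a =>
    (DGAlg.IsHom.formsEval D.affAlg a).toIsHom.map_formsPrim ω
  have hs0 : Forms.map (Forms.eval 0) η = 0 := by
    rw [hs, LinearMap.mem_ker.1 hω.1.1, map_zero]
  set cV := Forms.map (LinearMap.snd K D.EndStar V) c with hcV
  have hcV0 : Forms.eval 0 cV = 0 := by
    rw [hcV, Forms.eval_map, hc, ← Forms.eval_map 1 (Forms.eval (0 : K)) η, hs0, map_zero,
      map_zero]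
  have hdcV : D.forms.d cV = 0 := by
    rw [hcV, ← D.isHom_snd.forms_map_d]
    have : D.affAlg.toDGSpace.forms.d c = Forms.eval 1 ω := by
      rw [hc, ← hdη]; exact (𝒮.eval_forms_d 1 η).symm
    rw [this, D.map_snd_eval_one hω]
  -- `d (v s)` adjusts the value of the primitive at `s = 1`, which is congruent to `-d v`
  set b := D.formsPrim cV + D.forms.d (ramp v) with hb
  have hdb : D.forms.d b = cV := by
    rw [hb, map_add, D.forms.d_d, add_zero, D.forms_d_formsPrim hdcV hcV0]
  have hb0 : Forms.eval 0 b = 0 := by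
    rw [hb, map_add, D.eval_zero_formsPrim, D.eval_forms_d, eval_ramp, zero_smul, map_zero,
      add_zero]
  have hb1 : Forms.eval 1 b ∈ F := by
    have h1 : Forms.integral cV = -D.sgn (Forms.integral (Forms.integral ω)).2 := by
      rw [hcV, Forms.integral_map, hc, hη, 𝒮.eval_one_formsPrim]
      have := D.affAlg.toDGSpace.integral_sgn (Forms.integral ω)
      change LinearMap.snd K D.EndStar V (Forms.integral (D.affAlg.toDGSpace.forms.sgn _)) = _
      rw [this, map_neg, D.isHom_snd.map_sgn]
      rfl
    rw [hb, map_add, D.eval_one_formsPrim, D.eval_forms_d, eval_ramp, one_smul, h1, map_neg,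
      D.sgn_sgn, neg_add_eq_sub, ← neg_sub]
    exact neg_mem hv
  set β := Forms.map (LinearMap.inr K D.EndStar V) b with hβ
  have hβs : ∀ a : K, Forms.map (Forms.eval a) (𝒮.forms.d (ramp β)) =
      D.affAlg.forms.d (ramp (LinearMap.inr K D.EndStar V (Forms.eval a b))) := by
    intro a
    rw [← Forms.eval_map, ← map_ramp]
    exact (DGAlg.IsHom.formsEval D.affAlg a).toIsHom.forms_map_d _
  refine ⟨η - 𝒮.forms.d (ramp β), ⟨⟨?_, ?_⟩, ?_, ?_⟩, ?_⟩
  · change Forms.map (Forms.eval 0) _ = 0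
    rw [map_sub, hs0, hβs, hb0, map_zero]
    have : (ramp 0 : Forms K (D.EndStar × V)) = 0 := by
      refine Forms.ext ?_ ?_ <;> simp [ramp]
    rw [this, map_zero, sub_zero]
  · change Forms.map (Forms.eval 1) _ ∈ LinearMap.range _
    rw [map_sub, hs, hβs]
    refine sub_mem ?_ ?_
    · obtain ⟨ζ, hζ⟩ := hω.1.2
      rw [← hζ]
      exact ⟨_, (DGAlg.IsHom.subtype D.affAlg (D.affSub F) hF.affSub).toIsHom.map_formsPrim ζ⟩
    · have hmem : LinearMap.inr K D.EndStar V (Forms.eval 1 b) ∈ D.affSub F :=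
        ⟨zero_mem _, hb1⟩
      have hsub := DGAlg.IsHom.subtype D.affAlg (D.affSub F) hF.affSub
      refine ⟨(D.affAlg.restrict (D.affSub F) hF.affSub).forms.d
        (ramp (⟨_, hmem⟩ : D.affSub F)), ?_⟩
      rw [hsub.formsMap.map_d, map_ramp]
      rfl
  · change Forms.eval 0 _ = 0
    rw [map_sub, hη, 𝒮.eval_zero_formsPrim, 𝒮.eval_forms_d, eval_ramp,
      zero_smul, map_zero, sub_zero]
  · change Forms.eval 1 _ ∈ LinearMap.range _
    refine Forms.mem_range_map_inl ?_
    rw [map_sub, map_sub, 𝒮.eval_forms_d, eval_ramp, one_smul, ← hc, ← hcV, sub_eq_zero, ← hdb]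
    have h1 := D.isHom_snd.forms_map_d β
    have h2 : Forms.map (LinearMap.snd K D.EndStar V) β = b := by
      rw [hβ, Forms.map_map, LinearMap.snd_comp_inr, Forms.map_id]
    rw [h2] at h1
    exact h1.symm
  · change 𝒮.forms.d _ = ω
    rw [map_sub, hdη, 𝒮.forms.d_d, sub_zero]

/-- Every cocycle of `V / F` is the integral of a cocycle. -/
theorem exists_integralAInf_linear_eq [CharZero K] (D : DGSpace K V) (F : Submodule K V)
    (hF : D.IsSubspace F) {w : V ⧸ F} (hw : ((D.quotient F hF).shift (-2)).d w = 0) :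
    ∃ ω, (D.twAssoc F hF).d ω = 0 ∧ (D.integralAInf F hF).linear ω = w := by
  obtain ⟨v, rfl⟩ := F.mkQ_surjective w
  rw [shift_neg_two_d] at hw
  obtain ⟨ω, hω, hdω, hint⟩ := D.exists_cocycle hF ((Submodule.Quotient.mk_eq_zero F).1 hw)
  refine ⟨⟨ω, hω⟩, Subtype.ext hdω, ?_⟩
  rw [integralAInf_linear, hint]

/-- A cocycle with exact integral is exact. -/
theorem eq_d_of_integralAInf_linear_eq [CharZero K] (D : DGSpace K V) (F : Submodule K V)
    (hF : D.IsSubspace F) {ω : D.twAssocSub F} (hd : (D.twAssoc F hF).d ω = 0) {u : V ⧸ F}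
    (hu : (D.integralAInf F hF).linear ω = ((D.quotient F hF).shift (-2)).d u) :
    ∃ η, ω = (D.twAssoc F hF).d η := by
  obtain ⟨v, rfl⟩ := F.mkQ_surjective u
  rw [shift_neg_two_d] at hu
  obtain ⟨η, hη, hdη⟩ := D.exists_primitive hF ω.2 (congrArg Subtype.val hd)
    (v := v) ((Submodule.Quotient.eq F).1 hu)
  exact ⟨⟨η, hη⟩, Subtype.ext hdη.symm⟩

theorem integralAInf_isQuasiIso [CharZero K] (D : DGSpace K V) (F : Submodule K V)
    (hF : D.IsSubspace F) : (D.integralAInf F hF).IsQuasiIso := by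
  refine IsHom.isQuasiIso (D.integralAInf F hF).linear_isHom (fun w hw => ?_) fun ω hω hu => ?_
  · obtain ⟨ω, hω, h⟩ := D.exists_integralAInf_linear_eq F hF hw
    exact ⟨ω, hω, 0, by rw [h, sub_self, map_zero]⟩
  · obtain ⟨u, hu⟩ := hu
    exact D.eq_d_of_integralAInf_linear_eq F hF hω hu

end quasiIso
end DGSpace

/-! ### The double fibre of the Jacobian square -/

namespace DGAlg

section commutator

variable {K A : Type*} [Field K] [AddCommGroup A] [Module K A]

theorem eq_of_mul_eq {𝒜 ℬ : DGAlg K A} (h : 𝒜.toDGSpace = ℬ.toDGSpace) (h' : 𝒜.mul = ℬ.mul) :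
    𝒜 = ℬ := by
  cases 𝒜
  cases ℬ
  subst h h'
  rfl

theorem polyCoeff_commutator (𝒜 : DGAlg K A) {i j : ℤ} {x y : PolyCoeff K A}
    (hx : x ∈ PolyCoeff.sub (𝒜.gr i)) (hy : y ∈ PolyCoeff.sub (𝒜.gr j)) :
    PolyCoeff.mul 𝒜.commutator.mul x y = PolyCoeff.mul 𝒜.mul x y -
      (i * j).negOnePow • PolyCoeff.mul 𝒜.mul y x := by
  refine PolyCoeff.sub_induct (P := fun x => PolyCoeff.mul 𝒜.commutator.mul x y =
    PolyCoeff.mul 𝒜.mul x y - (i * j).negOnePow • PolyCoeff.mul 𝒜.mul y x) hx ?_ (by simp) ?_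
  · intro a ha p
    refine PolyCoeff.sub_induct (P := fun y => PolyCoeff.mul 𝒜.commutator.mul (a ⊗ₜ[K] p) y =
      PolyCoeff.mul 𝒜.mul (a ⊗ₜ[K] p) y -
        (i * j).negOnePow • PolyCoeff.mul 𝒜.mul y (a ⊗ₜ[K] p)) hy ?_ (by simp) ?_
    · intro b hb q
      rw [PolyCoeff.mul_tmul, PolyCoeff.mul_tmul, PolyCoeff.mul_tmul, 𝒜.commutator_of_mem ha hb,
        mul_comm q p]
      rcases negOnePow_cases (i * j) with h | h <;>
      simp [h, TensorProduct.sub_tmul, TensorProduct.add_tmul]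
    · intro v w hv hw
      simp only [map_add, LinearMap.add_apply, smul_add, hv, hw]; abel
  · intro v w hv hw
    simp only [map_add, LinearMap.add_apply, smul_add, hv, hw]; abel

/-- The bracket of `A[t, dt]` induced by the commutator of `A` is the commutator of `A[t, dt]`. -/
theorem commutator_forms (𝒜 : DGAlg K A) : 𝒜.commutator.forms = 𝒜.forms.commutator := by
  refine eq_of_mul_eq rfl (LinearMap.ext fun x => LinearMap.ext fun y => ?_)
  refine 𝒜.forms.induct (P := fun x => 𝒜.commutator.forms.mul x y =
    𝒜.forms.commutator.mul x y) x ?_ (by simp) ?_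
  · intro i x hx
    refine 𝒜.forms.induct (P := fun y => 𝒜.commutator.forms.mul x y =
      𝒜.forms.commutator.mul x y) y ?_ (by simp) ?_
    · intro j y hy
      rw [𝒜.forms.commutator_of_mem hx hy]
      refine Forms.ext ?_ ?_
      · rw [map_sub, map_sign]
        exact 𝒜.polyCoeff_commutator hx.1 hy.1
      · have hs : PolyCoeff.map 𝒜.commutator.sgn (Forms.fnPart y) =
            j.negOnePow • Forms.fnPart y := polyCoeff_sgn 𝒜.toDGSpace hy.1
        rw [map_sub, map_sign, dtCoeff_mul, dtCoeff_mul, dtCoeff_mul, hs,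
          polyCoeff_sgn 𝒜.toDGSpace hx.1, polyCoeff_sgn 𝒜.toDGSpace hy.1, map_sign, map_sign,
          map_sign, 𝒜.polyCoeff_commutator hx.1 hy.2, 𝒜.polyCoeff_commutator hx.2 hy.1, mul_sub,
          sub_mul, Int.negOnePow_sub, Int.negOnePow_sub]
        rcases negOnePow_cases i with h1 | h1 <;> rcases negOnePow_cases j with h2 | h2 <;>
        rcases negOnePow_cases (i * j) with h3 | h3 <;> simp [h1, h2, h3] <;> abel
    · intro v w hv hw
      simp only [map_add, hv, hw]
  · intro v w hv hw
    simp only [map_add, LinearMap.add_apply, hv, hw]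

end commutator
end DGAlg

theorem Forms.map_injective {K V W : Type*} [Field K] [AddCommGroup V] [Module K V]
    [AddCommGroup W] [Module K W] {φ : V →ₗ[K] W} (hφ : Function.Injective φ) :
    Function.Injective (Forms.map φ) := by
  obtain ⟨ψ, hψ⟩ := φ.exists_leftInverse_of_injective (LinearMap.ker_eq_bot.2 hφ)
  refine Function.LeftInverse.injective (g := Forms.map ψ) fun ω => ?_
  rw [Forms.map_map, hψ, Forms.map_id]

namespace DGSpace

section doubleFibre

variable {K V : Type*} [Field K] [AddCommGroup V] [Module K V]

/-- The projection of the double fibre of the Jacobian square to its last component. -/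
noncomputable def doubleFibreProj (D : DGSpace K V) (F : Submodule K V) (hF : D.IsSubspace F) :
    (D.jacobianSquare F hF).tw →ₗ[K] D.twAssocSub F where
  toFun ω := ⟨ω.1.2.2.2, ⟨⟨ω.2.2.2.1.1, ⟨ω.1.2.2.1, ω.2.2.2.1.2.symm⟩⟩,
    ω.2.2.2.2.1, ⟨ω.1.2.1, ω.2.2.2.2.2.symm⟩⟩⟩
  map_add' _ _ := rfl
  map_smul' _ _ := rfl

/-- The maps of the Jacobian square are injective, so that the last component determines the other
ones. -/
theorem doubleFibreProj_injective (D : DGSpace K V) (F : Submodule K V) (hF : D.IsSubspace F) :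
    Function.Injective (D.doubleFibreProj F hF) := by
  rw [injective_iff_map_eq_zero]
  rintro ⟨⟨ω₀₀, ω₀₁, ω₁₀, ω₁₁⟩, ⟨h1, h2⟩, ⟨h3, h4⟩, ⟨h5, h6⟩, h7, h8⟩ h
  have h11 : ω₁₁ = 0 := congrArg Subtype.val h
  subst h11
  have h10 : ω₁₀ = 0 := Forms.map_injective (D.affSub F).subtype_injective
    (by rw [map_zero]; exact h6.symm.trans (map_zero _))
  have h01 : ω₀₁ = 0 := Forms.map_injective (LinearMap.inl_injective (R := K) (M₂ := V))
    (by rw [map_zero]; exact h8.symm.trans (map_zero _))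
  subst h10 h01
  have h00 : ω₀₀ = 0 := (D.endSub F).subtype_injective
    (by rw [map_zero]; exact h2.symm.trans (map_zero _))
  subst h00
  rfl

theorem doubleFibreProj_surjective (D : DGSpace K V) (F : Submodule K V) (hF : D.IsSubspace F) :
    Function.Surjective (D.doubleFibreProj F hF) := by
  rintro ⟨ω, ⟨hs0, ⟨ω₁₀, h10⟩⟩, ht0, ⟨ω₀₁, h01⟩⟩
  have hs0 : Forms.map (Forms.eval 0) ω = 0 := hs0
  have ht0 : Forms.eval 0 ω = 0 := ht0
  have e1 : ∀ c : K, LinearMap.inl K D.EndStar V (Forms.eval c ω₀₁) =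
      Forms.eval 1 (Forms.map (Forms.eval c) ω) := by
    intro c
    rw [Forms.eval_map, ← h01, Forms.eval_map]
  have e2 : ∀ c : K, (D.affSub F).subtype (Forms.eval c ω₁₀) =
      Forms.eval 1 (Forms.eval c ω) := by
    intro c
    rw [← Forms.eval_map, h10, Forms.eval_map]
  have h00 : Forms.eval 1 ω₀₁ ∈ D.endSub F := by
    have h : LinearMap.inl K D.EndStar V (Forms.eval 1 ω₀₁) ∈ D.affSub F := by
      rw [e1, Forms.eval_map, ← e2]
      exact (Forms.eval 1 ω₁₀).2
    exact h.1
  refine ⟨⟨(⟨_, h00⟩, ω₀₁, ω₁₀, ω), ⟨?_, rfl⟩, ⟨?_, ?_⟩, ⟨hs0, h10.symm⟩, ht0, h01.symm⟩, rfl⟩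
  · refine LinearMap.inl_injective (R := K) (M₂ := V) ?_
    rw [e1, hs0, map_zero, map_zero]
  · refine (D.affSub F).subtype_injective ?_
    rw [e2, ht0, map_zero, map_zero]
  · refine (D.affSub F).subtype_injective ?_
    rw [e2, ← Forms.eval_map, ← e1]
    rfl

/-- The double fibre of the Jacobian square, identified with its last component. -/
noncomputable def doubleFibreEquiv (D : DGSpace K V) (F : Submodule K V) (hF : D.IsSubspace F) :
    (D.jacobianSquare F hF).tw ≃ₗ[K] D.twAssocSub F :=
  LinearEquiv.ofBijective (D.doubleFibreProj F hF)
    ⟨D.doubleFibreProj_injective F hF, D.doubleFibreProj_surjective F hF⟩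

theorem doubleFibreEquiv_isHom (D : DGSpace K V) (F : Submodule K V) (hF : D.IsSubspace F) :
    (D.jacobianSquare F hF).twAlg.IsHom (D.twAssoc F hF).commutator
      (D.doubleFibreEquiv F hF).toLinearMap where
  map_mem h := h.2.2.2
  map_d _ := rfl
  map_mul a b := by
    have h1 := (DGAlg.IsHom.subtype D.affAlg.forms.forms (D.twAssocSub F)
      hF.twAssocSub).commutator.map_mul (D.doubleFibreEquiv F hF a) (D.doubleFibreEquiv F hF b)
    refine Subtype.ext (Eq.trans ?_ h1.symm)
    rw [← DGAlg.commutator_forms, ← DGAlg.commutator_forms]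
    rfl

end doubleFibre
end DGSpace

/-! ### Permutations and unshuffles -/

namespace Equiv.Perm

section shift

/-- The permutation of `{0, …, n}` which fixes `0` and permutes `1, …, n` as `ρ` permutes
`0, …, n - 1`. -/
def shift {n : ℕ} (ρ : Equiv.Perm (Fin n)) : Equiv.Perm (Fin (n + 1)) :=
  Equiv.Perm.decomposeFin.symm (0, ρ)

@[simp] theorem shift_zero {n : ℕ} (ρ : Equiv.Perm (Fin n)) : shift ρ 0 = 0 := by
  simp [shift]

@[simp] theorem shift_succ {n : ℕ} (ρ : Equiv.Perm (Fin n)) (j : Fin n) :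
    shift ρ j.succ = (ρ j).succ := by
  simp [shift]

theorem shift_one {n : ℕ} : shift (1 : Equiv.Perm (Fin n)) = 1 := by
  refine Equiv.ext fun j => ?_
  refine Fin.cases ?_ (fun j => ?_) j <;> simp

theorem shift_mul {n : ℕ} (ρ ρ' : Equiv.Perm (Fin n)) : shift (ρ * ρ') = shift ρ * shift ρ' := by
  refine Equiv.ext fun j => ?_
  refine Fin.cases ?_ (fun j => ?_) j <;> simp

theorem shift_inv {n : ℕ} (ρ : Equiv.Perm (Fin n)) : shift ρ⁻¹ = (shift ρ)⁻¹ := by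
  rw [eq_inv_iff_mul_eq_one, ← shift_mul, inv_mul_cancel, shift_one]

theorem shift_injective {n : ℕ} : Function.Injective (shift (n := n)) := fun _ _ h =>
  (Prod.ext_iff.1 (Equiv.Perm.decomposeFin.symm.injective h)).2

/-- Every permutation of `{0, …, n}` is, in a unique way, a permutation which fixes `0` followed by
the permutation which sends `0` to some `m` and preserves the order of `1, …, n`. -/
theorem sum_eq_sum_cycleRange_mul {n : ℕ} {M : Type*} [AddCommMonoid M]
    (H : Equiv.Perm (Fin (n + 1)) → M) :
    ∑ τ, H τ = ∑ m : Fin (n + 1), ∑ ρ : Equiv.Perm (Fin n), H (m.cycleRange⁻¹ * shift ρ) := by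
  rw [← Fintype.sum_prod_type']
  symm
  refine Fintype.sum_bijective
    (fun x : Fin (n + 1) × Equiv.Perm (Fin n) => x.1.cycleRange⁻¹ * shift x.2) ?_ _ _
    fun _ => rfl
  rw [Fintype.bijective_iff_injective_and_card]
  refine ⟨?_, ?_⟩
  · rintro ⟨m, ρ⟩ ⟨m', ρ'⟩ h
    have h0 : m = m' := by
      have := congrArg (fun σ : Equiv.Perm (Fin (n + 1)) => σ 0) h
      simpa [Equiv.Perm.inv_def] using this
    subst h0
    rw [Prod.mk.injEq]
    exact ⟨rfl, shift_injective (mul_left_cancel h)⟩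
  · rw [Fintype.card_prod, Fintype.card_perm, Fintype.card_perm, Fintype.card_fin,
      Fintype.card_fin, Nat.factorial_succ]

/-- Every permutation of `{0, …, n}` is, in a unique way, the permutation which sends some `i` to
`0` and preserves the order of the other elements, followed by a permutation which fixes `0`. -/
theorem sum_eq_sum_mul_cycleRange {n : ℕ} {M : Type*} [AddCommMonoid M]
    (H : Equiv.Perm (Fin (n + 1)) → M) :
    ∑ τ, H τ = ∑ i : Fin (n + 1), ∑ ρ : Equiv.Perm (Fin n), H (shift ρ * i.cycleRange) := by
  rw [← Equiv.sum_comp (Equiv.inv (Equiv.Perm (Fin (n + 1)))) H, sum_eq_sum_cycleRange_mul]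
  refine Finset.sum_congr rfl fun i _ => ?_
  rw [← Equiv.sum_comp (Equiv.inv (Equiv.Perm (Fin n)))]
  refine Finset.sum_congr rfl fun ρ _ => ?_
  simp [shift_inv]

theorem eq_one_of_strictMono {n : ℕ} {ρ : Equiv.Perm (Fin n)} (h : StrictMono ρ) : ρ = 1 := by
  have := (h.range_inj strictMono_id).1 (by rw [ρ.surjective.range_eq, Set.range_id])
  exact Equiv.ext fun j => congrFun this j

theorem cycleRange_mul_shift_succ {n : ℕ} (m : Fin (n + 1)) (ρ : Equiv.Perm (Fin n))
    (j : Fin n) : (m.cycleRange⁻¹ * shift ρ) j.succ = m.succAbove (ρ j) := by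
  simp [Equiv.Perm.inv_def]

/-- The unshuffles of type `(1, n)` are the permutations which send `0` to some `m` and preserve the
order of `1, …, n`. -/
theorem sum_unshuffles_one {n : ℕ} {M : Type*} [AddCommMonoid M]
    (Q : Equiv.Perm (Fin (n + 1)) → M) :
    ∑ σ ∈ unshuffles (n + 1) 1, Q σ = ∑ m : Fin (n + 1), Q m.cycleRange⁻¹ := by
  classical
  rw [unshuffles, Finset.sum_filter, sum_eq_sum_cycleRange_mul]
  refine Finset.sum_congr rfl fun m _ => ?_
  rw [Fintype.sum_eq_single 1]
  · rw [shift_one, mul_one, if_pos]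
    intro i j hij hk
    have hi : i ≠ 0 := by
      rintro rfl
      rcases hk with hk | hk
      · simp only [Nat.lt_one_iff, Fin.val_eq_zero_iff] at hk
        exact absurd hij (by simp [hk])
      · simp at hk
    obtain ⟨i, rfl⟩ := Fin.exists_succ_eq.2 hi
    obtain ⟨j, rfl⟩ := Fin.exists_succ_eq.2 ((Fin.zero_le _).trans_lt hij).ne'
    simpa [Equiv.Perm.inv_def] using hij
  · intro ρ hρ
    rw [if_neg]
    intro h
    refine hρ (eq_one_of_strictMono fun i j hij => ?_)
    have := h i.succ j.succ (Fin.succ_lt_succ_iff.2 hij) (Or.inr (by simp))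
    rw [cycleRange_mul_shift_succ, cycleRange_mul_shift_succ] at this
    exact Fin.succAbove_lt_succAbove_iff.1 this

/-- Summing over the unshuffles of type `(2, n)` and over the two orders of the first two entries
amounts to summing over the ordered pairs of distinct entries. -/
theorem sum_unshuffles_two {n : ℕ} {M : Type*} [AddCommMonoid M]
    (Q : Equiv.Perm (Fin (n + 2)) → M) :
    ∑ σ ∈ unshuffles (n + 2) 2, (Q σ + Q (σ * Equiv.swap 0 1)) =
      ∑ a : Fin (n + 2), ∑ b : Fin (n + 1), Q (a.cycleRange⁻¹ * shift b.cycleRange⁻¹) := by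
  classical
  set U : Finset (Equiv.Perm (Fin (n + 2))) :=
    Finset.univ.filter fun σ => ∀ i j : Fin n, i < j → σ i.succ.succ < σ j.succ.succ with hU
  have h1 : unshuffles (n + 2) 2 = U.filter fun σ => σ 0 < σ 1 := by
    ext σ
    simp only [unshuffles, hU, Finset.mem_filter, Finset.mem_univ, true_and]
    constructor
    · intro h
      refine ⟨fun i j hij => h _ _ (by simpa using hij) (Or.inr (by simp)),
        h 0 1 (by simp) (Or.inl (by simp))⟩
    · rintro ⟨h, h'⟩ i j hij hk
      induction i using Fin.cases with
      | zero =>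
        have hj : j = 1 := by
          rcases hk with hk | hk
          · exact Fin.ext (by have : (0 : ℕ) < j := hij; simp; omega)
          · simp at hk
        rw [hj]; exact h'
      | succ i =>
        induction i using Fin.cases with
        | zero =>
          exfalso
          rcases hk with hk | hk
          · have : (1 : ℕ) < j := by simpa [Fin.lt_def] using hij
            omega
          · simp at hk
        | succ i =>
          induction j using Fin.cases with
          | zero => simp at hij
          | succ j =>
            induction j using Fin.cases with
            | zero => simp [Fin.lt_def] at hij
            | succ j => exact h i j (by simpa using hij)
  -- composition with the transposition exchanges the permutations in `U` with `σ 0 < σ 1` and those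
  -- with `σ 1 < σ 0`
  have hsw : ∀ (σ : Equiv.Perm (Fin (n + 2))) (i : Fin n),
      (σ * Equiv.swap 0 1 : Equiv.Perm (Fin (n + 2))) i.succ.succ = σ i.succ.succ := by
    intro σ i
    rw [Equiv.Perm.mul_apply, Equiv.swap_apply_of_ne_of_ne (Fin.succ_ne_zero _)]
    intro h
    have := congrArg Fin.val h
    simp at this
  have h2 : ∑ σ ∈ U.filter (fun σ => σ 0 < σ 1), Q (σ * Equiv.swap 0 1) =
      ∑ σ ∈ U.filter (fun σ => ¬ σ 0 < σ 1), Q σ := by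
    refine Finset.sum_nbij' (fun σ => σ * Equiv.swap 0 1) (fun σ => σ * Equiv.swap 0 1) ?_ ?_ ?_ ?_
      fun _ _ => rfl
    · intro σ hσ
      simp only [hU, Finset.mem_filter, Finset.mem_univ, true_and, hsw] at hσ ⊢
      refine ⟨hσ.1, ?_⟩
      simpa using hσ.2.le
    · intro σ hσ
      simp only [hU, Finset.mem_filter, Finset.mem_univ, true_and, hsw] at hσ ⊢
      refine ⟨hσ.1, ?_⟩
      have hne : σ 1 ≠ σ 0 := fun h => by
        have := congrArg Fin.val (σ.injective h)
        simp at this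
      simpa using lt_of_le_of_ne (not_lt.1 hσ.2) hne
    · intro σ _; simp [mul_assoc]
    · intro σ _; simp [mul_assoc]
  rw [Finset.sum_add_distrib, h1, h2, Finset.sum_filter_add_sum_filter_not, hU, Finset.sum_filter,
    sum_eq_sum_cycleRange_mul]
  refine Finset.sum_congr rfl fun a _ => ?_
  rw [← sum_unshuffles_one fun ρ => Q (a.cycleRange⁻¹ * shift ρ), unshuffles, Finset.sum_filter]
  refine Finset.sum_congr rfl fun ρ _ => ?_
  congr 1
  simp only [cycleRange_mul_shift_succ, Fin.succAbove_lt_succAbove_iff, eq_iff_iff]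
  constructor
  · intro h i j hij hk
    induction i using Fin.cases with
    | zero =>
      exfalso
      rcases hk with hk | hk
      · have : (0 : ℕ) < j := hij
        omega
      · simp at hk
    | succ i =>
      induction j using Fin.cases with
      | zero => simp at hij
      | succ j => exact h i j (by simpa using hij)
  · intro h i j hij
    exact h _ _ (by simpa using hij) (Or.inr (by simp))

end shift
end Equiv.Perm

/-! ### Koszul signs -/

section koszul

theorem seqPerm_of_lt {A : Type*} {n : ℕ} (σ : Equiv.Perm (Fin n)) (x : ℕ → A) {j : ℕ}
    (hj : j < n) : seqPerm σ x j = x (σ ⟨j, hj⟩) := by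
  simp [seqPerm, hj]

theorem seqPerm_coe {A : Type*} {n : ℕ} (σ : Equiv.Perm (Fin n)) (x : ℕ → A) (j : Fin n) :
    seqPerm σ x j = x (σ j) := seqPerm_of_lt σ x j.2

theorem seqPerm_mul {A : Type*} {n : ℕ} (σ τ : Equiv.Perm (Fin n)) (x : ℕ → A) :
    seqPerm (σ * τ) x = seqPerm τ (seqPerm σ x) := by
  funext j
  by_cases h : j < n <;> simp [seqPerm, h]

theorem comp_seqPerm {A B : Type*} {n : ℕ} (φ : A → B) (σ : Equiv.Perm (Fin n)) (x : ℕ → A) :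
    (fun j => φ (seqPerm σ x j)) = seqPerm σ fun j => φ (x j) := by
  funext j
  by_cases h : j < n <;> simp [seqPerm, h]

theorem seqPerm_rel {A B : Type*} {n : ℕ} {P : A → B → Prop} (σ : Equiv.Perm (Fin n)) {x : ℕ → A}
    {y : ℕ → B} (h : ∀ i, P (x i) (y i)) (i : ℕ) : P (seqPerm σ x i) (seqPerm σ y i) := by
  by_cases hi : i < n
  · rw [seqPerm_of_lt _ _ hi, seqPerm_of_lt _ _ hi]; exact h _
  · simpa [seqPerm, hi] using h i

/-- A product over the pairs `i < j` of a symmetric function is invariant under permutations. -/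
theorem prod_lt_comp_perm {n : ℕ} {M : Type*} [CommMonoid M] (g : Fin n → Fin n → M)
    (hg : ∀ i j, g i j = g j i) (τ : Equiv.Perm (Fin n)) :
    (∏ i, ∏ j, if i < j then g (τ i) (τ j) else 1) = ∏ i, ∏ j, if i < j then g i j else 1 := by
  rw [← Fintype.prod_prod_type', ← Fintype.prod_prod_type', ← Finset.prod_filter,
    ← Finset.prod_filter]
  -- the action of `τ` on the pairs `i < j`
  set o : Equiv.Perm (Fin n) → Fin n × Fin n → Fin n × Fin n := fun τ p =>
    if τ p.1 < τ p.2 then (τ p.1, τ p.2) else (τ p.2, τ p.1) with ho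
  have hmem : ∀ τ : Equiv.Perm (Fin n), ∀ p : Fin n × Fin n, p.1 < p.2 → (o τ p).1 < (o τ p).2 := by
    intro τ p hp
    simp only [ho]
    split_ifs with h
    · exact h
    · exact lt_of_le_of_ne (not_lt.1 h) fun h' => hp.ne' (τ.injective h')
  have hinv : ∀ τ : Equiv.Perm (Fin n), ∀ p : Fin n × Fin n, p.1 < p.2 → o τ⁻¹ (o τ p) = p := by
    intro τ p hp
    simp only [ho]
    split_ifs with h1 h2 h3
    · simp
    · simp [hp] at h2
    · simp [hp.not_gt] at h3
    · simp
  refine Finset.prod_nbij' (o τ) (o τ⁻¹) ?_ ?_ ?_ ?_ ?_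
  · intro p hp
    simp only [Finset.mem_filter, Finset.mem_univ, true_and] at hp ⊢
    exact hmem τ p hp
  · intro p hp
    simp only [Finset.mem_filter, Finset.mem_univ, true_and] at hp ⊢
    exact hmem τ⁻¹ p hp
  · intro p hp
    simp only [Finset.mem_filter, Finset.mem_univ, true_and] at hp
    exact hinv τ p hp
  · intro p hp
    simp only [Finset.mem_filter, Finset.mem_univ, true_and] at hp
    simpa using hinv τ⁻¹ p hp
  · intro p _
    simp only [ho]
    split_ifs with h
    · rfl
    · exact hg _ _

/-- The cocycle property of the Koszul signs. -/
theorem koszulSign_mul {n : ℕ} (σ τ : Equiv.Perm (Fin n)) (deg : ℕ → ℤ) :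
    koszulSign (σ * τ) deg = koszulSign σ deg * koszulSign τ (seqPerm σ deg) := by
  -- `ε(σ)` is the product over the unordered pairs of positions of a symmetric function `w`, which
  -- may be reindexed by `τ`; then the factors of the two sides agree pair by pair
  set s : Fin n → Fin n → ℤˣ := fun a b => ((deg a - 1) * (deg b - 1)).negOnePow with hs
  have hsymm : ∀ a b, s a b = s b a := fun a b => by simp only [hs]; rw [mul_comm]
  have hsq : ∀ a b, s a b * s a b = 1 := fun a b => by simp
  set w : Fin n → Fin n → ℤˣ := fun i j => if (i < j ↔ σ i < σ j) then 1 else s (σ i) (σ j)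
    with hw
  have hwsymm : ∀ i j, w i j = w j i := by
    intro i j
    rcases eq_or_ne i j with rfl | hij
    · rfl
    have hσ : σ i ≠ σ j := fun h => hij (σ.injective h)
    have h1 : (i < j ↔ σ i < σ j) ↔ (j < i ↔ σ j < σ i) := by
      rcases hij.lt_or_gt with h | h <;> rcases hσ.lt_or_gt with h' | h' <;>
      simp [h, h', h.not_gt, h'.not_gt]
    simp only [hw, h1, hsymm]
  have h1 : koszulSign σ deg = ∏ i, ∏ j, if i < j then w (τ i) (τ j) else 1 := by
    rw [prod_lt_comp_perm w hwsymm τ, koszulSign]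
    refine Finset.prod_congr rfl fun i _ => Finset.prod_congr rfl fun j _ => ?_
    by_cases hij : i < j
    · have hσ : σ i ≠ σ j := fun h => hij.ne (σ.injective h)
      rcases hσ.lt_or_gt with h' | h' <;> simp [hw, hs, hij, h', h'.not_gt]
    · simp [hij]
  rw [h1, koszulSign, koszulSign, ← Finset.prod_mul_distrib]
  refine Finset.prod_congr rfl fun i _ => ?_
  rw [← Finset.prod_mul_distrib]
  refine Finset.prod_congr rfl fun j _ => ?_
  rw [seqPerm_coe, seqPerm_coe]
  change _ = _ * if i < j ∧ τ j < τ i then s (σ (τ i)) (σ (τ j)) else 1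
  change (if i < j ∧ σ (τ j) < σ (τ i) then s (σ (τ i)) (σ (τ j)) else 1) = _
  by_cases hij : i < j
  · have hτ : τ i ≠ τ j := fun h => hij.ne (τ.injective h)
    have hσ : σ (τ i) ≠ σ (τ j) := fun h => hτ (σ.injective h)
    rcases hτ.lt_or_gt with h | h <;> rcases hσ.lt_or_gt with h' | h' <;>
    simp [hw, hij, h, h', h.not_gt, h'.not_gt, hsq]
  · simp [hij]

theorem koszulSign_one {n : ℕ} (deg : ℕ → ℤ) : koszulSign (1 : Equiv.Perm (Fin n)) deg = 1 := by
  refine Finset.prod_eq_one fun i _ => Finset.prod_eq_one fun j _ => if_neg ?_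
  rintro ⟨h, h'⟩
  exact h.not_gt h'

/-- The Koszul signs depend only on the parities of the degrees. -/
theorem koszulSign_congr {n : ℕ} (σ : Equiv.Perm (Fin n)) {deg deg' : ℕ → ℤ}
    (h : ∀ j < n, (deg j).negOnePow = (deg' j).negOnePow) :
    koszulSign σ deg = koszulSign σ deg' := by
  refine Finset.prod_congr rfl fun i _ => Finset.prod_congr rfl fun j _ => ?_
  congr 1
  have hi := (Int.negOnePow_eq_iff _ _).1 (h _ (σ i).2)
  have hj := (Int.negOnePow_eq_iff _ _).1 (h _ (σ j).2)
  rw [Int.negOnePow_eq_iff]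
  simp only [Int.even_sub, Int.even_mul] at hi hj ⊢
  rw [hi, hj]

theorem koszulSign_shift {n : ℕ} (ρ : Equiv.Perm (Fin n)) (deg : ℕ → ℤ) :
    koszulSign (Equiv.Perm.shift ρ) deg = koszulSign ρ fun j => deg (j + 1) := by
  rw [koszulSign, koszulSign, Fin.prod_univ_succ, Finset.prod_eq_one, one_mul]
  · refine Finset.prod_congr rfl fun i _ => ?_
    rw [Fin.prod_univ_succ, if_neg (by simp), one_mul]
    refine Finset.prod_congr rfl fun j _ => ?_
    simp
  · intro j _
    rw [if_neg]
    simp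

theorem negOnePow_sum {ι : Type*} (s : Finset ι) (f : ι → ℤ) :
    (∑ i ∈ s, f i).negOnePow = ∏ i ∈ s, (f i).negOnePow := by
  classical
  induction s using Finset.induction_on with
  | empty => simp
  | insert a s ha ih => rw [Finset.sum_insert ha, Finset.prod_insert ha, Int.negOnePow_add, ih]

theorem prod_ite_lt_eq {n : ℕ} (i : Fin n) (f : ℕ → ℤˣ) :
    (∏ j : Fin n, if j < i then f j else 1) = ∏ j ∈ Finset.range i, f j := by
  have h := Fin.prod_univ_eq_prod_range (fun j => if j < (i : ℕ) then f j else 1) n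
  have h2 : (Finset.range n).filter (fun j => j < (i : ℕ)) = Finset.range i := by
    ext j
    simp only [Finset.mem_filter, Finset.mem_range]
    have := i.2
    omega
  rw [← h2, Finset.prod_filter]
  exact h

/-- Raising the degree of the first entry by `1` changes the Koszul sign by the sign of moving an
element of degree `1` across the entries which `ρ` puts before it. -/
theorem koszulSign_update_zero {n : ℕ} (ρ : Equiv.Perm (Fin (n + 1))) (deg : ℕ → ℤ) :
    koszulSign ρ (Function.update deg 0 (deg 0 + 1)) = koszulSign ρ deg *
      (∑ j ∈ Finset.range (ρ⁻¹ 0 : Fin (n + 1)), (seqPerm ρ deg j - 1)).negOnePow := by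
  rw [negOnePow_sum, ← prod_ite_lt_eq, koszulSign, koszulSign, ← Finset.prod_mul_distrib]
  refine Finset.prod_congr rfl fun i _ => ?_
  have h1 : (if i < ρ⁻¹ 0 then (seqPerm ρ deg i - 1).negOnePow else 1) =
      ∏ j, if j = ρ⁻¹ 0 then (if i < ρ⁻¹ 0 then (deg (ρ i) - 1).negOnePow else 1) else 1 := by
    rw [Fintype.prod_ite_eq', seqPerm_coe]
  rw [h1, ← Finset.prod_mul_distrib]
  refine Finset.prod_congr rfl fun j _ => ?_
  by_cases hj : j = ρ⁻¹ 0
  · subst hj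
    rw [if_pos rfl]
    have h0 : ρ (ρ⁻¹ 0) = 0 := by simp
    rw [h0]
    by_cases hi : i < ρ⁻¹ 0
    · have hne : ρ i ≠ 0 := fun h => hi.ne (by rw [← h]; simp)
      have hne' : ((ρ i : Fin (n + 1)) : ℕ) ≠ 0 := fun h => hne (Fin.ext h)
      have hpos : 0 < ρ i := Fin.pos_iff_ne_zero.2 hne
      simp only [hi, hpos, and_self, if_true]
      rw [Function.update_of_ne hne', Fin.val_zero, Function.update_self, ← Int.negOnePow_add]
      congr 1
      ring
    · rw [if_neg (fun h => hi h.1), if_neg (fun h => hi h.1), if_neg hi, mul_one]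
  · rw [if_neg hj, mul_one]
    have hne : ρ j ≠ 0 := fun h => hj (by rw [← h]; simp)
    have hne' : ((ρ j : Fin (n + 1)) : ℕ) ≠ 0 := fun h => hne (Fin.ext h)
    by_cases hc : i < j ∧ ρ j < ρ i
    · have hi' : ((ρ i : Fin (n + 1)) : ℕ) ≠ 0 := fun h => by
        have := hc.2
        rw [Fin.lt_def, h] at this
        omega
      rw [if_pos hc, if_pos hc, Function.update_of_ne hne', Function.update_of_ne hi']
    · rw [if_neg hc, if_neg hc]

/-- Moving the entry `0` to the position `i` moves it across the entries `1, …, i`. -/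
theorem koszulSign_cycleRange {n : ℕ} (i : Fin (n + 1)) (deg : ℕ → ℤ) :
    koszulSign i.cycleRange deg =
      ((deg 0 - 1) * ∑ j ∈ Finset.range i, (deg (j + 1) - 1)).negOnePow := by
  rw [Finset.mul_sum, negOnePow_sum,
    ← prod_ite_lt_eq i fun j => ((deg 0 - 1) * (deg (j + 1) - 1)).negOnePow, koszulSign]
  refine Finset.prod_congr rfl fun k _ => ?_
  rw [Finset.prod_eq_single i]
  · rw [Fin.cycleRange_self]
    by_cases hk : k < i
    · have := Fin.coe_cycleRange_of_lt hk
      have hpos : 0 < i.cycleRange k := by rw [Fin.lt_def, this]; simp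
      rw [if_pos ⟨hk, hpos⟩, if_pos hk, this, mul_comm]
      rfl
    · simp [hk]
  · intro l _ hl
    rw [if_neg]
    rintro ⟨hkl, h⟩
    rcases hl.lt_or_gt with hl | hl
    · have h1 := Fin.coe_cycleRange_of_lt hl
      have h2 := Fin.coe_cycleRange_of_lt (hkl.trans hl)
      rw [Fin.lt_def, h1, h2] at h
      rw [Fin.lt_def] at hkl
      omega
    · rw [Fin.cycleRange_of_gt hl, Fin.lt_def] at h
      rcases lt_trichotomy k i with hk | rfl | hk
      · rw [Fin.coe_cycleRange_of_lt hk] at h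
        rw [Fin.lt_def] at hk hl hkl
        omega
      · rw [Fin.cycleRange_self] at h
        simp at h
      · rw [Fin.cycleRange_of_gt hk] at h
        rw [Fin.lt_def] at hkl
        omega
  · simp

/-- Moving the entries `0` and `1` to the positions `i` and `i + 1` moves them across the entries
`2, …, i + 1`. -/
theorem koszulSign_cycleRange_sq {n : ℕ} (i : Fin (n + 1)) (deg : ℕ → ℤ) :
    koszulSign (i.succ.cycleRange * i.succ.cycleRange) deg =
      ((deg 0 - 1 + (deg 1 - 1)) * ∑ j ∈ Finset.range i, (deg (j + 2) - 1)).negOnePow := by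
  have h1 : ∀ j : ℕ, j < i + 1 → seqPerm i.succ.cycleRange deg j = deg (j + 1) := by
    intro j hj
    have hj' : j < n + 2 := by have := i.2; omega
    have hlt : (⟨j, hj'⟩ : Fin (n + 2)) < i.succ := by rw [Fin.lt_def]; simpa using hj
    rw [seqPerm_of_lt _ _ hj', Fin.coe_cycleRange_of_lt hlt]
  have h2 : seqPerm i.succ.cycleRange deg (i + 1) = deg 0 := by
    have := seqPerm_coe i.succ.cycleRange deg i.succ
    rwa [Fin.cycleRange_self] at this
  rw [koszulSign_mul, koszulSign_cycleRange, koszulSign_cycleRange, Fin.val_succ,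
    Finset.sum_range_succ', Finset.sum_range_succ, h2, h1 0 (by omega)]
  have h3 : ∑ j ∈ Finset.range i, (seqPerm i.succ.cycleRange deg (j + 1) - 1) =
      ∑ j ∈ Finset.range i, (deg (j + 2) - 1) :=
    Finset.sum_congr rfl fun j hj => by
      rw [Finset.mem_range] at hj
      rw [h1 _ (by omega)]
  rw [h3, ← Int.negOnePow_add, Int.negOnePow_eq_iff]
  simp only [zero_add]
  refine ⟨(deg 0 - 1) * (deg 1 - 1), ?_⟩
  ring

end koszul

/-! ### Symmetrization of functions of sequences -/

section symmetrization

variable {A B : Type*} [AddCommGroup B]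

/-- The graded symmetrization `∑_σ ε(σ) g(x_{σ 0}, …, x_{σ (n-1)}, x_n, …)` of a function `g` of
sequences in the first `n` entries, where `x_i` has degree `deg i`. -/
def symSum (n : ℕ) (g : (ℕ → A) → B) (x : ℕ → A) (deg : ℕ → ℤ) : B :=
  ∑ σ : Equiv.Perm (Fin n), koszulSign σ deg • g (seqPerm σ x)

/-- Graded symmetry of the symmetrization. -/
theorem koszulSign_smul_symSum {n : ℕ} (g : (ℕ → A) → B) (x : ℕ → A) (deg : ℕ → ℤ)
    (σ : Equiv.Perm (Fin n)) :
    koszulSign σ deg • symSum n g (seqPerm σ x) (seqPerm σ deg) = symSum n g x deg := by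
  conv_rhs => rw [symSum, ← Equiv.sum_comp (Equiv.mulLeft σ)]
  rw [symSum, Finset.smul_sum]
  refine Finset.sum_congr rfl fun τ _ => ?_
  rw [Equiv.coe_mulLeft, koszulSign_mul, seqPerm_mul, smul_smul]

theorem seqPerm_update_zero {n : ℕ} (ρ : Equiv.Perm (Fin (n + 1))) (w : ℕ → A) (z : A) :
    seqPerm ρ (Function.update w 0 z) =
      Function.update (seqPerm ρ w) (ρ⁻¹ 0 : Fin (n + 1)) z := by
  funext j
  by_cases hj : j < n + 1
  · by_cases h : (⟨j, hj⟩ : Fin (n + 1)) = ρ⁻¹ 0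
    · have h0 : ρ ⟨j, hj⟩ = 0 := by rw [h]; simp
      have h1 : j = (ρ⁻¹ 0 : Fin (n + 1)) := congrArg Fin.val h
      rw [seqPerm_of_lt _ _ hj, h0, Fin.val_zero, Function.update_self, h1, Function.update_self]
    · have h0 : ((ρ ⟨j, hj⟩ : Fin (n + 1)) : ℕ) ≠ 0 := fun h' => h (by
        rw [Equiv.Perm.eq_inv_iff_eq]; exact Fin.ext h')
      have h1 : j ≠ (ρ⁻¹ 0 : Fin (n + 1)) := fun h' => h (Fin.ext h')
      rw [seqPerm_of_lt _ _ hj, Function.update_of_ne h0, Function.update_of_ne h1,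
        seqPerm_of_lt _ _ hj]
  · have h1 : j ≠ (ρ⁻¹ 0 : Fin (n + 1)) := by have := (ρ⁻¹ 0 : Fin (n + 1)).2; omega
    have h0 : j ≠ 0 := by omega
    rw [Function.update_of_ne h1]
    simp [seqPerm, hj, h0]

/-- The part of the bar differential with one input `δ`: symmetrization turns the sum over the
entries into the sum over the unshuffles of type `(1, n)`. -/
theorem sum_unshuffles_one_symSum {n : ℕ} (g : (ℕ → A) → B) (δ : A → A) (x : ℕ → A)
    (deg : ℕ → ℤ) :
    ∑ σ ∈ unshuffles (n + 1) 1, koszulSign σ deg •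
        symSum (n + 1) g (Function.update (seqPerm σ x) 0 (δ (seqPerm σ x 0)))
          (Function.update (seqPerm σ deg) 0 (seqPerm σ deg 0 + 1)) =
      ∑ τ : Equiv.Perm (Fin (n + 1)), koszulSign τ deg • ∑ i ∈ Finset.range (n + 1),
        (∑ j ∈ Finset.range i, (seqPerm τ deg j - 1)).negOnePow •
          g (Function.update (seqPerm τ x) i (δ (seqPerm τ x i))) := by
  set Φ : Equiv.Perm (Fin (n + 1)) → ℕ → B := fun τ i => koszulSign τ deg •
    (∑ j ∈ Finset.range i, (seqPerm τ deg j - 1)).negOnePow •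
      g (Function.update (seqPerm τ x) i (δ (seqPerm τ x i))) with hΦ
  -- the entry `m` is put first by the unshuffle, and in the position `i = τ⁻¹ m` by `τ`
  have h1 : ∀ m : Fin (n + 1), koszulSign m.cycleRange⁻¹ deg •
      symSum (n + 1) g
        (Function.update (seqPerm m.cycleRange⁻¹ x) 0 (δ (seqPerm m.cycleRange⁻¹ x 0)))
        (Function.update (seqPerm m.cycleRange⁻¹ deg) 0 (seqPerm m.cycleRange⁻¹ deg 0 + 1)) =
      ∑ τ : Equiv.Perm (Fin (n + 1)), Φ τ (τ⁻¹ m : Fin (n + 1)) := by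
    intro m
    rw [← Equiv.sum_comp (Equiv.mulLeft m.cycleRange⁻¹), symSum, Finset.smul_sum]
    refine Finset.sum_congr rfl fun ρ _ => ?_
    have hm : (m.cycleRange⁻¹ * ρ)⁻¹ m = ρ⁻¹ 0 := by
      rw [mul_inv_rev, inv_inv, Equiv.Perm.mul_apply, Fin.cycleRange_self]
    have hz : seqPerm (m.cycleRange⁻¹ * ρ) x (ρ⁻¹ 0 : Fin (n + 1)) =
        seqPerm m.cycleRange⁻¹ x 0 := by
      have h0 : ρ (ρ⁻¹ 0) = 0 := by simp
      rw [seqPerm_mul, seqPerm_coe, h0]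
      rfl
    rw [Equiv.coe_mulLeft, hΦ]
    simp only
    rw [hm, hz, koszulSign_update_zero, koszulSign_mul, seqPerm_update_zero, ← seqPerm_mul,
      ← seqPerm_mul, smul_smul, smul_smul, mul_assoc]
  rw [Equiv.Perm.sum_unshuffles_one, Finset.sum_congr rfl fun m _ => h1 m, Finset.sum_comm]
  refine Finset.sum_congr rfl fun τ _ => ?_
  rw [Equiv.sum_comp τ⁻¹ fun i : Fin (n + 1) => Φ τ i, Fin.sum_univ_eq_sum_range (Φ τ),
    Finset.smul_sum]

section contract

variable {n : ℕ} (ρ : Equiv.Perm (Fin n)) (i : Fin (n + 1))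

/-- The permutation of `{0, …, n + 1}` which moves the entries `0` and `1` to the positions `i` and
`i + 1`, and permutes the other entries as `ρ` does. -/
def Equiv.Perm.insertTwo : Equiv.Perm (Fin (n + 2)) :=
  Equiv.Perm.shift (Equiv.Perm.shift ρ) * (i.succ.cycleRange * i.succ.cycleRange)

theorem seqPerm_insertTwo_self (w : ℕ → A) : seqPerm (ρ.insertTwo i) w i = w 0 := by
  have h : (i.castSucc : Fin (n + 2)) < i.succ := Fin.castSucc_lt_succ
  have h1 : i.succ.cycleRange i.castSucc = i.succ :=
    Fin.ext (by rw [Fin.coe_cycleRange_of_lt h]; simp)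
  have := seqPerm_coe (ρ.insertTwo i) w i.castSucc
  rw [Fin.val_castSucc] at this
  rw [this, Equiv.Perm.insertTwo, Equiv.Perm.mul_apply, Equiv.Perm.mul_apply, h1,
    Fin.cycleRange_self, Equiv.Perm.shift_zero]
  rfl

theorem seqPerm_insertTwo_succ (w : ℕ → A) : seqPerm (ρ.insertTwo i) w (i + 1) = w 1 := by
  have h1 : i.succ.cycleRange 0 = 1 :=
    Fin.ext (by rw [Fin.coe_cycleRange_of_lt (Fin.succ_pos i)]; simp)
  have := seqPerm_coe (ρ.insertTwo i) w i.succ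
  rw [Fin.val_succ] at this
  have h2 : (1 : Fin (n + 2)) = Fin.succ 0 := rfl
  rw [this, Equiv.Perm.insertTwo, Equiv.Perm.mul_apply, Equiv.Perm.mul_apply, Fin.cycleRange_self,
    h1, h2, Equiv.Perm.shift_succ, Equiv.Perm.shift_zero]
  rfl

theorem seqPerm_insertTwo_of_lt (w : ℕ → A) {j : Fin n} (h : (j : ℕ) < i) :
    seqPerm (ρ.insertTwo i) w j = w (ρ j + 2) := by
  have hj : (j.castSucc.castSucc : Fin (n + 2)) < i.succ := by
    rw [Fin.lt_def]; simp; omega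
  have h1 : i.succ.cycleRange j.castSucc.castSucc = j.succ.castSucc :=
    Fin.ext (by rw [Fin.coe_cycleRange_of_lt hj]; simp)
  have hj' : (j.succ.castSucc : Fin (n + 2)) < i.succ := by
    rw [Fin.lt_def]; simp; omega
  have h2 : i.succ.cycleRange j.succ.castSucc = j.succ.succ :=
    Fin.ext (by rw [Fin.coe_cycleRange_of_lt hj']; simp)
  have := seqPerm_coe (ρ.insertTwo i) w j.castSucc.castSucc
  rw [Fin.val_castSucc, Fin.val_castSucc] at this
  rw [this, Equiv.Perm.insertTwo, Equiv.Perm.mul_apply, Equiv.Perm.mul_apply, h1, h2,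
    Equiv.Perm.shift_succ, Equiv.Perm.shift_succ]
  rfl

theorem seqPerm_insertTwo_of_ge (w : ℕ → A) {j : Fin n} (h : (i : ℕ) ≤ j) :
    seqPerm (ρ.insertTwo i) w (j + 2) = w (ρ j + 2) := by
  have hj : i.succ < j.succ.succ := by
    rw [Fin.lt_def]; simp; omega
  have := seqPerm_coe (ρ.insertTwo i) w j.succ.succ
  rw [Fin.val_succ, Fin.val_succ] at this
  rw [this, Equiv.Perm.insertTwo, Equiv.Perm.mul_apply, Equiv.Perm.mul_apply,
    Fin.cycleRange_of_gt hj, Fin.cycleRange_of_gt hj, Equiv.Perm.shift_succ,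
    Equiv.Perm.shift_succ]
  rfl

/-- Permuting the entries after the contraction of the first two of them to `z` contracts the
entries `i` and `i + 1` of the sequence permuted by `insertTwo`, if `z` is put in the position `i`. -/
theorem seqPerm_seqContract (w : ℕ → A) (z : A) {j : ℕ} (hj : j < n + 1) :
    seqPerm (Equiv.Perm.shift ρ * i.cycleRange) (seqContract w 0 z) j =
      seqContract (seqPerm (ρ.insertTwo i) w) i z j := by
  have hpos : ∀ k : ℕ, seqContract w 0 z (k + 1) = w (k + 2) := fun k =>
    seqContract_of_gt w z (Nat.succ_pos k)
  rw [seqPerm_of_lt _ _ hj, Equiv.Perm.mul_apply]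
  rcases lt_trichotomy j (i : ℕ) with h | h | h
  · have hj' : j < n := by have := i.2; omega
    have h1 : i.cycleRange ⟨j, hj⟩ = Fin.succ ⟨j, hj'⟩ :=
      Fin.ext (by rw [Fin.coe_cycleRange_of_lt (by rwa [Fin.lt_def])]; simp)
    rw [seqContract_of_lt _ _ h, h1, Equiv.Perm.shift_succ, Fin.val_succ, hpos]
    exact (seqPerm_insertTwo_of_lt ρ i w (j := ⟨j, hj'⟩) h).symm
  · have h1 : (⟨j, hj⟩ : Fin (n + 1)) = i := Fin.ext h
    rw [h1, Fin.cycleRange_self, Equiv.Perm.shift_zero, h, seqContract_self, Fin.val_zero,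
      seqContract_self]
  · obtain ⟨j, rfl⟩ : ∃ k, j = k + 1 := ⟨j - 1, by omega⟩
    have hj' : j < n := by omega
    rw [Fin.cycleRange_of_gt (by rwa [Fin.lt_def]), seqContract_of_gt _ _ h]
    have h1 : (⟨j + 1, hj⟩ : Fin (n + 1)) = Fin.succ ⟨j, hj'⟩ := rfl
    rw [h1, Equiv.Perm.shift_succ, Fin.val_succ, hpos]
    exact (seqPerm_insertTwo_of_ge ρ i w (j := ⟨j, hj'⟩) (by simpa using Nat.lt_succ_iff.1 h)).symm

/-- The bar differential multiplies two neighbours, of total degree `deg 0 + deg 1` in `A`, which is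
one more than the degree of their tensor product in `A[1] ⊗ A[1]`; hence the sign of moving an
element of degree `1` across the first `i` entries. -/
theorem koszulSign_seqContract (deg : ℕ → ℤ) :
    koszulSign (Equiv.Perm.shift ρ * i.cycleRange) (seqContract deg 0 (deg 0 + deg 1)) =
      koszulSign (ρ.insertTwo i) deg *
        (∑ j ∈ Finset.range i, (seqPerm (ρ.insertTwo i) deg j - 1)).negOnePow := by
  set c := seqContract deg 0 (deg 0 + deg 1) with hc
  have hpos : ∀ k : ℕ, c (k + 1) = deg (k + 2) := fun k => seqContract_of_gt deg _ (Nat.succ_pos k)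
  have h0 : c 0 = deg 0 + deg 1 := seqContract_self _ _ _
  have hlt : ∀ j ∈ Finset.range (i : ℕ), j < n := fun j hj => by
    rw [Finset.mem_range] at hj
    have := i.2
    omega
  have e1 : ∑ j ∈ Finset.range i, (seqPerm (Equiv.Perm.shift ρ) c (j + 1) - 1) =
      ∑ j ∈ Finset.range i, (seqPerm (ρ.insertTwo i) deg j - 1) := by
    refine Finset.sum_congr rfl fun j hj => ?_
    have h1 := seqPerm_coe (Equiv.Perm.shift ρ) c (Fin.succ ⟨j, hlt j hj⟩)
    rw [Equiv.Perm.shift_succ, Fin.val_succ, Fin.val_succ, hpos] at h1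
    rw [h1, ← seqPerm_insertTwo_of_lt ρ i deg (j := ⟨j, hlt j hj⟩) (Finset.mem_range.1 hj)]
  have e2 : ∑ j ∈ Finset.range i,
        (seqPerm (Equiv.Perm.shift (Equiv.Perm.shift ρ)) deg (j + 2) - 1) =
      ∑ j ∈ Finset.range i, (seqPerm (ρ.insertTwo i) deg j - 1) := by
    refine Finset.sum_congr rfl fun j hj => ?_
    have h1 := seqPerm_coe (Equiv.Perm.shift (Equiv.Perm.shift ρ)) deg
      (Fin.succ (Fin.succ ⟨j, hlt j hj⟩))
    rw [Equiv.Perm.shift_succ, Equiv.Perm.shift_succ, Fin.val_succ, Fin.val_succ, Fin.val_succ,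
      Fin.val_succ] at h1
    rw [h1, ← seqPerm_insertTwo_of_lt ρ i deg (j := ⟨j, hlt j hj⟩) (Finset.mem_range.1 hj)]
  have e3 : seqPerm (Equiv.Perm.shift ρ) c 0 = deg 0 + deg 1 := by
    have := seqPerm_coe (Equiv.Perm.shift ρ) c 0
    rwa [Equiv.Perm.shift_zero, Fin.val_zero, h0] at this
  have e4 : seqPerm (Equiv.Perm.shift (Equiv.Perm.shift ρ)) deg 0 = deg 0 := by
    have := seqPerm_coe (Equiv.Perm.shift (Equiv.Perm.shift ρ)) deg 0
    rwa [Equiv.Perm.shift_zero, Fin.val_zero] at this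
  have e5 : seqPerm (Equiv.Perm.shift (Equiv.Perm.shift ρ)) deg 1 = deg 1 := by
    have := seqPerm_coe (Equiv.Perm.shift (Equiv.Perm.shift ρ)) deg (Fin.succ 0)
    rwa [Equiv.Perm.shift_succ, Equiv.Perm.shift_zero] at this
  rw [Equiv.Perm.insertTwo, koszulSign_mul, koszulSign_mul, koszulSign_cycleRange,
    koszulSign_cycleRange_sq, ← Equiv.Perm.insertTwo, koszulSign_shift, koszulSign_shift,
    koszulSign_shift, e1, e2, e3, e4, e5, mul_assoc, ← Int.negOnePow_add]
  simp only [hpos]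
  congr 2
  ring

end contract

/-- The part of the bar differential with two inputs `μ`: symmetrization turns the sum over the
pairs of neighbours into the sum over the ordered pairs of distinct entries. -/
theorem sum_sum_symSum_seqContract {n : ℕ} {g : (ℕ → A) → B}
    (hg : ∀ x y : ℕ → A, (∀ j < n + 1, x j = y j) → g x = g y) (μ : A → A → A) (x : ℕ → A)
    (deg : ℕ → ℤ) {Q : Equiv.Perm (Fin (n + 2)) → B}
    (hQ : ∀ σ, Q σ = koszulSign σ deg • symSum (n + 1) g
      (seqContract (seqPerm σ x) 0 (μ (seqPerm σ x 0) (seqPerm σ x 1)))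
      (seqContract (seqPerm σ deg) 0 (seqPerm σ deg 0 + seqPerm σ deg 1))) :
    ∑ a : Fin (n + 2), ∑ b : Fin (n + 1),
        Q (a.cycleRange⁻¹ * Equiv.Perm.shift b.cycleRange⁻¹) =
      ∑ τ : Equiv.Perm (Fin (n + 2)), koszulSign τ deg • ∑ i ∈ Finset.range (n + 1),
        (∑ j ∈ Finset.range i, (seqPerm τ deg j - 1)).negOnePow •
          g (seqContract (seqPerm τ x) i (μ (seqPerm τ x i) (seqPerm τ x (i + 1)))) := by
  set Φ : Equiv.Perm (Fin (n + 2)) → ℕ → B := fun τ i => koszulSign τ deg •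
    (∑ j ∈ Finset.range i, (seqPerm τ deg j - 1)).negOnePow •
      g (seqContract (seqPerm τ x) i (μ (seqPerm τ x i) (seqPerm τ x (i + 1)))) with hΦ
  have h1 : ∀ σ, Q σ = ∑ i : Fin (n + 1), ∑ ρ : Equiv.Perm (Fin n),
      Φ (σ * ρ.insertTwo i) i := by
    intro σ
    rw [hQ, symSum, Equiv.Perm.sum_eq_sum_mul_cycleRange, Finset.smul_sum]
    refine Finset.sum_congr rfl fun i _ => ?_
    rw [Finset.smul_sum]
    refine Finset.sum_congr rfl fun ρ _ => ?_
    rw [koszulSign_seqContract, hg _ _ fun j hj => seqPerm_seqContract ρ i _ _ hj, hΦ]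
    simp only
    rw [koszulSign_mul, seqPerm_mul, seqPerm_mul, seqPerm_insertTwo_self, seqPerm_insertTwo_succ,
      smul_smul, smul_smul, mul_assoc]
  have h2 : ∀ i : Fin (n + 1), ∑ a : Fin (n + 2), ∑ b : Fin (n + 1), ∑ ρ : Equiv.Perm (Fin n),
      Φ (a.cycleRange⁻¹ * Equiv.Perm.shift b.cycleRange⁻¹ * ρ.insertTwo i) i = ∑ τ, Φ τ i := by
    intro i
    rw [← Equiv.sum_comp (Equiv.mulRight (i.succ.cycleRange * i.succ.cycleRange))
      fun τ => Φ τ i, Equiv.Perm.sum_eq_sum_cycleRange_mul]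
    refine Finset.sum_congr rfl fun a _ => ?_
    rw [Equiv.Perm.sum_eq_sum_cycleRange_mul]
    refine Finset.sum_congr rfl fun b _ => Finset.sum_congr rfl fun ρ _ => ?_
    rw [Equiv.coe_mulRight, Equiv.Perm.shift_mul, Equiv.Perm.insertTwo]
    simp only [mul_assoc]
  simp only [h1]
  have h3 : ∀ a : Fin (n + 2), ∑ b : Fin (n + 1), ∑ i : Fin (n + 1), ∑ ρ : Equiv.Perm (Fin n),
      Φ (a.cycleRange⁻¹ * Equiv.Perm.shift b.cycleRange⁻¹ * ρ.insertTwo i) i =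
      ∑ i : Fin (n + 1), ∑ b : Fin (n + 1), ∑ ρ : Equiv.Perm (Fin n),
      Φ (a.cycleRange⁻¹ * Equiv.Perm.shift b.cycleRange⁻¹ * ρ.insertTwo i) i :=
    fun a => Finset.sum_comm
  rw [Finset.sum_congr rfl fun a _ => h3 a, Finset.sum_comm,
    Finset.sum_congr rfl fun i _ => h2 i, Finset.sum_comm]
  refine Finset.sum_congr rfl fun τ _ => ?_
  rw [Fin.sum_univ_eq_sum_range (Φ τ), Finset.smul_sum]

end symmetrization

/-! ### Symmetrization of `A_∞`-morphisms -/

section symmetrize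

variable {K A B : Type*} [Field K] [AddCommGroup A] [Module K A] [AddCommGroup B] [Module K B]

namespace DGSpace

/-- The projection onto the sum of the components of odd degree if `b` is true, and of even degree
otherwise. -/
noncomputable def parityProj (D : DGSpace K A) (b : Bool) : A →ₗ[K] A :=
  D.lift fun j => if Odd j ↔ b = true then (D.gr j).subtype else 0

theorem parityProj_of_mem (D : DGSpace K A) (b : Bool) {i : ℤ} {a : A} (ha : a ∈ D.gr i) :
    D.parityProj b a = if Odd i ↔ b = true then a else 0 := by
  rw [parityProj, D.lift_of_mem _ ha]
  split_ifs <;> rfl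

/-- Degrees with the parities `par`: `1` for the odd entries and `0` for the even ones. -/
def parityDeg {n : ℕ} (par : Fin n → Bool) : ℕ → ℤ := fun j =>
  if h : j < n then (if par ⟨j, h⟩ then 1 else 0) else 0

/-- The graded symmetrization `x ↦ ∑_σ ε(σ) f(x_{σ 0}, …, x_{σ (n-1)})` of a multilinear map. The
Koszul signs depend on the parities of the entries only, so the map is defined for all `x` by
decomposing the entries into their odd and even parts. -/
noncomputable def symmetrize (D : DGSpace K A) {n : ℕ}
    (f : MultilinearMap K (fun _ : Fin n => A) B) : MultilinearMap K (fun _ : Fin n => A) B :=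
  ∑ par : Fin n → Bool, ∑ σ : Equiv.Perm (Fin n), koszulSign σ (parityDeg par) •
    (MultilinearMap.domDomCongr σ f).compLinearMap fun i => D.parityProj (par i)

theorem symmetrize_apply (D : DGSpace K A) {n : ℕ} (f : MultilinearMap K (fun _ : Fin n => A) B)
    {x : Fin n → A} {deg : ℕ → ℤ} (hx : ∀ i : Fin n, x i ∈ D.gr (deg i)) :
    D.symmetrize f x = ∑ σ : Equiv.Perm (Fin n), koszulSign σ deg • f fun i => x (σ i) := by
  classical
  rw [symmetrize, sum_apply,
    Finset.sum_eq_single fun i : Fin n => decide (Odd (deg i))]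
  -- only the summand with the parities of the entries of `x` is nonzero
  · rw [sum_apply]
    refine Finset.sum_congr rfl fun σ _ => ?_
    have h1 : koszulSign σ (parityDeg fun i : Fin n => decide (Odd (deg i))) =
        koszulSign σ deg := by
      refine koszulSign_congr σ fun j hj => ?_
      by_cases h : Odd (deg j)
      · simp [parityDeg, hj, h, Int.negOnePow_odd]
      · rw [Int.negOnePow_even _ (Int.not_odd_iff_even.1 h)]
        simp [parityDeg, hj, h]
    have h2 : ∀ i : Fin n, D.parityProj (decide (Odd (deg i))) (x i) = x i := fun i => by
      rw [D.parityProj_of_mem _ (hx i), if_pos (by simp)]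
    rw [h1, smul_apply, MultilinearMap.compLinearMap_apply,
      MultilinearMap.domDomCongr_apply]
    simp only [h2]
  · intro par _ hpar
    obtain ⟨i, hi⟩ := Function.ne_iff.1 hpar
    have h0 : D.parityProj (par i) (x i) = 0 := by
      rw [D.parityProj_of_mem _ (hx i), if_neg]
      intro h
      refine hi ?_
      rw [Bool.eq_iff_iff, decide_eq_true_iff, h]
    rw [sum_apply]
    refine Finset.sum_eq_zero fun σ _ => ?_
    rw [smul_apply, MultilinearMap.compLinearMap_apply,
      MultilinearMap.map_coord_zero _ i h0, smul_zero]
  · intro h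
    exact absurd (Finset.mem_univ _) h

theorem symmetrize_onSeq (D : DGSpace K A) {n : ℕ} (f : MultilinearMap K (fun _ : Fin n => A) B)
    {x : ℕ → A} {deg : ℕ → ℤ} (hx : ∀ i, x i ∈ D.gr (deg i)) :
    (D.symmetrize f).onSeq x = symSum n f.onSeq x deg := by
  rw [MultilinearMap.onSeq, D.symmetrize_apply f fun i => hx i, symSum]
  refine Finset.sum_congr rfl fun σ _ => ?_
  simp only [MultilinearMap.onSeq, seqPerm_coe]

theorem symmetrize_zero (D : DGSpace K A) {n : ℕ} :
    D.symmetrize (0 : MultilinearMap K (fun _ : Fin n => A) B) = 0 := by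
  ext x
  simp [symmetrize]

end DGSpace

theorem DGAlg.barMul_of_mem (𝒜 : DGAlg K A) {i : ℤ} {a : A} (ha : a ∈ 𝒜.gr i) (b : A) :
    𝒜.barMul a b = i.negOnePow • 𝒜.mul a b := by
  change 𝒜.mul (𝒜.sgn a) b = _
  rw [𝒜.sgn_of_mem ha]
  exact map_sign (𝒜.mul.flip b) _ _

theorem DGAlg.barMul_mem (𝒜 : DGAlg K A) {i j : ℤ} {a b : A} (ha : a ∈ 𝒜.gr i)
    (hb : b ∈ 𝒜.gr j) : 𝒜.barMul a b ∈ 𝒜.gr (i + j) := by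
  rw [𝒜.barMul_of_mem ha, Units.smul_def]
  exact zsmul_mem (𝒜.mul_mem ha hb) _

/-- On the bar construction the commutator is the graded symmetrization of the product. -/
theorem DGAlg.barMul_commutator (𝒜 : DGAlg K A) {i j : ℤ} {a b : A} (ha : a ∈ 𝒜.gr i)
    (hb : b ∈ 𝒜.gr j) : 𝒜.commutator.barMul a b =
      𝒜.barMul a b + ((i - 1) * (j - 1)).negOnePow • 𝒜.barMul b a := by
  rw [𝒜.commutator.barMul_of_mem (show a ∈ 𝒜.commutator.gr i from ha), 𝒜.barMul_of_mem ha,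
    𝒜.barMul_of_mem hb, 𝒜.commutator_of_mem ha hb, smul_sub, smul_smul, smul_smul,
    ← Int.negOnePow_add, ← Int.negOnePow_add, sub_eq_add_neg]
  congr 1
  have h : (i - 1) * (j - 1) + j = i + i * j + 1 - 2 * i := by ring
  rw [h, Int.negOnePow_sub, Int.negOnePow_two_mul, Int.negOnePow_succ]
  simp

theorem koszulSign_swap {n : ℕ} (deg : ℕ → ℤ) :
    koszulSign (Equiv.swap 0 1 : Equiv.Perm (Fin (n + 2))) deg =
      ((deg 0 - 1) * (deg 1 - 1)).negOnePow := by
  have h : (Equiv.swap 0 1 : Equiv.Perm (Fin (n + 2))) = Fin.cycleRange 1 := by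
    refine Equiv.ext fun j => ?_
    induction j using Fin.cases with
    | zero =>
      rw [Equiv.swap_apply_left]
      exact Fin.ext (by rw [Fin.coe_cycleRange_of_lt (by simp)]; simp)
    | succ j =>
      induction j using Fin.cases with
      | zero => rw [Fin.succ_zero_eq_one, Equiv.swap_apply_right, Fin.cycleRange_self]
      | succ j =>
        have h0 : j.succ.succ ≠ 0 := Fin.succ_ne_zero _
        have h1 : (1 : Fin (n + 2)) < j.succ.succ := by
          rw [Fin.lt_def]; simp
        rw [Equiv.swap_apply_of_ne_of_ne h0 h1.ne', Fin.cycleRange_of_gt h1]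
  rw [h, koszulSign_cycleRange]
  simp

theorem seqPerm_swap_zero {A : Type*} {n : ℕ} (w : ℕ → A) :
    seqPerm (Equiv.swap 0 1 : Equiv.Perm (Fin (n + 2))) w 0 = w 1 := by
  have := seqPerm_coe (Equiv.swap 0 1 : Equiv.Perm (Fin (n + 2))) w 0
  rwa [Equiv.swap_apply_left] at this

theorem seqPerm_swap_one {A : Type*} {n : ℕ} (w : ℕ → A) :
    seqPerm (Equiv.swap 0 1 : Equiv.Perm (Fin (n + 2))) w 1 = w 0 := by
  have := seqPerm_coe (Equiv.swap 0 1 : Equiv.Perm (Fin (n + 2))) w 1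
  rwa [Equiv.swap_apply_right] at this

theorem seqContract_seqPerm_swap {A : Type*} {n : ℕ} (w : ℕ → A) (z : A) :
    seqContract (seqPerm (Equiv.swap 0 1 : Equiv.Perm (Fin (n + 2))) w) 0 z =
      seqContract w 0 z := by
  funext j
  rcases Nat.eq_zero_or_pos j with rfl | hj
  · rw [seqContract_self, seqContract_self]
  · rw [seqContract_of_gt _ _ hj, seqContract_of_gt _ _ hj]
    by_cases h : j + 1 < n + 2
    · rw [seqPerm_of_lt _ _ h, Equiv.swap_apply_of_ne_of_ne]
      · exact fun h' => by simpa using congrArg Fin.val h'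
      · intro h'
        have := congrArg Fin.val h'
        simp at this
        omega
    · simp [seqPerm, h]

namespace AInfMorphism

variable {L : Type*} [AddCommGroup L] [Module K L] {𝒜 : DGAlg K A} [𝒜.IsAssoc] {E : DGSpace K B}

/-- The structure equations of an `A_∞`-morphism to an algebra with trivial product, summed over
all orders of the entries with Koszul signs, are those of an `L_∞`-morphism on the commutator
Lie algebra. -/
theorem symmetrize_rel (f : AInfMorphism 𝒜 (DGAlg.trivial E)) (n : ℕ) {x : ℕ → A} {deg : ℕ → ℤ}
    (hx : ∀ i, x i ∈ 𝒜.gr (deg i)) :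
    (∑ σ ∈ unshuffles n 1, koszulSign σ deg • (𝒜.symmetrize (f.toFun n)).onSeq
        (Function.update (seqPerm σ x) 0 (𝒜.barD (seqPerm σ x 0)))) +
      (∑ σ ∈ unshuffles n 2, koszulSign σ deg • (𝒜.symmetrize (f.toFun (n - 1))).onSeq
        (seqContract (seqPerm σ x) 0
          (𝒜.commutator.barMul (seqPerm σ x 0) (seqPerm σ x 1)))) =
    -E.d ((𝒜.symmetrize (f.toFun n)).onSeq x) := by
  have hzero : ∀ y : ℕ → A, (𝒜.symmetrize (f.toFun 0)).onSeq y = 0 := fun y => by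
    rw [f.zero, DGSpace.symmetrize_zero]; rfl
  have hσ : ∀ σ : Equiv.Perm (Fin n), ∀ i, seqPerm σ x i ∈ 𝒜.gr (seqPerm σ deg i) := fun σ =>
    seqPerm_rel (P := fun a i => a ∈ 𝒜.gr i) σ hx
  rcases n with _ | n
  · simp [hzero]
  have T1 : ∑ σ ∈ unshuffles (n + 1) 1, koszulSign σ deg •
        (𝒜.symmetrize (f.toFun (n + 1))).onSeq
          (Function.update (seqPerm σ x) 0 (𝒜.barD (seqPerm σ x 0))) =
      ∑ τ : Equiv.Perm (Fin (n + 1)), koszulSign τ deg • ∑ i ∈ Finset.range (n + 1),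
        (∑ j ∈ Finset.range i, (seqPerm τ deg j - 1)).negOnePow •
          (f.toFun (n + 1)).onSeq
            (Function.update (seqPerm τ x) i (𝒜.barD (seqPerm τ x i))) := by
    rw [← sum_unshuffles_one_symSum]
    refine Finset.sum_congr rfl fun σ _ => ?_
    rw [DGSpace.symmetrize_onSeq]
    intro i
    rcases eq_or_ne i 0 with rfl | hi
    · rw [Function.update_self, Function.update_self]
      exact neg_mem (𝒜.d_mem (hσ σ 0))
    · rw [Function.update_of_ne hi, Function.update_of_ne hi]
      exact hσ σ i
  have T2 : ∑ σ ∈ unshuffles (n + 1) 2, koszulSign σ deg • (𝒜.symmetrize (f.toFun n)).onSeq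
        (seqContract (seqPerm σ x) 0
          (𝒜.commutator.barMul (seqPerm σ x 0) (seqPerm σ x 1))) =
      ∑ τ : Equiv.Perm (Fin (n + 1)), koszulSign τ deg • ∑ i ∈ Finset.range n,
        (∑ j ∈ Finset.range i, (seqPerm τ deg j - 1)).negOnePow • (f.toFun n).onSeq
          (seqContract (seqPerm τ x) i (𝒜.barMul (seqPerm τ x i) (seqPerm τ x (i + 1)))) := by
    rcases n with _ | n
    · simp [hzero]
    set Q : Equiv.Perm (Fin (n + 2)) → B := fun σ => koszulSign σ deg •
      symSum (n + 1) (f.toFun (n + 1)).onSeq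
        (seqContract (seqPerm σ x) 0 (𝒜.barMul (seqPerm σ x 0) (seqPerm σ x 1)))
        (seqContract (seqPerm σ deg) 0 (seqPerm σ deg 0 + seqPerm σ deg 1)) with hQ
    refine Eq.trans ?_ (sum_sum_symSum_seqContract (g := (f.toFun (n + 1)).onSeq) (Q := Q)
      (fun _ _ h => MultilinearMap.onSeq_congr _ h) (fun a b => 𝒜.barMul a b) x deg fun _ => rfl)
    rw [← Equiv.Perm.sum_unshuffles_two]
    refine Finset.sum_congr rfl fun σ _ => ?_
    have hc : ∀ {z : A}, z ∈ 𝒜.gr (seqPerm σ deg 0 + seqPerm σ deg 1) →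
        (𝒜.symmetrize (f.toFun (n + 1))).onSeq (seqContract (seqPerm σ x) 0 z) =
        symSum (n + 1) (f.toFun (n + 1)).onSeq (seqContract (seqPerm σ x) 0 z)
          (seqContract (seqPerm σ deg) 0 (seqPerm σ deg 0 + seqPerm σ deg 1)) := by
      intro z hz
      refine DGSpace.symmetrize_onSeq _ _ fun i => ?_
      rcases Nat.eq_zero_or_pos i with rfl | hi
      · rw [seqContract_self, seqContract_self]; exact hz
      · rw [seqContract_of_gt _ _ hi, seqContract_of_gt _ _ hi]; exact hσ σ _
    have hlin : ∀ z z' : A, ∀ u : ℤˣ, (𝒜.symmetrize (f.toFun (n + 1))).onSeq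
          (seqContract (seqPerm σ x) 0 (z + u • z')) =
        (𝒜.symmetrize (f.toFun (n + 1))).onSeq (seqContract (seqPerm σ x) 0 z) +
          u • (𝒜.symmetrize (f.toFun (n + 1))).onSeq (seqContract (seqPerm σ x) 0 z') := by
      intro z z' u
      have h0 := seqContract_eq_update (seqPerm σ x) 0 (z := 0)
      rw [h0 (z + u • z'), h0 z, h0 z', MultilinearMap.onSeq_update _ _ n.succ_pos,
        MultilinearMap.onSeq_update _ _ n.succ_pos,
        MultilinearMap.onSeq_update _ _ n.succ_pos, map_add, map_sign]
    have hz' : 𝒜.barMul (seqPerm σ x 1) (seqPerm σ x 0) ∈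
        𝒜.gr (seqPerm σ deg 0 + seqPerm σ deg 1) := by
      rw [add_comm]; exact 𝒜.barMul_mem (hσ σ 1) (hσ σ 0)
    rw [𝒜.barMul_commutator (hσ σ 0) (hσ σ 1), hlin, hc (𝒜.barMul_mem (hσ σ 0) (hσ σ 1)), hc hz',
      smul_add, smul_smul, hQ]
    simp only
    rw [koszulSign_mul, koszulSign_swap, seqPerm_mul, seqPerm_mul, seqPerm_swap_zero,
      seqPerm_swap_one, seqPerm_swap_zero, seqPerm_swap_one, seqContract_seqPerm_swap,
      seqContract_seqPerm_swap, add_comm (seqPerm σ deg 1)]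
  rw [T1, Nat.add_sub_cancel, T2, ← Finset.sum_add_distrib, DGSpace.symmetrize_onSeq _ _ hx, symSum,
    map_sum, ← Finset.sum_neg_distrib]
  refine Finset.sum_congr rfl fun τ _ => ?_
  have h := f.rel (n + 1) (seqPerm τ x) (seqPerm τ deg) (hσ τ)
  -- the product of the target is zero
  have hμ : ∀ a b, (DGAlg.trivial E).barMul a b = 0 := fun _ _ => rfl
  simp only [hμ, Finset.sum_const_zero, add_zero, Nat.add_sub_cancel] at h
  rw [← smul_add, map_sign, ← smul_neg]
  exact congrArg (koszulSign τ deg • ·) h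

/-- The `L_∞`-morphism obtained from an `A_∞`-morphism `f` to a complex with trivial product by
graded symmetrization, on a DG-Lie algebra which is mapped to the commutator Lie algebra by `e`. -/
noncomputable def symmetrize (f : AInfMorphism 𝒜 (DGAlg.trivial E)) {ℒ : DGAlg K L} [ℒ.IsLie]
    {e : L →ₗ[K] A} (he : ℒ.IsHom 𝒜.commutator e) : LInfMorphism ℒ (DGAlg.trivial E) where
  toFun n := (𝒜.symmetrize (f.toFun n)).compLinearMap fun _ => e
  zero := by
    rw [f.zero, DGSpace.symmetrize_zero]; rfl
  map_mem n x deg hx := by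
    obtain ⟨deg, rfl⟩ := exists_seq deg
    rw [MultilinearMap.compLinearMap_apply,
      𝒜.symmetrize_apply _ fun i => show e (x i) ∈ 𝒜.gr (deg i) from he.map_mem (hx i)]
    refine sum_mem fun σ _ => ?_
    rw [Units.smul_def]
    refine zsmul_mem ?_ _
    have h := f.map_mem n (fun i => e (x (σ i))) (fun i => deg (σ i)) fun i => he.map_mem (hx (σ i))
    rwa [Equiv.sum_comp σ fun i : Fin n => deg i - 1] at h
  symm n x deg hx σ := by
    have hx' : ∀ i, e (x i) ∈ 𝒜.gr (deg i) := fun i => he.map_mem (hx i)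
    have h1 := DGSpace.symmetrize_onSeq 𝒜.toDGSpace (f.toFun n) hx'
    have h2 := DGSpace.symmetrize_onSeq 𝒜.toDGSpace (f.toFun n)
      (seqPerm_rel (P := fun a i => a ∈ 𝒜.gr i) σ hx')
    rw [← koszulSign_smul_symSum _ _ _ σ, ← h2, ← comp_seqPerm] at h1
    exact h1.symm
  rel n x deg hx := by
    have hx' : ∀ i, e (x i) ∈ 𝒜.gr (deg i) := fun i => he.map_mem (hx i)
    have h := f.symmetrize_rel n hx'
    -- the product of the target is zero
    have hμ : ∀ a b, (DGAlg.trivial E).barMul a b = 0 := fun _ _ => rfl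
    simp only [hμ, smul_zero, Finset.sum_const_zero, add_zero]
    refine Eq.trans ?_ h
    have h0 : ∀ (σ : Equiv.Perm (Fin n)) (i : ℕ),
        e (seqPerm σ x i) = seqPerm σ (fun j => e (x j)) i := fun σ i =>
      congrFun (comp_seqPerm e σ x) i
    congr 1
    · refine Finset.sum_congr rfl fun σ _ => ?_
      congr 1
      refine congrArg (𝒜.symmetrize (f.toFun n)).onSeq
        (Eq.trans (comp_update e (seqPerm σ x) 0 _) ?_)
      have h1 : e (ℒ.barD (seqPerm σ x 0)) = 𝒜.barD (e (seqPerm σ x 0)) := by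
        change e (-ℒ.d _) = -𝒜.d _
        rw [map_neg, he.map_d]
        rfl
      rw [h1, h0, comp_seqPerm]
    · refine Finset.sum_congr rfl fun σ _ => ?_
      congr 1
      refine congrArg (𝒜.symmetrize (f.toFun (n - 1))).onSeq
        (Eq.trans (comp_seqContract e (seqPerm σ x) 0 _) ?_)
      have h1 : ∀ a b, e (ℒ.barMul a b) = 𝒜.commutator.barMul (e a) (e b) := by
        intro a b
        change e (ℒ.mul (ℒ.sgn a) b) = 𝒜.commutator.mul (𝒜.commutator.sgn (e a)) (e b)
        rw [he.map_mul, he.toIsHom.map_sgn]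
      rw [h1, h0, h0, comp_seqPerm]

theorem symmetrize_onSeq (f : AInfMorphism 𝒜 (DGAlg.trivial E)) {ℒ : DGAlg K L} [ℒ.IsLie]
    {e : L →ₗ[K] A} (he : ℒ.IsHom 𝒜.commutator e) (n : ℕ) {x : ℕ → L} {deg : ℕ → ℤ}
    (hx : ∀ i, x i ∈ ℒ.gr (deg i)) :
    ((f.symmetrize he).toFun n).onSeq x = ∑ σ : Equiv.Perm (Fin n), koszulSign σ deg •
      (f.toFun n).onSeq (seqPerm σ fun i => e (x i)) :=
  DGSpace.symmetrize_onSeq 𝒜.toDGSpace (f.toFun n) (deg := deg) fun i => he.map_mem (hx i)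

theorem symmetrize_linear (f : AInfMorphism 𝒜 (DGAlg.trivial E)) {ℒ : DGAlg K L} [ℒ.IsLie]
    {e : L →ₗ[K] A} (he : ℒ.IsHom 𝒜.commutator e) (x : L) :
    (f.symmetrize he).linear x = f.linear (e x) := by
  refine ℒ.induct (P := fun x => (f.symmetrize he).linear x = f.linear (e x)) x ?_ (by simp) ?_
  · intro i x hx
    have h := f.symmetrize_onSeq he 1 (x := fun _ => x) (deg := fun _ => i) fun _ => hx
    have h1 : (1 : Equiv.Perm (Fin 1)) = default := Subsingleton.elim _ _
    rw [Fintype.sum_unique, ← h1, koszulSign_one, one_smul] at h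
    refine h.trans (congrArg (f.toFun 1) (funext fun j => ?_))
    rw [seqPerm_coe]
  · intro v w hv hw
    rw [map_add, map_add, map_add, hv, hw]

end AInfMorphism

end symmetrize

/-! ### The `L_∞` quasi-isomorphism -/

namespace DGSpace

theorem integralAInf_symmetrize_isQuasiIso {K V : Type*} [Field K] [CharZero K] [AddCommGroup V]
    [Module K V] (D : DGSpace K V) (F : Submodule K V) (hF : D.IsSubspace F) :
    ((D.integralAInf F hF).symmetrize (D.doubleFibreEquiv_isHom F hF)).IsQuasiIso := by
  set e := D.doubleFibreEquiv F hF with he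
  have hlin : ((D.integralAInf F hF).symmetrize (D.doubleFibreEquiv_isHom F hF)).linear =
      (D.integralAInf F hF).linear ∘ₗ e.toLinearMap :=
    LinearMap.ext fun x => AInfMorphism.symmetrize_linear _ _ x
  have hd : ∀ x, e ((D.jacobianSquare F hF).twAlg.d x) = (D.twAssoc F hF).d (e x) :=
    (D.doubleFibreEquiv_isHom F hF).map_d
  rw [LInfMorphism.IsQuasiIso, hlin]
  refine IsHom.isQuasiIso ?_ (fun w hw => ?_) fun x hx hu => ?_
  · have hf := (D.integralAInf F hF).linear_isHom
    exact ⟨fun hx => hf.map_mem ((D.doubleFibreEquiv_isHom F hF).map_mem hx),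
      fun x => (congrArg _ (hd x)).trans (hf.map_d (e x))⟩
  · obtain ⟨ω, hω, h⟩ := D.exists_integralAInf_linear_eq F hF hw
    refine ⟨e.symm ω, e.injective ?_, 0, ?_⟩
    · rw [hd, e.apply_symm_apply, hω, map_zero]
    · rw [map_zero, LinearMap.comp_apply, LinearEquiv.coe_coe, e.apply_symm_apply, h, sub_self]
  · obtain ⟨u, hu⟩ := hu
    have hx' : (D.twAssoc F hF).d (e x) = 0 := by rw [← hd, hx, map_zero]
    obtain ⟨η, hη⟩ := D.eq_d_of_integralAInf_linear_eq F hF hx' hu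
    refine ⟨e.symm η, e.injective ?_⟩
    rw [hd, e.apply_symm_apply, hη]

end DGSpace

theorem mainTheorem8 {K V : Type*} [Field K] [CharZero K] [AddCommGroup V] [Module K V]
    (D : DGSpace K V) (F : Submodule K V) (hF : D.IsSubspace F) :
    -- the explicit values of the iterated integrals: on `a_i s^{j_i} (ds)^{b_i} t^{k_i} dt`, `i < n`,
    -- and `v s^{j_n} (ds)^{b_n} t^{k_n} dt`
    (∀ (n : ℕ) (a : Fin n → D.EndStar) (v : V) (deg : Fin (n + 1) → ℤ),
      (∀ i : Fin n, a i ∈ D.endAlg.gr (deg i.castSucc)) → v ∈ D.gr (deg (Fin.last n)) →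
      ∀ (j k : Fin (n + 1) → ℕ) (b : Fin (n + 1) → Bool),
        D.iteratedIntegral F n
            (Fin.snoc (fun i : Fin n => D.monomialForm (a i, 0) (j i.castSucc) (b i.castSucc)
                (k i.castSucc))
              (D.monomialForm (0, v) (j (Fin.last n)) (b (Fin.last n)) (k (Fin.last n)))) =
          if (Finset.univ.filter fun i => b i = true).card = 1 then
            (∏ i, ∏ l, if i < l ∧ b i = true then (deg l).negOnePow else 1) •
              ((((∑ i, j i : ℕ) : K) + 1)⁻¹ *
                ∏ l : Fin (n + 1), (((∑ i ∈ Finset.univ.filter (fun i => i ≤ l), (k i + 1) : ℕ) :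
                  K))⁻¹) •
              F.mkQ ((List.ofFn fun i => D.toEnd (a i)).prod v)
          else 0) ∧
    -- the vanishing on the other direct summands
    (∀ (n : ℕ) (ω : Fin (n + 1) → Forms K (Forms K (D.EndStar × V))),
      ((∃ i, Forms.dtCoeff (ω i) = 0) ∨
        (∃ i, i ≠ Fin.last n ∧
          Forms.map (Forms.map (LinearMap.fst K D.EndStar V)) (ω i) = 0) ∨
        Forms.map (Forms.map (LinearMap.snd K D.EndStar V)) (ω (Fin.last n)) = 0) →
      D.iteratedIntegral F n ω = 0) ∧
    -- the `A_∞` quasi-isomorphism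
    ∃ f : AInfMorphism (D.twAssoc F hF) (DGAlg.trivial ((D.quotient F hF).shift (-2))),
      (∀ (n : ℕ) (x : Fin (n + 1) → D.twAssocSub F),
        f.toFun (n + 1) x = D.iteratedIntegral F n fun i => (x i : Forms K (Forms K _))) ∧
      f.IsQuasiIso ∧
      -- the Thom-Whitney double fibre of the Jacobian square is the commutator DG-Lie algebra
      ∃ e : (D.jacobianSquare F hF).tw ≃ₗ[K] D.twAssocSub F,
        (∀ ω, (e ω : Forms K (Forms K (D.EndStar × V))) = ω.1.2.2.2) ∧
        (D.jacobianSquare F hF).twAlg.IsHom (D.twAssoc F hF).commutator e.toLinearMap ∧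
        -- the `L_∞` quasi-isomorphism, obtained by symmetrization
        ∃ g : LInfMorphism (D.jacobianSquare F hF).twAlg
            (DGAlg.trivial ((D.quotient F hF).shift (-2))),
          (∀ (n : ℕ) (x : ℕ → (D.jacobianSquare F hF).tw) (deg : ℕ → ℤ),
            (∀ i, x i ∈ (D.jacobianSquare F hF).twAlg.gr (deg i)) →
            (g.toFun n).onSeq x = ∑ σ : Equiv.Perm (Fin n), koszulSign σ deg •
              (f.toFun n).onSeq (seqPerm σ fun i => e (x i))) ∧
          g.IsQuasiIso := by
  refine ⟨fun n a v deg ha hv j k b => D.iteratedIntegral_monomial F n a v deg ha hv j k b,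
    fun n ω h => D.iteratedIntegral_eq_zero F n ω h, D.integralAInf F hF, fun _ _ => rfl,
    D.integralAInf_isQuasiIso F hF, D.doubleFibreEquiv F hF, fun _ => rfl,
    D.doubleFibreEquiv_isHom F hF,
    (D.integralAInf F hF).symmetrize (D.doubleFibreEquiv_isHom F hF), fun n x deg hx => ?_,
    D.integralAInf_symmetrize_isQuasiIso F hF⟩
  exact (D.integralAInf F hF).symmetrize_onSeq (D.doubleFibreEquiv_isHom F hF) n hx
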